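/- **Setting.** Let $\tau=\{\tau_0,\tau_1,\dots\}$ be a renewal process: $\tau_0=0$ and the increments $\tau_i-\tau_{i-1}$, $i\ge1$, are i.i.d. with values in the positive integers. Write $\mathbf P$, $\mathbf E$ for its law and expectation, $K(n)=\mathbf P[\tau_1=n]$, and assume that for some $\zeta\in(0,1)$ and $c_K>0$, $$K(n)=c_K(1+o(1))\exp(-n^{\zeta}),\qquad n\to\infty .$$ Let $\omega=(\omega_n)_{n\ge1}$ be an i.i.d. sequence of centered real random variables, defined on a probability space $(\Omega,\mathbb P)$ with expectation $\mathbb E$, with unit variance and with $\mathbb E[e^{t\omega_1}]<\infty$ for all $t\in\mathbb R$. Assume that there are constants $C_1,C_2>0$ such that for every $N$, every convex Lipschitz function $F:\mathbb R^N\to\mathbb R$ with Lipschitz constant $k>0$ for the Euclidean norm, and every $u>0$, $$\mathbb P\big(|F(\omega_1,\dots,\omega_N)-\mathbb E[F(\omega_1,\dots,\omega_N)]|\ge u\big)\le C_1\exp\Big(-\frac{u^2}{C_2k^2}\Big).$$ For $\beta>0$ and $h\in\mathbb R$, with $\delta_n=\mathbf 1_{\{n\in\tau\}}$, let $$Z_N^{\beta,h,\omega}=\mathbf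 E\Big[e^{\sum_{n=1}^N(\beta\omega_n+h)\delta_n}\,\delta_N\Big],\qquad \mathrm F(\beta,h)=\lim_{N\to\infty}\frac1N\mathbb E\big[\log Z_N^{\beta,h,\omega}\big],\qquad h_c(\beta)=\inf\{h\in\mathbb R:\mathrm F(\beta,h)>0\}.$$ **Theorem.** For all $\beta>0$ and $h\in\mathbb R$ the limit $\mathrm F(\beta,h)$ exists and is finite, and almost surely $\frac1N\log Z_N^{\beta,h,\omega}\to\mathrm F(\beta,h)$; for all $\beta>0$ the infimum $h_c(\beta)$ is finite. Moreover: (i) If $\zeta>1/2$, there is a constant $c>0$, not depending on $\beta$ or $h$, such that for all $\beta>0$ and $h\in\mathbb R$ $$\mathrm F(\beta,h)\ \ge\ c\,\min(1,\beta^{-2})\,(h-h_c(\beta))_+ .$$ (ii) If $\zeta\le1/2$, there are a constant $c>0$, not depending on $\beta$, and, for every $\beta>0$, a $u_0(\beta)>0$ such that for all $u\in(0,u_0(\beta))$ $$\mathrm F(\beta,h_c(\beta)+u)\ \ge\ c\left(\frac{u}{\beta^2|\log u|}\right)^{\frac{1-\zeta}{\zeta}} .$$ -/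

import Mathlib

open MeasureTheory ProbabilityTheory Filter Topology
open scoped NNReal

noncomputable section

namespace Pinning

/-- The random potential: an i.i.d. sequence of centered real random variables with unit variance
and finite exponential moments of all orders. `ω n` is the potential attached to the site `n + 1`,
so that the sites are `1, 2, 3, …`. -/
structure IsEnvironment {Ω : Type*} [MeasurableSpace Ω] (ω : ℕ → Ω → ℝ) (Pr : Measure Ω) :
    Prop where
  measurable : ∀ n, Measurable (ω n)
  indep : iIndepFun ω Pr
  ident : ∀ n, IdentDistrib (ω n) (ω 0) Pr Pr
  centered : ∫ w, ω 0 w ∂Pr = 0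
  unit_variance : variance (ω 0) Pr = 1
  exp_moments : ∀ t : ℝ, Integrable (fun w => Real.exp (t * ω 0 w)) Pr

/-- Dimension-free Gaussian concentration for convex Lipschitz functions of the environment,
with respect to the Euclidean norm. The bound for every Lipschitz constant `k > 0` of `F` is
equivalent to the bound for the smallest one. -/
def ConvexConcentration {Ω : Type*} [MeasurableSpace Ω] (ω : ℕ → Ω → ℝ) (Pr : Measure Ω) : Prop :=
  ∃ C₁ C₂ : ℝ, 0 < C₁ ∧ 0 < C₂ ∧
    ∀ (N : ℕ) (F : EuclideanSpace ℝ (Fin N) → ℝ) (k : ℝ≥0), 0 < k →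
      LipschitzWith k F → ConvexOn ℝ Set.univ F → ∀ u : ℝ, 0 < u →
        Pr.real {w | u ≤ |F (WithLp.toLp 2 fun i : Fin N => ω i w)
            - ∫ w', F (WithLp.toLp 2 fun i : Fin N => ω i w') ∂Pr|}
          ≤ C₁ * Real.exp (-(u ^ 2 / (C₂ * (k : ℝ) ^ 2)))

/-- The increments of a (recurrent) renewal process: i.i.d. random variables with values in the
positive integers. `ξ i` is the increment `τ_{i+1} - τ_i`. -/
structure IsRenewalIncrements {S : Type*} [MeasurableSpace S] (ξ : ℕ → S → ℕ) (P : Measure S) :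
    Prop where
  measurable : ∀ i, Measurable (ξ i)
  indep : iIndepFun ξ P
  ident : ∀ i, IdentDistrib (ξ i) (ξ 0) P P
  pos : ∀ i s, 0 < ξ i s

/-- The inter-arrival law `K(n) = P(τ₁ = n)`. -/
def interarrivalLaw {S : Type*} [MeasurableSpace S] (ξ : ℕ → S → ℕ) (P : Measure S) (n : ℕ) : ℝ :=
  P.real {s | ξ 0 s = n}

/-- The set of renewal points `τ = {τ₀, τ₁, …}`, where `τ_i = ξ₀ + ⋯ + ξ_{i-1}` and `τ₀ = 0`. -/
def renewalSet {S : Type*} (ξ : ℕ → S → ℕ) (s : S) : Set ℕ :=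
  Set.range fun i : ℕ => ∑ j ∈ Finset.range i, ξ j s

/-- The contact variable `δ_n`, equal to `1` if `n ∈ τ` and to `0` otherwise. -/
def contact {S : Type*} (ξ : ℕ → S → ℕ) (n : ℕ) (s : S) : ℝ :=
  (renewalSet ξ s).indicator (fun _ => (1 : ℝ)) n

/-- The partition function `E[exp(∑_{n=1}^N (β ω_n + h) δ_n) δ_N]` of the system pinned at `N`,
for a fixed realization `x` of the environment (`x n` sits at the site `n + 1`). -/
def partitionFunction {S : Type*} [MeasurableSpace S] (ξ : ℕ → S → ℕ) (P : Measure S)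
    (β h : ℝ) (x : ℕ → ℝ) (N : ℕ) : ℝ :=
  ∫ s, Real.exp (∑ n ∈ Finset.range N, (β * x n + h) * contact ξ (n + 1) s) * contact ξ N s ∂P

/-- The free energy: the limit of `N⁻¹ 𝔼[log Z_N]`. -/
def freeEnergy {Ω S : Type*} [MeasurableSpace Ω] [MeasurableSpace S] (ω : ℕ → Ω → ℝ)
    (Pr : Measure Ω) (ξ : ℕ → S → ℕ) (P : Measure S) (β h : ℝ) : ℝ :=
  limUnder atTop fun N : ℕ =>
    (N : ℝ)⁻¹ * ∫ w, Real.log (partitionFunction ξ P β h (fun n => ω n w) N) ∂Pr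

/-- The critical point: the infimum of the `h` for which the free energy is positive. -/
def criticalPoint {Ω S : Type*} [MeasurableSpace Ω] [MeasurableSpace S] (ω : ℕ → Ω → ℝ)
    (Pr : Measure Ω) (ξ : ℕ → S → ℕ) (P : Measure S) (β : ℝ) : ℝ :=
  sInf {h : ℝ | 0 < freeEnergy ω Pr ξ P β h}

end Pinning

end

/-! The logarithm of a restricted partition function is convex in the environment and, if its
trajectories have at most `M` contacts, Lipschitz with constant `β√M`. A sparse system thus
fluctuates little, and the proof shows that a system that is too sparse cannot have positive free
energy. Precisely (`exists_contact_density_lower_bound`): when `0 < F(β,h) ≤ 1`, the slope of `F` to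
the right of `h` exceeds every small `p > 0` such that `β² p n log n ≤ κ (n^ζ + F n)²` at all scales
`n ≥ L`.

Suppose the slope is at most `p`. By convexity in `h`, the mean number of contacts is then `O(pN)`.
Since `F > 0`, a single jump over a very long distance is an unlikely way to cover it. The descent
(`exists_descent`) carries this property from all lengths `j > n` to `n` itself. If jumps longer
than `n` are rare, typical trajectories split into pieces of length at most `n/2` and single jumps.
There are only `exp(O((N/n) log n))` coarse shapes, and the fluctuation per block is of order `√(β²
p n log n)`; both are small against `n^ζ + F n`. Hence one shape carries almost the whole free
energy (`exists_config_meanLog_ge`), and by pigeonhole one of its pieces has length `ℓ` comparable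
to `n`, few contacts, and a mean log partition function close to its maximal value `F ℓ`
(`exists_good_segment`). A bounded number of copies of that piece followed by a jump of length at
most `3n/4` beats the single jump of length `n`, because the stretched exponential tail makes the
shorter jump cheaper by `exp(θ n^ζ)`. Descending to the fixed scale `L`, most sites lie under jumps
of length at most `L`, which forces a contact density of order `1/L` and contradicts the smallness
of `p`.

If `ζ > 1/2`, then `n log n = O(n^{2ζ})`, so a constant `p` is admissible and `F` grows linearly. If
`ζ ≤ 1/2`, the constraint is tightest near `n = F^{-1/(1-ζ)}`, where `n^ζ = F n`. It allows `p` of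
order `F^{1-γ} / (β² |log F|)` with `γ = ζ/(1-ζ)`. Integrating `F' ≥ p` gives `F^γ |log F| ≥ c u /
β²`, and inverting this yields the exponent `1/γ`. -/

noncomputable section

namespace Pinning

/-! ### Trajectories -/

/-- The trajectories of a renewal process from `0` to `N`, as lists of positive jumps. -/
def trajectories (N : ℕ) : Finset (List ℕ) :=
  Finset.univ.image (Composition.blocks : Composition N → List ℕ)

lemma mem_trajectories {N : ℕ} {l : List ℕ} :
    l ∈ trajectories N ↔ (∀ i ∈ l, 0 < i) ∧ l.sum = N := by
  unfold trajectories
  simp only [Finset.mem_image, Finset.mem_univ, true_and]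
  constructor
  · rintro ⟨c, rfl⟩
    exact ⟨fun i hi => c.blocks_pos hi, c.blocks_sum⟩
  · rintro ⟨h1, h2⟩
    exact ⟨⟨l, fun {i} hi => h1 i hi, h2⟩, rfl⟩

lemma singleton_mem_trajectories {N : ℕ} (hN : 0 < N) : [N] ∈ trajectories N := by
  simp [mem_trajectories, hN]

lemma trajectories_zero : trajectories 0 = {[]} := by
  ext l
  rw [mem_trajectories, Finset.mem_singleton]
  constructor
  · rintro ⟨h1, h2⟩
    cases l with
    | nil => rfl
    | cons j l =>
      have := h1 j (by simp)
      simp at h2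
      omega
  · rintro rfl
    simp

lemma sum_trajectories {M : Type*} [AddCommMonoid M] {N : ℕ} (hN : 0 < N) (f : List ℕ → M) :
    ∑ l ∈ trajectories N, f l =
      ∑ j ∈ Finset.Icc 1 N, ∑ l ∈ trajectories (N - j), f (j :: l) := by
  rw [Finset.sum_sigma']
  symm
  refine Finset.sum_bij (fun p _ => p.1 :: p.2) ?_ ?_ ?_ ?_
  · rintro ⟨j, l⟩ h
    simp only [Finset.mem_sigma, Finset.mem_Icc, mem_trajectories] at h ⊢
    refine ⟨?_, ?_⟩
    · intro i hi
      rcases List.mem_cons.1 hi with rfl | hi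
      · omega
      · exact h.2.1 i hi
    · simp only [List.sum_cons]
      omega
  · rintro ⟨j, l⟩ _ ⟨j', l'⟩ _ h
    simp only [List.cons.injEq] at h
    obtain ⟨rfl, rfl⟩ := h
    rfl
  · intro l hl
    rw [mem_trajectories] at hl
    cases l with
    | nil => simp at hl; omega
    | cons j l =>
      have h1 := hl.1 j (by simp)
      have h2 := hl.2
      simp only [List.sum_cons] at h2
      refine ⟨⟨j, l⟩, ?_, rfl⟩
      simp only [Finset.mem_sigma, Finset.mem_Icc, mem_trajectories]
      refine ⟨by omega, fun i hi => hl.1 i (by simp [hi]), by omega⟩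
  · intros
    rfl

lemma length_le_sum {l : List ℕ} (h : ∀ i ∈ l, 0 < i) : l.length ≤ l.sum := by
  induction l with
  | nil => simp
  | cons j l ih =>
    have := ih fun i hi => h i (by simp [hi])
    have := h j (by simp)
    simp only [List.length_cons, List.sum_cons]
    omega

/-- All concatenations of a trajectory in `X` with a trajectory in `Y`. -/
def concat (X Y : Finset (List ℕ)) : Finset (List ℕ) :=
  (X ×ˢ Y).image fun p => p.1 ++ p.2

lemma mem_concat {X Y : Finset (List ℕ)} {l : List ℕ} :
    l ∈ concat X Y ↔ ∃ l₁ ∈ X, ∃ l₂ ∈ Y, l₁ ++ l₂ = l := by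
  simp only [concat, Finset.mem_image, Finset.mem_product, Prod.exists]
  constructor
  · rintro ⟨a, b, ⟨h1, h2⟩, h⟩
    exact ⟨a, h1, b, h2, h⟩
  · rintro ⟨a, h1, b, h2, h⟩
    exact ⟨a, b, ⟨h1, h2⟩, h⟩

lemma concat_subset {X Y : Finset (List ℕ)} {a b : ℕ} (hX : X ⊆ trajectories a)
    (hY : Y ⊆ trajectories b) : concat X Y ⊆ trajectories (a + b) := by
  intro l hl
  obtain ⟨l₁, h₁, l₂, h₂, rfl⟩ := mem_concat.1 hl
  have h₁ := mem_trajectories.1 (hX h₁)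
  have h₂ := mem_trajectories.1 (hY h₂)
  rw [mem_trajectories]
  refine ⟨fun i hi => ?_, by simp [h₁.2, h₂.2]⟩
  rcases List.mem_append.1 hi with hi | hi
  exacts [h₁.1 i hi, h₂.1 i hi]

/-- Partial sums of positive jumps increase strictly, so the total of the prefix fixes where it
ends. Concatenation is therefore injective, and restricted partition functions of concatenations
factorize. -/
lemma append_left_cancel_of_sum {l₁ l₁' l₂ l₂' : List ℕ} (h₁ : ∀ i ∈ l₁, 0 < i)
    (h₁' : ∀ i ∈ l₁', 0 < i) (hs : l₁.sum = l₁'.sum) (h : l₁ ++ l₂ = l₁' ++ l₂') :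
    l₁ = l₁' ∧ l₂ = l₂' := by
  induction l₁ generalizing l₁' with
  | nil =>
    cases l₁' with
    | nil => simpa using h
    | cons j l =>
      have := h₁' j (by simp)
      simp at hs
      omega
  | cons j l ih =>
    cases l₁' with
    | nil =>
      have := h₁ j (by simp)
      simp at hs
      omega
    | cons j' l' =>
      simp only [List.cons_append, List.cons.injEq] at h
      obtain ⟨rfl, h⟩ := h
      have := ih (fun i hi => h₁ i (by simp [hi])) (l₁' := l') (fun i hi => h₁' i (by simp [hi]))
        (by simpa using hs) h
      simp [this.1, this.2]

lemma sum_concat {M : Type*} [AddCommMonoid M] {X Y : Finset (List ℕ)} {a : ℕ}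
    (hX : X ⊆ trajectories a) (f : List ℕ → M) :
    ∑ l ∈ concat X Y, f l = ∑ l₁ ∈ X, ∑ l₂ ∈ Y, f (l₁ ++ l₂) := by
  rw [concat, Finset.sum_image, Finset.sum_product]
  rintro ⟨l₁, l₂⟩ h ⟨l₁', l₂'⟩ h' he
  simp only [Finset.coe_product, Set.mem_prod, Finset.mem_coe] at h h'
  have h1 := mem_trajectories.1 (hX h.1)
  have h2 := mem_trajectories.1 (hX h'.1)
  obtain ⟨rfl, rfl⟩ : l₁ = l₁' ∧ l₂ = l₂' :=
    append_left_cancel_of_sum h1.1 h2.1 (h1.2.trans h2.2.symm) he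
  rfl

/-! ### Shifts, energies and weights -/

/-- The environment seen from the site `a`. -/
def shift (a : ℕ) (x : ℕ → ℝ) : ℕ → ℝ := fun n => x (n + a)

lemma shift_shift (a b : ℕ) (x : ℕ → ℝ) : shift a (shift b x) = shift (b + a) x := by
  ext n
  simp only [shift]
  congr 1
  omega

lemma shift_zero (x : ℕ → ℝ) : shift 0 x = x := rfl

/-- The sites of a trajectory; the site `n + 1` is represented by `n`. -/
def sites : List ℕ → Finset ℕ
  | [] => ∅
  | j :: l => insert (j - 1) ((sites l).map (addRightEmbedding j))

/-- The total potential collected by a trajectory. -/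
def energy (x : ℕ → ℝ) (l : List ℕ) : ℝ := ∑ i ∈ sites l, x i

lemma energy_nil (x : ℕ → ℝ) : energy x [] = 0 := by simp [energy, sites]

lemma energy_cons (x : ℕ → ℝ) {j : ℕ} (hj : 0 < j) (l : List ℕ) :
    energy x (j :: l) = x (j - 1) + energy (shift j x) l := by
  rw [energy, sites, Finset.sum_insert, Finset.sum_map]
  · rfl
  · simp only [Finset.mem_map, addRightEmbedding_apply, not_exists, not_and]
    intro i _
    omega

lemma energy_append (x : ℕ → ℝ) {l₁ : List ℕ} (h : ∀ i ∈ l₁, 0 < i) (l₂ : List ℕ) :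
    energy x (l₁ ++ l₂) = energy x l₁ + energy (shift l₁.sum x) l₂ := by
  induction l₁ generalizing x with
  | nil => simp [energy_nil, shift_zero]
  | cons j l ih =>
    have hj := h j (by simp)
    rw [List.cons_append, energy_cons _ hj, energy_cons _ hj, ih _ fun i hi => h i (by simp [hi]),
      shift_shift, List.sum_cons, add_assoc]

lemma card_sites {l : List ℕ} (h : ∀ i ∈ l, 0 < i) : (sites l).card = l.length := by
  induction l with
  | nil => simp [sites]
  | cons j l ih =>
    have hj := h j (by simp)
    rw [sites, Finset.card_insert_of_notMem, Finset.card_map, ih fun i hi => h i (by simp [hi]),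
      List.length_cons]
    simp only [Finset.mem_map, addRightEmbedding_apply, not_exists, not_and]
    intro i _
    omega

lemma sites_subset {l : List ℕ} (h : ∀ i ∈ l, 0 < i) : sites l ⊆ Finset.range l.sum := by
  induction l with
  | nil => simp [sites]
  | cons j l ih =>
    have hj := h j (by simp)
    have ih := ih fun i hi => h i (by simp [hi])
    intro i hi
    rw [sites, Finset.mem_insert, Finset.mem_map] at hi
    rw [Finset.mem_range, List.sum_cons]
    rcases hi with rfl | ⟨k, hk, rfl⟩
    · omega
    · have := Finset.mem_range.1 (ih hk)
      simp only [addRightEmbedding_apply]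
      omega

variable (K : ℕ → ℝ) (β h : ℝ)

/-- The restricted partition function: the sum of the Gibbs weights of the trajectories in `X`. -/
def partialSum (X : Finset (List ℕ)) (x : ℕ → ℝ) : ℝ :=
  ∑ l ∈ X, (l.map K).prod * Real.exp (β * energy x l + h * l.length)

/-- `X` contains a trajectory with positive probability. -/
def Feasible (X : Finset (List ℕ)) : Prop := ∃ l ∈ X, 0 < (l.map K).prod

variable {K β h}

lemma prod_nonneg_of_nonneg (hK : ∀ n, 0 ≤ K n) (l : List ℕ) : 0 ≤ (l.map K).prod := by
  apply List.prod_nonneg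
  intro a ha
  obtain ⟨b, _, rfl⟩ := List.mem_map.1 ha
  exact hK b

lemma partialSum_nonneg (hK : ∀ n, 0 ≤ K n) (X : Finset (List ℕ)) (x : ℕ → ℝ) :
    0 ≤ partialSum K β h X x :=
  Finset.sum_nonneg fun l _ => mul_nonneg (prod_nonneg_of_nonneg hK l) (Real.exp_pos _).le

lemma partialSum_pos (hK : ∀ n, 0 ≤ K n) {X : Finset (List ℕ)} (hX : Feasible K X) (x : ℕ → ℝ) :
    0 < partialSum K β h X x := by
  obtain ⟨l, hl, hp⟩ := hX
  refine lt_of_lt_of_le (mul_pos hp (Real.exp_pos (β * energy x l + h * l.length))) ?_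
  exact Finset.single_le_sum (f := fun l : List ℕ => (l.map K).prod *
    Real.exp (β * energy x l + h * l.length))
    (fun l _ => mul_nonneg (prod_nonneg_of_nonneg hK l) (Real.exp_pos _).le) hl

lemma partialSum_mono (hK : ∀ n, 0 ≤ K n) {X Y : Finset (List ℕ)} (hXY : X ⊆ Y) (x : ℕ → ℝ) :
    partialSum K β h X x ≤ partialSum K β h Y x :=
  Finset.sum_le_sum_of_subset_of_nonneg hXY
    fun l _ _ => mul_nonneg (prod_nonneg_of_nonneg hK l) (Real.exp_pos _).le

lemma Feasible.mono {X Y : Finset (List ℕ)} (hX : Feasible K X) (hXY : X ⊆ Y) : Feasible K Y := by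
  obtain ⟨l, hl, hp⟩ := hX
  exact ⟨l, hXY hl, hp⟩

lemma Feasible.concat {X Y : Finset (List ℕ)} (hX : Feasible K X) (hY : Feasible K Y) :
    Feasible K (concat X Y) := by
  obtain ⟨l, hl, hp⟩ := hX
  obtain ⟨l', hl', hp'⟩ := hY
  exact ⟨l ++ l', mem_concat.2 ⟨l, hl, l', hl', rfl⟩, by simpa using mul_pos hp hp'⟩

lemma weight_append (x : ℕ → ℝ) {l₁ : List ℕ} (hl : ∀ i ∈ l₁, 0 < i) (l₂ : List ℕ) :
    ((l₁ ++ l₂).map K).prod * Real.exp (β * energy x (l₁ ++ l₂) + h * (l₁ ++ l₂).length) =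
      ((l₁.map K).prod * Real.exp (β * energy x l₁ + h * l₁.length)) *
      ((l₂.map K).prod * Real.exp (β * energy (shift l₁.sum x) l₂ + h * l₂.length)) := by
  rw [energy_append x hl, List.map_append, List.prod_append, List.length_append, Nat.cast_add,
    show β * (energy x l₁ + energy (shift l₁.sum x) l₂) + h * (l₁.length + l₂.length) =
      (β * energy x l₁ + h * l₁.length) + (β * energy (shift l₁.sum x) l₂ + h * l₂.length) by ring,
    Real.exp_add]
  ring

lemma partialSum_concat {X Y : Finset (List ℕ)} {a : ℕ} (hX : X ⊆ trajectories a) (x : ℕ → ℝ) :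
    partialSum K β h (concat X Y) x = partialSum K β h X x * partialSum K β h Y (shift a x) := by
  rw [partialSum, sum_concat hX, partialSum, partialSum, Finset.sum_mul_sum]
  refine Finset.sum_congr rfl fun l₁ h₁ => Finset.sum_congr rfl fun l₂ _ => ?_
  have h₁ := mem_trajectories.1 (hX h₁)
  rw [weight_append x h₁.1, h₁.2]

/-- The Gibbs weight of a single jump of length `j`. -/
def jumpWeight (K : ℕ → ℝ) (β h : ℝ) (j : ℕ) (x : ℕ → ℝ) : ℝ :=
  K j * Real.exp (β * x (j - 1) + h)

lemma jumpWeight_nonneg (hK : ∀ n, 0 ≤ K n) (j : ℕ) (x : ℕ → ℝ) : 0 ≤ jumpWeight K β h j x :=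
  mul_nonneg (hK j) (Real.exp_pos _).le

lemma partialSum_singleton {j : ℕ} (hj : 0 < j) (x : ℕ → ℝ) :
    partialSum K β h {[j]} x = jumpWeight K β h j x := by
  simp [partialSum, jumpWeight, energy_cons _ hj, energy_nil]

lemma singleton_subset_trajectories {j : ℕ} (hj : 0 < j) : {[j]} ⊆ trajectories j :=
  Finset.singleton_subset_iff.2 (singleton_mem_trajectories hj)

lemma jumpWeight_le (hK : ∀ n, 0 ≤ K n) {j : ℕ} (hj : 0 < j) (x : ℕ → ℝ) :
    jumpWeight K β h j x ≤ partialSum K β h (trajectories j) x := by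
  rw [← partialSum_singleton hj]
  exact partialSum_mono hK (singleton_subset_trajectories hj) x

lemma feasible_singleton {j : ℕ} (hj : 0 < K j) : Feasible K {[j]} :=
  ⟨[j], by simp, by simpa using hj⟩

lemma partialSum_mul_le (hK : ∀ n, 0 ≤ K n) {X Y : Finset (List ℕ)} {a b : ℕ}
    (hX : X ⊆ trajectories a) (hY : Y ⊆ trajectories b) (x : ℕ → ℝ) :
    partialSum K β h X x * partialSum K β h Y (shift a x)
      ≤ partialSum K β h (trajectories (a + b)) x := by
  rw [← partialSum_concat hX]
  exact partialSum_mono hK (concat_subset hX hY) x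

lemma weight_cons {j : ℕ} (hj : 0 < j) (l : List ℕ) (x : ℕ → ℝ) :
    ((j :: l).map K).prod * Real.exp (β * energy x (j :: l) + h * (j :: l).length) =
      jumpWeight K β h j x *
        ((l.map K).prod * Real.exp (β * energy (shift j x) l + h * l.length)) := by
  have := weight_append (K := K) (β := β) (h := h) x (l₁ := [j]) (by simp [hj]) l
  simpa [jumpWeight, energy_cons _ hj, energy_nil] using this

lemma sum_prod_le_one (hK : ∀ n, 0 ≤ K n) (hK1 : ∀ N, ∑ j ∈ Finset.Icc 1 N, K j ≤ 1) (N : ℕ) :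
    ∑ l ∈ trajectories N, (l.map K).prod ≤ 1 := by
  induction N using Nat.strong_induction_on with
  | _ N ih =>
    rcases Nat.eq_zero_or_pos N with rfl | hN
    · simp [trajectories_zero]
    · rw [sum_trajectories hN]
      refine le_trans ?_ (hK1 N)
      refine Finset.sum_le_sum fun j hj => ?_
      rw [Finset.mem_Icc] at hj
      simp only [List.map_cons, List.prod_cons]
      rw [← Finset.mul_sum]
      exact mul_le_of_le_one_right (hK j) (ih _ (by omega))

/-! ### Log-sum-exp functions -/

/-- Tangent-line inequality for log-sum-exp: Jensen for `exp` under the Gibbs weights at `φ`. It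
serves twice, for convexity in the environment and for bounding the mean number of contacts by an
increment in `h`. -/
lemma log_sum_exp_sub_ge {ι : Type*} {s : Finset ι} {k φ ψ : ι → ℝ} (hk : ∀ i ∈ s, 0 ≤ k i)
    (hpos : ∃ i ∈ s, 0 < k i) :
    (∑ i ∈ s, k i * Real.exp (φ i) * (ψ i - φ i)) / (∑ i ∈ s, k i * Real.exp (φ i)) ≤
      Real.log (∑ i ∈ s, k i * Real.exp (ψ i)) - Real.log (∑ i ∈ s, k i * Real.exp (φ i)) := by
  have key : ∀ χ : ι → ℝ, 0 < ∑ i ∈ s, k i * Real.exp (χ i) := fun χ => by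
    obtain ⟨i, hi, hp⟩ := hpos
    exact Finset.sum_pos' (fun j hj => mul_nonneg (hk j hj) (Real.exp_pos _).le)
      ⟨i, hi, mul_pos hp (Real.exp_pos _)⟩
  set S := ∑ i ∈ s, k i * Real.exp (φ i) with hS
  have hSpos : 0 < S := key φ
  rw [← Real.log_div (key ψ).ne' hSpos.ne', Real.le_log_iff_exp_le (div_pos (key ψ) hSpos)]
  have hJ := convexOn_exp.map_sum_le (t := s) (w := fun i => k i * Real.exp (φ i) / S)
    (p := fun i => ψ i - φ i)
    (fun i hi => div_nonneg (mul_nonneg (hk i hi) (Real.exp_pos _).le) hSpos.le)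
    (by rw [← Finset.sum_div, div_self hSpos.ne']) (fun i _ => Set.mem_univ _)
  simp only [smul_eq_mul] at hJ
  calc Real.exp ((∑ i ∈ s, k i * Real.exp (φ i) * (ψ i - φ i)) / S)
      = Real.exp (∑ i ∈ s, k i * Real.exp (φ i) / S * (ψ i - φ i)) := by
        rw [Finset.sum_div]
        exact congrArg _ (Finset.sum_congr rfl fun i _ => by ring)
    _ ≤ _ := hJ
    _ = _ := by
        rw [Finset.sum_div]
        refine Finset.sum_congr rfl fun i _ => ?_
        rw [Real.exp_sub]
        have := (Real.exp_pos (φ i)).ne'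
        field_simp

lemma log_sum_exp_sub_le {ι : Type*} {s : Finset ι} {k φ ψ : ι → ℝ} {B : ℝ}
    (hk : ∀ i ∈ s, 0 ≤ k i) (hpos : ∃ i ∈ s, 0 < k i) (hB : ∀ i ∈ s, ψ i - φ i ≤ B) :
    Real.log (∑ i ∈ s, k i * Real.exp (ψ i)) - Real.log (∑ i ∈ s, k i * Real.exp (φ i)) ≤ B := by
  have key : ∀ χ : ι → ℝ, 0 < ∑ i ∈ s, k i * Real.exp (χ i) := fun χ => by
    obtain ⟨i, hi, hp⟩ := hpos
    exact Finset.sum_pos' (fun j hj => mul_nonneg (hk j hj) (Real.exp_pos _).le)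
      ⟨i, hi, mul_pos hp (Real.exp_pos _)⟩
  rw [sub_le_iff_le_add, Real.log_le_iff_le_exp (key ψ), Real.exp_add, Real.exp_log (key φ),
    Finset.mul_sum]
  refine Finset.sum_le_sum fun i hi => ?_
  rw [show Real.exp B * (k i * Real.exp (φ i)) = k i * Real.exp (B + φ i) by
    rw [Real.exp_add]; ring]
  exact mul_le_mul_of_nonneg_left (Real.exp_le_exp.2 (by linarith [hB i hi])) (hk i hi)

end Pinning
end

noncomputable section

namespace Pinning

/-! ### Stationary environments -/

/-- A stationary centered law of the environment with Gaussian concentration for convex functions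
and annealed exponential moments. -/
structure IsStationaryLaw (μ : Measure (ℕ → ℝ)) (C₁ C₂ : ℝ) : Prop where
  prob : IsProbabilityMeasure μ
  stationary : ∀ a, MeasurePreserving (shift a) μ μ
  integrable : ∀ n, Integrable (fun x : ℕ → ℝ => x n) μ
  centered : ∀ n, ∫ x, x n ∂μ = 0
  exp_moments : ∀ β : ℝ, ∃ c : ℝ, ∀ s : Finset ℕ,
    Integrable (fun x : ℕ → ℝ => Real.exp (β * ∑ i ∈ s, x i)) μ ∧
      ∫ x, Real.exp (β * ∑ i ∈ s, x i) ∂μ ≤ Real.exp (c * s.card)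
  pos₁ : 0 < C₁
  pos₂ : 0 < C₂
  concentration : ∀ (N : ℕ) (F : EuclideanSpace ℝ (Fin N) → ℝ) (k : ℝ≥0), 0 < k →
      LipschitzWith k F → ConvexOn ℝ Set.univ F → ∀ u : ℝ, 0 < u →
        μ.real {x | u ≤ |F (WithLp.toLp 2 fun i : Fin N => x i)
            - ∫ x', F (WithLp.toLp 2 fun i : Fin N => x' i) ∂μ|}
          ≤ C₁ * Real.exp (-(u ^ 2 / (C₂ * (k : ℝ) ^ 2)))

/-- The mean of the logarithm of the restricted partition function. -/
def meanLog (K : ℕ → ℝ) (β h : ℝ) (μ : Measure (ℕ → ℝ)) (X : Finset (List ℕ)) : ℝ :=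
  ∫ x, Real.log (partialSum K β h X x) ∂μ

variable {K : ℕ → ℝ} {β h : ℝ} {μ : Measure (ℕ → ℝ)} {C₁ C₂ : ℝ}

lemma energy_sub (x y : ℕ → ℝ) (l : List ℕ) : energy (x - y) l = energy x l - energy y l := by
  simp [energy]

lemma energy_congr {N : ℕ} {l : List ℕ} (hl : l ∈ trajectories N) {x y : ℕ → ℝ}
    (hxy : ∀ i < N, x i = y i) : energy x l = energy y l := by
  rw [mem_trajectories] at hl
  refine Finset.sum_congr rfl fun i hi => hxy i ?_
  have := sites_subset hl.1 hi
  rwa [hl.2, Finset.mem_range] at this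

lemma abs_energy_le {N : ℕ} {l : List ℕ} (hl : l ∈ trajectories N) (x : ℕ → ℝ) :
    |energy x l| ≤ ∑ i ∈ Finset.range N, |x i| := by
  rw [mem_trajectories] at hl
  refine (Finset.abs_sum_le_sum_abs _ _).trans ?_
  have := sites_subset hl.1
  rw [hl.2] at this
  exact Finset.sum_le_sum_of_subset_of_nonneg this fun _ _ _ => abs_nonneg _

/-- Cauchy–Schwarz over the visited sites only. This is how the number of contacts, rather than the
length of the system, enters the Lipschitz constant. -/
lemma abs_energy_le_sqrt {N : ℕ} {l : List ℕ} (hl : l ∈ trajectories N) (x : ℕ → ℝ) :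
    |energy x l| ≤ √l.length * √(∑ i ∈ Finset.range N, x i ^ 2) := by
  rw [mem_trajectories] at hl
  rw [← Real.sqrt_mul (Nat.cast_nonneg _)]
  refine Real.abs_le_sqrt ?_
  refine (sq_sum_le_card_mul_sum_sq).trans ?_
  rw [card_sites hl.1]
  have := sites_subset hl.1
  rw [hl.2] at this
  exact mul_le_mul_of_nonneg_left
    (Finset.sum_le_sum_of_subset_of_nonneg this fun _ _ _ => sq_nonneg _) (Nat.cast_nonneg _)

lemma length_le_of_mem {N : ℕ} {l : List ℕ} (hl : l ∈ trajectories N) : l.length ≤ N := by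
  rw [mem_trajectories] at hl
  exact hl.2 ▸ length_le_sum hl.1

lemma measurable_energy (l : List ℕ) : Measurable fun x => energy x l :=
  Finset.measurable_sum _ fun i _ => measurable_pi_apply i

lemma measurable_partialSum (X : Finset (List ℕ)) : Measurable (partialSum K β h X) :=
  Finset.measurable_sum _ fun l _ => Measurable.const_mul
    (Real.measurable_exp.comp (((measurable_energy l).const_mul β).add_const _)) _

lemma measurable_log_partialSum (X : Finset (List ℕ)) :
    Measurable fun x => Real.log (partialSum K β h X x) :=
  Real.measurable_log.comp (measurable_partialSum X)

lemma abs_log_partialSum_sub_le (hK : ∀ n, 0 ≤ K n) {X : Finset (List ℕ)}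
    (hf : Feasible K X) (x y : ℕ → ℝ) {B : ℝ}
    (hB : ∀ l ∈ X, |energy (x - y) l| ≤ B) :
    |Real.log (partialSum K β h X x) - Real.log (partialSum K β h X y)| ≤ |β| * B := by
  have key : ∀ l ∈ X, |β * (energy x l - energy y l)| ≤ |β| * B := fun l hl => by
    rw [abs_mul, ← energy_sub]
    exact mul_le_mul_of_nonneg_left (hB l hl) (abs_nonneg β)
  rw [abs_sub_le_iff]
  constructor
  · refine log_sum_exp_sub_le (fun l _ => prod_nonneg_of_nonneg hK l) hf fun l hl => ?_
    have := (abs_le.1 (key l hl)).2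
    linarith
  · refine log_sum_exp_sub_le (fun l _ => prod_nonneg_of_nonneg hK l) hf fun l hl => ?_
    have := (abs_le.1 (key l hl)).1
    linarith

lemma integrable_log_partialSum (hμ : IsStationaryLaw μ C₁ C₂) (hK : ∀ n, 0 ≤ K n) {N : ℕ}
    {X : Finset (List ℕ)} (hX : X ⊆ trajectories N) (hf : Feasible K X) :
    Integrable (fun x => Real.log (partialSum K β h X x)) μ := by
  have := hμ.prob
  have h1 : Integrable (fun x : ℕ → ℝ => |Real.log (partialSum K β h X 0)| +
      |β| * ∑ i ∈ Finset.range N, |x i|) μ :=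
    (integrable_const _).add ((integrable_finsetSum _ fun i _ => (hμ.integrable i).abs).const_mul _)
  refine h1.mono' (measurable_log_partialSum X).aestronglyMeasurable (Eventually.of_forall fun x => ?_)
  rw [Real.norm_eq_abs]
  have := abs_log_partialSum_sub_le (β := β) (h := h) hK hf x 0 (B := ∑ i ∈ Finset.range N, |x i|)
    (fun l hl => by simpa using abs_energy_le (hX hl) x)
  have h3 := abs_sub_abs_le_abs_sub (Real.log (partialSum K β h X x))
    (Real.log (partialSum K β h X 0))
  linarith

/-- The tangents at `χ` towards `φ` and `ψ` are averaged with weights `a`, `b`; their slopes cancel.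
-/
lemma log_sum_exp_convex {ι : Type*} {s : Finset ι} {k φ ψ χ : ι → ℝ} {a b : ℝ}
    (hk : ∀ i ∈ s, 0 ≤ k i) (hpos : ∃ i ∈ s, 0 < k i) (ha : 0 ≤ a) (hb : 0 ≤ b) (hab : a + b = 1)
    (hχ : ∀ i ∈ s, χ i = a * φ i + b * ψ i) :
    Real.log (∑ i ∈ s, k i * Real.exp (χ i)) ≤ a * Real.log (∑ i ∈ s, k i * Real.exp (φ i)) +
      b * Real.log (∑ i ∈ s, k i * Real.exp (ψ i)) := by
  have h1 := mul_le_mul_of_nonneg_left (log_sum_exp_sub_ge (φ := χ) (ψ := φ) hk hpos) ha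
  have h2 := mul_le_mul_of_nonneg_left (log_sum_exp_sub_ge (φ := χ) (ψ := ψ) hk hpos) hb
  have h3 : a * ((∑ i ∈ s, k i * Real.exp (χ i) * (φ i - χ i)) / (∑ i ∈ s, k i * Real.exp (χ i))) +
      b * ((∑ i ∈ s, k i * Real.exp (χ i) * (ψ i - χ i)) /
        (∑ i ∈ s, k i * Real.exp (χ i))) = 0 := by
    rw [mul_div_assoc', mul_div_assoc', ← add_div, Finset.mul_sum, Finset.mul_sum,
      ← Finset.sum_add_distrib, Finset.sum_eq_zero, zero_div]
    intro i hi
    rw [show a * (k i * Real.exp (χ i) * (φ i - χ i)) + b * (k i * Real.exp (χ i) * (ψ i - χ i)) =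
      k i * Real.exp (χ i) * (a * φ i + b * ψ i - (a + b) * χ i) by ring, hab, hχ i hi]
    ring
  have h4 : a * Real.log (∑ i ∈ s, k i * Real.exp (χ i)) +
    b * Real.log (∑ i ∈ s, k i * Real.exp (χ i)) = Real.log (∑ i ∈ s, k i * Real.exp (χ i)) := by
    rw [← add_mul, hab, one_mul]
  linarith

/-- Extension of a finite environment by zero. -/
def extendZero {N : ℕ} (v : EuclideanSpace ℝ (Fin N)) : ℕ → ℝ :=
  fun n => if hn : n < N then v ⟨n, hn⟩ else 0

/-- The gain over a plain concentration bound is that `M` may be far smaller than `N`: the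
fluctuations are of order `β√M`. -/
lemma concentration_log_partialSum (hμ : IsStationaryLaw μ C₁ C₂) (hK : ∀ n, 0 ≤ K n) (hβ : 0 < β)
    {N : ℕ} {X : Finset (List ℕ)} (hX : X ⊆ trajectories N) (hf : Feasible K X) {M : ℝ}
    (hM : 0 < M) (hlen : ∀ l ∈ X, (l.length : ℝ) ≤ M) {u : ℝ} (hu : 0 < u) :
    μ.real {x | u ≤ |Real.log (partialSum K β h X x) - meanLog K β h μ X|} ≤
      C₁ * Real.exp (-(u ^ 2 / (C₂ * (β ^ 2 * M)))) := by
  set F : EuclideanSpace ℝ (Fin N) → ℝ :=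
    fun v => Real.log (partialSum K β h X (extendZero v)) with hF
  have hFx : ∀ x : ℕ → ℝ, F (WithLp.toLp 2 fun i : Fin N => x i) =
      Real.log (partialSum K β h X x) := fun x => by
    simp only [hF, partialSum]
    congr 1
    refine Finset.sum_congr rfl fun l hl => ?_
    rw [energy_congr (hX hl) (y := x)]
    intro i hi
    simp [extendZero, hi]
  have hlip : LipschitzWith (Real.toNNReal (β * √M)) F := by
    refine LipschitzWith.of_dist_le_mul fun v w => ?_
    rw [Real.dist_eq, Real.coe_toNNReal _ (by positivity)]
    have hd : √(∑ i ∈ Finset.range N, (extendZero v - extendZero w) i ^ 2) = dist v w := by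
      rw [EuclideanSpace.dist_eq, Finset.sum_range]
      congr 1
      refine Finset.sum_congr rfl fun i _ => ?_
      simp [extendZero, Real.dist_eq]
    have := abs_log_partialSum_sub_le (β := β) (h := h) hK hf (extendZero v) (extendZero w)
      (B := √M * dist v w) (fun l hl => by
        refine (abs_energy_le_sqrt (hX hl) _).trans ?_
        rw [hd]
        exact mul_le_mul_of_nonneg_right (Real.sqrt_le_sqrt (hlen l hl)) dist_nonneg)
    rw [abs_of_pos hβ, ← mul_assoc] at this
    exact this
  have hconv : ConvexOn ℝ Set.univ F := by
    refine ⟨convex_univ, fun v _ w _ a b ha hb hab => ?_⟩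
    refine log_sum_exp_convex (fun l _ => prod_nonneg_of_nonneg hK l) hf ha hb hab fun l _ => ?_
    have he : energy (extendZero (a • v + b • w)) l =
        a * energy (extendZero v) l + b * energy (extendZero w) l := by
      simp only [energy, Finset.mul_sum, ← Finset.sum_add_distrib]
      refine Finset.sum_congr rfl fun i _ => ?_
      unfold extendZero
      split_ifs <;> simp
    rw [he]
    linear_combination (-(h * l.length)) * hab
  have := hμ.concentration N F (Real.toNNReal (β * √M)) (by simp; positivity) hlip hconv u hu
  simp only [hFx] at this
  rwa [Real.coe_toNNReal _ (by positivity), mul_pow, Real.sq_sqrt hM.le] at this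

/-! ### Superadditivity and the free energy -/

lemma integrable_comp_shift (hμ : IsStationaryLaw μ C₁ C₂) {f : (ℕ → ℝ) → ℝ}
    (hf : Integrable f μ) (a : ℕ) : Integrable (fun x => f (shift a x)) μ :=
  (hμ.stationary a).integrable_comp_of_integrable hf

lemma integral_comp_shift (hμ : IsStationaryLaw μ C₁ C₂) {f : (ℕ → ℝ) → ℝ}
    (hf : Measurable f) (a : ℕ) : ∫ x, f (shift a x) ∂μ = ∫ x, f x ∂μ := by
  have h1 := (hμ.stationary a)
  conv_rhs => rw [← h1.map_eq]
  rw [integral_map h1.measurable.aemeasurable hf.aestronglyMeasurable]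

/-- The second factor sees a shifted environment, which stationarity removes after integration. No
independence of the two factors is needed. -/
lemma meanLog_concat (hμ : IsStationaryLaw μ C₁ C₂) (hK : ∀ n, 0 ≤ K n) {X Y : Finset (List ℕ)}
    {a b : ℕ} (hX : X ⊆ trajectories a) (hY : Y ⊆ trajectories b) (hfX : Feasible K X)
    (hfY : Feasible K Y) :
    meanLog K β h μ (concat X Y) = meanLog K β h μ X + meanLog K β h μ Y := by
  have : ∀ x, Real.log (partialSum K β h (concat X Y) x) =
      Real.log (partialSum K β h X x) + Real.log (partialSum K β h Y (shift a x)) := fun x => by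
    rw [partialSum_concat hX, Real.log_mul (partialSum_pos hK hfX _).ne'
      (partialSum_pos hK hfY _).ne']
  unfold meanLog
  simp_rw [this]
  rw [integral_add (integrable_log_partialSum hμ hK hX hfX)
    (integrable_comp_shift hμ (integrable_log_partialSum hμ hK hY hfY) a),
    integral_comp_shift hμ (measurable_log_partialSum Y)]

lemma meanLog_mono (hμ : IsStationaryLaw μ C₁ C₂) (hK : ∀ n, 0 ≤ K n) {X Y : Finset (List ℕ)}
    {a : ℕ} (hXY : X ⊆ Y) (hY : Y ⊆ trajectories a) (hfX : Feasible K X) :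
    meanLog K β h μ X ≤ meanLog K β h μ Y := by
  refine integral_mono (integrable_log_partialSum hμ hK (hXY.trans hY) hfX)
    (integrable_log_partialSum hμ hK hY (hfX.mono hXY)) fun x => ?_
  exact Real.log_le_log (partialSum_pos hK hfX x) (partialSum_mono hK hXY x)

/-- `q`-fold concatenation of `X` with itself. -/
def concatPow (X : Finset (List ℕ)) : ℕ → Finset (List ℕ)
  | 0 => {[]}
  | q + 1 => concat X (concatPow X q)

lemma concatPow_subset {X : Finset (List ℕ)} {a : ℕ} (hX : X ⊆ trajectories a) (q : ℕ) :
    concatPow X q ⊆ trajectories (q * a) := by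
  induction q with
  | zero => simp [concatPow, trajectories_zero]
  | succ q ih =>
    have := concat_subset hX ih
    rwa [show a + q * a = (q + 1) * a by ring] at this

lemma feasible_concatPow {X : Finset (List ℕ)} (hX : Feasible K X) (q : ℕ) :
    Feasible K (concatPow X q) := by
  induction q with
  | zero => exact ⟨[], by simp [concatPow], by simp⟩
  | succ q ih => exact hX.concat ih

lemma partialSum_nil (x : ℕ → ℝ) : partialSum K β h {[]} x = 1 := by
  simp [partialSum, energy_nil]

lemma meanLog_concatPow (hμ : IsStationaryLaw μ C₁ C₂) (hK : ∀ n, 0 ≤ K n) {X : Finset (List ℕ)}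
    {a : ℕ} (hX : X ⊆ trajectories a) (hfX : Feasible K X) (q : ℕ) :
    meanLog K β h μ (concatPow X q) = q * meanLog K β h μ X := by
  induction q with
  | zero => simp [concatPow, meanLog, partialSum_nil]
  | succ q ih =>
    rw [concatPow, meanLog_concat hμ hK hX (concatPow_subset hX q) hfX (feasible_concatPow hfX q),
      ih]
    push_cast
    ring

lemma length_concatPow {X : Finset (List ℕ)} {m : ℕ} (hX : ∀ l ∈ X, l.length ≤ m) (q : ℕ) :
    ∀ l ∈ concatPow X q, l.length ≤ q * m := by
  induction q with
  | zero => simp [concatPow]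
  | succ q ih =>
    intro l hl
    obtain ⟨l₁, h₁, l₂, h₂, rfl⟩ := mem_concat.1 hl
    have := hX l₁ h₁
    have := ih l₂ h₂
    rw [List.length_append]
    linarith

end Pinning
end

/-! ### Existence and elementary properties of the free energy for stretched exponential kernels. -/

noncomputable section

namespace Pinning

/-- Fekete's lemma with superadditivity only from `r` on, since the kernel may vanish at short
lengths and the logarithm is then meaningless. -/
lemma tendsto_of_superadditive {u : ℕ → ℝ} {r : ℕ} {C : ℝ} (hr : 0 < r)
    (hu : ∀ m n, r ≤ m → r ≤ n → u m + u n ≤ u (m + n)) (hC : ∀ n, r ≤ n → u n ≤ C * n) :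
    ∃ F : ℝ, Tendsto (fun n : ℕ => (n : ℝ)⁻¹ * u n) atTop (𝓝 F) ∧ ∀ n, r ≤ n → u n ≤ F * n := by
  set S : Set ℝ := (fun n : ℕ => (n : ℝ)⁻¹ * u n) '' Set.Ici r with hS
  have hbdd : BddAbove S := by
    refine ⟨C, ?_⟩
    rintro _ ⟨n, hn, rfl⟩
    have hn0 : (0 : ℝ) < n := by
      have : r ≤ n := hn
      exact_mod_cast (by omega : 0 < n)
    have := hC n hn
    simp only
    rw [inv_mul_le_iff₀ hn0]
    linarith
  have hne : S.Nonempty := ⟨_, r, Set.mem_Ici.2 le_rfl, rfl⟩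
  have hle : ∀ n, r ≤ n → (n : ℝ)⁻¹ * u n ≤ sSup S := fun n hn => le_csSup hbdd ⟨n, hn, rfl⟩
  refine ⟨sSup S, ?_, fun n hn => ?_⟩
  · refine tendsto_order.2 ⟨fun a ha => ?_, fun a ha => ?_⟩
    · obtain ⟨_, ⟨n, hn, rfl⟩, hna⟩ := exists_lt_of_lt_csSup hne ha
      have hn : r ≤ n := hn
      have hn0 : (0 : ℝ) < n := by exact_mod_cast (by omega : 0 < n)
      set s := (n : ℝ)⁻¹ * u n with hs
      have hun : u n = n * s := by rw [hs]; field_simp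
      have hmul : ∀ q k : ℕ, r ≤ k → q * u n + u k ≤ u (q * n + k) := by
        intro q k hk
        induction q with
        | zero => simp
        | succ q ih =>
          have := hu n (q * n + k) hn (by omega)
          rw [show n + (q * n + k) = (q + 1) * n + k by ring] at this
          push_cast
          linarith
      set D : ℝ := (r + n) * |s| + ∑ k ∈ Finset.range (r + n), |u k| with hD
      have hlow : ∀ N, r ≤ N → N * s - D ≤ u N := by
        intro N hN
        -- The remainder is kept in `[r, r + n)` rather than `[0, n)`, so that superadditivity
        -- applies to it.
        have h1 := hmul ((N - r) / n) (r + (N - r) % n) (by omega)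
        have h2 : (N - r) / n * n + (r + (N - r) % n) = N := by
          have := Nat.div_add_mod (N - r) n
          rw [mul_comm] at this
          omega
        have h3 : (N - r) % n < n := Nat.mod_lt _ (by omega)
        rw [h2] at h1
        have h4 : |u (r + (N - r) % n)| ≤ ∑ k ∈ Finset.range (r + n), |u k| :=
          Finset.single_le_sum (f := fun k => |u k|) (fun _ _ => abs_nonneg _)
            (Finset.mem_range.2 (by omega))
        have h5 := neg_abs_le (u (r + (N - r) % n))
        have h6 : (((N - r) / n : ℕ) : ℝ) * n + ((r + (N - r) % n : ℕ) : ℝ) = N := by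
          exact_mod_cast h2
        have h7 : ((r + (N - r) % n : ℕ) : ℝ) ≤ r + n := by exact_mod_cast (by omega)
        have h8 : ((r + (N - r) % n : ℕ) : ℝ) * s ≤ (r + n) * |s| :=
          (mul_le_mul_of_nonneg_left (le_abs_self s) (Nat.cast_nonneg _)).trans
            (mul_le_mul_of_nonneg_right h7 (abs_nonneg s))
        have h9 : (N : ℝ) * s = (((N - r) / n : ℕ) : ℝ) * u n +
            ((r + (N - r) % n : ℕ) : ℝ) * s := by
          rw [← h6, hun]
          ring
        linarith
      have hlim : Tendsto (fun N : ℕ => s - D / N) atTop (𝓝 (s - 0)) :=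
        tendsto_const_nhds.sub (tendsto_const_div_atTop_nhds_zero_nat D)
      rw [sub_zero] at hlim
      filter_upwards [hlim.eventually (lt_mem_nhds hna), eventually_ge_atTop r] with N hN1 hN2
      refine hN1.trans_le ?_
      have hN0 : (0 : ℝ) < N := by exact_mod_cast (by omega : 0 < N)
      have := hlow N hN2
      rw [inv_mul_eq_div, le_div_iff₀ hN0, sub_mul, div_mul_cancel₀ _ hN0.ne']
      linarith
    · filter_upwards [eventually_ge_atTop r] with n hn
      exact (hle n hn).trans_lt ha
  · have hn0 : (0 : ℝ) < n := by exact_mod_cast (by omega : 0 < n)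
    have := hle n hn
    rw [inv_mul_le_iff₀ hn0] at this
    linarith

/-- A sub-probability kernel on the positive integers with stretched exponential tails. -/
structure IsStretchedKernel (K : ℕ → ℝ) (ζ : ℝ) (r : ℕ) (c₁ c₂ : ℝ) : Prop where
  nonneg : ∀ n, 0 ≤ K n
  sum_le_one : ∀ N, ∑ j ∈ Finset.Icc 1 N, K j ≤ 1
  exp_pos : 0 < ζ
  exp_lt_one : ζ < 1
  threshold_pos : 0 < r
  const_pos : 0 < c₁
  lower : ∀ n, r ≤ n → c₁ * Real.exp (-(n : ℝ) ^ ζ) ≤ K n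
  upper : ∀ n, r ≤ n → K n ≤ c₂ * Real.exp (-(n : ℝ) ^ ζ)

variable {K : ℕ → ℝ} {β h : ℝ} {μ : Measure (ℕ → ℝ)} {C₁ C₂ ζ c₁ c₂ : ℝ} {r : ℕ}

lemma IsStretchedKernel.pos (hK : IsStretchedKernel K ζ r c₁ c₂) {n : ℕ} (hn : r ≤ n) : 0 < K n :=
  (mul_pos hK.const_pos (Real.exp_pos _)).trans_le (hK.lower n hn)

lemma IsStretchedKernel.feasible (hK : IsStretchedKernel K ζ r c₁ c₂) {n : ℕ} (hn : r ≤ n) :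
    Feasible K (trajectories n) :=
  (feasible_singleton (hK.pos hn)).mono
    (singleton_subset_trajectories (hK.threshold_pos.trans_le hn))

/-- The free energy, as a function of the law of the environment. -/
def freeEnergyOfLaw (K : ℕ → ℝ) (β h : ℝ) (μ : Measure (ℕ → ℝ)) : ℝ :=
  limUnder atTop fun N : ℕ => (N : ℝ)⁻¹ * meanLog K β h μ (trajectories N)

lemma meanLog_le_linear (hμ : IsStationaryLaw μ C₁ C₂) (hK : IsStretchedKernel K ζ r c₁ c₂)
    {n : ℕ} (hn : r ≤ n) :
    meanLog K β h μ (trajectories n) ≤ (|β| * (∫ x, |x 0| ∂μ) + |h|) * n := by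
  have := hμ.prob
  have hf := hK.feasible hn
  have hb : ∀ x, Real.log (partialSum K β h (trajectories n) x) ≤
      |β| * (∑ i ∈ Finset.range n, |x i|) + |h| * n := fun x => by
    rw [Real.log_le_iff_le_exp (partialSum_pos hK.nonneg hf x)]
    calc partialSum K β h (trajectories n) x
        ≤ ∑ l ∈ trajectories n, (l.map K).prod *
            Real.exp (|β| * (∑ i ∈ Finset.range n, |x i|) + |h| * n) := by
          refine Finset.sum_le_sum fun l hl =>
            mul_le_mul_of_nonneg_left (Real.exp_le_exp.2 (add_le_add ?_ ?_))
              (prod_nonneg_of_nonneg hK.nonneg l)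
          · refine (le_abs_self _).trans ?_
            rw [abs_mul]
            exact mul_le_mul_of_nonneg_left (abs_energy_le hl x) (abs_nonneg β)
          · refine mul_le_mul (le_abs_self h) ?_ (Nat.cast_nonneg _) (abs_nonneg h)
            exact_mod_cast length_le_of_mem hl
      _ ≤ _ := by
          rw [← Finset.sum_mul]
          exact mul_le_of_le_one_left (Real.exp_pos _).le
            (sum_prod_le_one hK.nonneg hK.sum_le_one n)
  have hi : ∀ i, Integrable (fun x : ℕ → ℝ => |x i|) μ := fun i => (hμ.integrable i).abs
  have he : ∀ i, ∫ x, |x i| ∂μ = ∫ x, |x 0| ∂μ := fun i => by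
    have := integral_comp_shift hμ (f := fun x => |x 0|)
      (continuous_abs.measurable.comp (measurable_pi_apply 0)) i
    simpa [shift] using this
  refine (integral_mono (integrable_log_partialSum hμ hK.nonneg subset_rfl hf)
    (((integrable_finsetSum _ fun i _ => hi i).const_mul _).add (integrable_const _)) hb).trans ?_
  simp only [Pi.add_apply]
  rw [integral_add ((integrable_finsetSum _ fun i _ => hi i).const_mul _) (integrable_const _),
    integral_const_mul, integral_finsetSum _ fun i _ => hi i, integral_const]
  simp only [he, Finset.sum_const, Finset.card_range, probReal_univ, smul_eq_mul, nsmul_eq_mul]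
  linarith

lemma exists_freeEnergy (hμ : IsStationaryLaw μ C₁ C₂) (hK : IsStretchedKernel K ζ r c₁ c₂)
    (β h : ℝ) :
    Tendsto (fun N : ℕ => (N : ℝ)⁻¹ * meanLog K β h μ (trajectories N)) atTop
      (𝓝 (freeEnergyOfLaw K β h μ)) ∧
    ∀ n, r ≤ n → meanLog K β h μ (trajectories n) ≤ freeEnergyOfLaw K β h μ * n := by
  obtain ⟨F, hF1, hF2⟩ := tendsto_of_superadditive (u := fun n => meanLog K β h μ (trajectories n))
    hK.threshold_pos (fun m n hm hn => by
      rw [← meanLog_concat hμ hK.nonneg subset_rfl subset_rfl (hK.feasible hm) (hK.feasible hn)]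
      exact meanLog_mono hμ hK.nonneg (concat_subset subset_rfl subset_rfl) subset_rfl
        ((hK.feasible hm).concat (hK.feasible hn)))
    (fun n hn => meanLog_le_linear (β := β) (h := h) hμ hK hn)
  have : freeEnergyOfLaw K β h μ = F := hF1.limUnder_eq
  rw [this]
  exact ⟨hF1, hF2⟩

lemma tendsto_freeEnergy (hμ : IsStationaryLaw μ C₁ C₂) (hK : IsStretchedKernel K ζ r c₁ c₂)
    (β h : ℝ) :
    Tendsto (fun N : ℕ => (N : ℝ)⁻¹ * meanLog K β h μ (trajectories N)) atTop
      (𝓝 (freeEnergyOfLaw K β h μ)) :=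
  (exists_freeEnergy hμ hK β h).1

/-- For `a < r` the Fekete bound does not apply directly; it is applied to `r` copies of `X`, of
total length `r * a ≥ r`, and divided by `r`. -/
lemma meanLog_le (hμ : IsStationaryLaw μ C₁ C₂) (hK : IsStretchedKernel K ζ r c₁ c₂) {a : ℕ}
    (ha : 0 < a) {X : Finset (List ℕ)} (hX : X ⊆ trajectories a) (hf : Feasible K X) :
    meanLog K β h μ X ≤ freeEnergyOfLaw K β h μ * a := by
  have h1 := (exists_freeEnergy hμ hK β h).2 (r * a) (Nat.le_mul_of_pos_right r ha)
  have h2 := meanLog_mono (β := β) (h := h) hμ hK.nonneg (concatPow_subset hX r) subset_rfl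
    (feasible_concatPow hf r)
  rw [meanLog_concatPow hμ hK.nonneg hX hf] at h2
  have hr : (0 : ℝ) < r := by exact_mod_cast hK.threshold_pos
  have h3 := h2.trans h1
  push_cast at h3
  rw [← mul_le_mul_iff_right₀ hr]
  linarith

lemma meanLog_singleton (hμ : IsStationaryLaw μ C₁ C₂) {n : ℕ} (hn : 0 < n) (hp : 0 < K n) :
    meanLog K β h μ {[n]} = Real.log (K n) + h := by
  have := hμ.prob
  have h1 : ∀ x : ℕ → ℝ, Real.log (partialSum K β h {[n]} x) =
      β * x (n - 1) + (Real.log (K n) + h) := fun x => by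
    rw [partialSum_singleton hn, jumpWeight, Real.log_mul hp.ne' (Real.exp_pos _).ne', Real.log_exp]
    ring
  unfold meanLog
  simp_rw [h1]
  rw [integral_add ((hμ.integrable _).const_mul _) (integrable_const _), integral_const_mul,
    hμ.centered]
  simp

/-- A single jump to `N` costs only `N^ζ = o(N)`. -/
lemma freeEnergy_nonneg (hμ : IsStationaryLaw μ C₁ C₂) (hK : IsStretchedKernel K ζ r c₁ c₂)
    (β h : ℝ) : 0 ≤ freeEnergyOfLaw K β h μ := by
  have h1 : Tendsto (fun N : ℕ => (Real.log c₁ + h) / N - (N : ℝ) ^ (-(1 - ζ))) atTop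
      (𝓝 (0 - 0)) :=
    (tendsto_const_div_atTop_nhds_zero_nat _).sub
      ((tendsto_rpow_neg_atTop (by linarith [hK.exp_lt_one])).comp tendsto_natCast_atTop_atTop)
  rw [sub_zero] at h1
  refine le_of_tendsto_of_tendsto h1 (tendsto_freeEnergy hμ hK β h) ?_
  filter_upwards [eventually_ge_atTop r] with N hN
  have hN0 : 0 < N := hK.threshold_pos.trans_le hN
  have hN0' : (0 : ℝ) < N := by exact_mod_cast hN0
  have h2 := meanLog_mono (β := β) (h := h) hμ hK.nonneg (singleton_subset_trajectories hN0)
    subset_rfl (feasible_singleton (hK.pos hN))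
  rw [meanLog_singleton hμ hN0 (hK.pos hN)] at h2
  have h3 := Real.log_le_log (mul_pos hK.const_pos (Real.exp_pos _)) (hK.lower N hN)
  rw [Real.log_mul hK.const_pos.ne' (Real.exp_pos _).ne', Real.log_exp] at h3
  rw [inv_mul_eq_div, le_div_iff₀ hN0', sub_mul, div_mul_cancel₀ _ hN0'.ne',
    ← Real.rpow_add_one hN0'.ne']
  rw [show -(1 - ζ) + 1 = ζ by ring]
  linarith

lemma partialSum_le_of_le (hK : ∀ n, 0 ≤ K n) {X : Finset (List ℕ)} {N : ℕ}
    (hX : X ⊆ trajectories N) (hf : Feasible K X) {h' : ℝ} (hh : h ≤ h') (x : ℕ → ℝ) :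
    Real.log (partialSum K β h X x) ≤ Real.log (partialSum K β h' X x) ∧
      Real.log (partialSum K β h' X x) ≤ Real.log (partialSum K β h X x) + (h' - h) * N := by
  constructor
  · refine Real.log_le_log (partialSum_pos hK hf x) (Finset.sum_le_sum fun l _ => ?_)
    exact mul_le_mul_of_nonneg_left (Real.exp_le_exp.2 (add_le_add_right
      (mul_le_mul_of_nonneg_right hh (Nat.cast_nonneg _)) _)) (prod_nonneg_of_nonneg hK l)
  · rw [← sub_le_iff_le_add']
    refine log_sum_exp_sub_le (fun l _ => prod_nonneg_of_nonneg hK l) hf fun l hl => ?_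
    have : (l.length : ℝ) ≤ N := by exact_mod_cast length_le_of_mem (hX hl)
    nlinarith

lemma freeEnergy_mono (hμ : IsStationaryLaw μ C₁ C₂) (hK : IsStretchedKernel K ζ r c₁ c₂)
    (β : ℝ) : Monotone fun h => freeEnergyOfLaw K β h μ := by
  intro h h' hh
  refine le_of_tendsto_of_tendsto (tendsto_freeEnergy hμ hK β h) (tendsto_freeEnergy hμ hK β h') ?_
  filter_upwards [eventually_ge_atTop r] with N hN
  refine mul_le_mul_of_nonneg_left ?_ (by positivity)
  exact integral_mono (integrable_log_partialSum hμ hK.nonneg subset_rfl (hK.feasible hN))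
    (integrable_log_partialSum hμ hK.nonneg subset_rfl (hK.feasible hN))
    fun x => (partialSum_le_of_le hK.nonneg subset_rfl (hK.feasible hN) hh x).1

lemma freeEnergy_le_add (hμ : IsStationaryLaw μ C₁ C₂) (hK : IsStretchedKernel K ζ r c₁ c₂)
    (β : ℝ) {h h' : ℝ} (hh : h ≤ h') :
    freeEnergyOfLaw K β h' μ ≤ freeEnergyOfLaw K β h μ + (h' - h) := by
  have := hμ.prob
  refine le_of_tendsto_of_tendsto (tendsto_freeEnergy hμ hK β h')
    ((tendsto_freeEnergy hμ hK β h).add_const (h' - h)) ?_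
  filter_upwards [eventually_ge_atTop r] with N hN
  have hN0' : (0 : ℝ) < N := by exact_mod_cast hK.threshold_pos.trans_le hN
  have h1 : meanLog K β h' μ (trajectories N) ≤
      meanLog K β h μ (trajectories N) + (h' - h) * N := by
    have hi := integrable_log_partialSum (β := β) (h := h) hμ hK.nonneg subset_rfl (hK.feasible hN)
    refine (integral_mono
      (integrable_log_partialSum hμ hK.nonneg subset_rfl (hK.feasible hN))
      (hi.add (integrable_const ((h' - h) * N)))
      fun x => (partialSum_le_of_le hK.nonneg subset_rfl (hK.feasible hN) hh x).2).trans_eq ?_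
    simp only [Pi.add_apply]
    rw [integral_add hi (integrable_const _)]
    simp [meanLog]
  calc (N : ℝ)⁻¹ * meanLog K β h' μ (trajectories N)
      ≤ (N : ℝ)⁻¹ * (meanLog K β h μ (trajectories N) + (h' - h) * N) :=
        mul_le_mul_of_nonneg_left h1 (by positivity)
    _ = _ := by field_simp

/-- Annealed bound: `log Z ≤ Z - 1`, and choosing `h = -c` cancels the exponential moments contact
by contact, so the mean of `Z` is at most the renewal mass, hence at most `1`. -/
lemma exists_freeEnergy_nonpos (hμ : IsStationaryLaw μ C₁ C₂)
    (hK : IsStretchedKernel K ζ r c₁ c₂) (β : ℝ) : ∃ h, freeEnergyOfLaw K β h μ ≤ 0 := by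
  have := hμ.prob
  obtain ⟨c, hc⟩ := hμ.exp_moments β
  refine ⟨-c, le_of_tendsto (tendsto_freeEnergy hμ hK β (-c)) ?_⟩
  filter_upwards [eventually_ge_atTop r] with N hN
  refine mul_nonpos_of_nonneg_of_nonpos (by positivity) ?_
  have hterm : ∀ l : List ℕ, (fun x => (l.map K).prod * Real.exp (β * energy x l + -c * l.length)) =
      fun x => (l.map K).prod * Real.exp (-c * l.length) * Real.exp (β * energy x l) := fun l => by
    ext x
    rw [Real.exp_add]
    ring
  have hi : ∀ l : List ℕ,
      Integrable (fun x => (l.map K).prod * Real.exp (β * energy x l + -c * l.length)) μ :=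
    fun l => by
      rw [hterm]
      exact (hc (sites l)).1.const_mul _
  have hQ : Integrable (partialSum K β (-c) (trajectories N)) μ :=
    integrable_finsetSum _ fun l _ => hi l
  have h1 : meanLog K β (-c) μ (trajectories N) ≤
      ∫ x, (partialSum K β (-c) (trajectories N) x - 1) ∂μ :=
    integral_mono (integrable_log_partialSum hμ hK.nonneg subset_rfl (hK.feasible hN))
      (hQ.sub (integrable_const _))
      fun x => Real.log_le_sub_one_of_pos (partialSum_pos hK.nonneg (hK.feasible hN) x)
  have h2 : ∫ x, partialSum K β (-c) (trajectories N) x ∂μ ≤ 1 := by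
    unfold partialSum
    rw [integral_finsetSum _ fun l _ => hi l]
    refine le_trans (Finset.sum_le_sum fun l hl => ?_)
      (sum_prod_le_one hK.nonneg hK.sum_le_one N)
    rw [hterm, integral_const_mul]
    have h3 := (hc (sites l)).2
    rw [card_sites (mem_trajectories.1 hl).1] at h3
    calc (l.map K).prod * Real.exp (-c * l.length) * ∫ x, Real.exp (β * energy x l) ∂μ
        ≤ (l.map K).prod * Real.exp (-c * l.length) * Real.exp (c * l.length) :=
          mul_le_mul_of_nonneg_left h3
            (mul_nonneg (prod_nonneg_of_nonneg hK.nonneg l) (Real.exp_pos _).le)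
      _ = (l.map K).prod := by
          rw [mul_assoc, ← Real.exp_add]
          simp
  rw [integral_sub hQ (integrable_const _)] at h1
  simp only [integral_const, probReal_univ, smul_eq_mul, mul_one] at h1
  linarith

lemma log_kernel_add_le (hμ : IsStationaryLaw μ C₁ C₂) (hK : IsStretchedKernel K ζ r c₁ c₂)
    (β h : ℝ) {n : ℕ} (hn : 0 < n) (hp : 0 < K n) :
    Real.log (K n) + h ≤ freeEnergyOfLaw K β h μ * n := by
  rw [← meanLog_singleton (β := β) hμ hn hp]
  exact meanLog_le hμ hK hn (singleton_subset_trajectories hn) (feasible_singleton hp)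

lemma exists_freeEnergy_pos (hμ : IsStationaryLaw μ C₁ C₂)
    (hK : IsStretchedKernel K ζ r c₁ c₂) (β : ℝ) : ∃ h, 0 < freeEnergyOfLaw K β h μ := by
  refine ⟨1 - Real.log (K r), ?_⟩
  have := log_kernel_add_le hμ hK β (1 - Real.log (K r)) hK.threshold_pos (hK.pos le_rfl)
  have hr : (0 : ℝ) < r := by exact_mod_cast hK.threshold_pos
  by_contra hcon
  push Not at hcon
  nlinarith

/-- Concentration with `M = N` gives geometrically small deviation probabilities, and Borel–Cantelli
turns convergence of the means into almost sure convergence. -/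
lemma ae_tendsto_freeEnergy (hμ : IsStationaryLaw μ C₁ C₂) (hK : IsStretchedKernel K ζ r c₁ c₂)
    (hβ : 0 < β) (h : ℝ) :
    ∀ᵐ x ∂μ, Tendsto (fun N : ℕ => (N : ℝ)⁻¹ * Real.log (partialSum K β h (trajectories N) x))
      atTop (𝓝 (freeEnergyOfLaw K β h μ)) := by
  have := hμ.prob
  have h1 : ∀ k : ℕ, ∀ᵐ x ∂μ, ∀ᶠ N : ℕ in atTop,
      |Real.log (partialSum K β h (trajectories N) x) - meanLog K β h μ (trajectories N)| <
        (1 / ((k : ℝ) + 1)) * N := by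
    intro k
    set ε : ℝ := 1 / ((k : ℝ) + 1) with hε
    have hε0 : 0 < ε := by positivity
    set s : ℕ → Set (ℕ → ℝ) := fun N => {x | ε * (N + r : ℕ) ≤
      |Real.log (partialSum K β h (trajectories (N + r)) x) -
        meanLog K β h μ (trajectories (N + r))|} with hs
    set ρ : ℝ := Real.exp (-(ε ^ 2 / (C₂ * β ^ 2))) with hρ
    have hq : 0 < ε ^ 2 / (C₂ * β ^ 2) := by
      have := hμ.pos₂
      positivity
    have hρ1 : ρ < 1 := by
      rw [hρ, Real.exp_lt_one_iff]
      linarith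
    have hbound : ∀ N, μ.real (s N) ≤ C₁ * ρ ^ (N + r) := by
      intro N
      have hr := hK.threshold_pos
      have hNr : (0 : ℝ) < (N + r : ℕ) := by exact_mod_cast (by omega : 0 < N + r)
      have := concentration_log_partialSum (h := h) hμ hK.nonneg hβ (N := N + r) subset_rfl
        (hK.feasible (Nat.le_add_left r N)) (M := (N + r : ℕ)) hNr
        (fun l hl => by exact_mod_cast length_le_of_mem hl) (u := ε * (N + r : ℕ)) (by positivity)
      refine this.trans_eq ?_
      rw [hρ, ← Real.exp_nat_mul]
      congr 2
      have := hμ.pos₂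
      field_simp
    have hsum : ∑' N, μ (s N) ≠ ⊤ := by
      have hsm : Summable fun N => C₁ * ρ ^ (N + r) :=
        ((summable_nat_add_iff r).2
          (summable_geometric_of_lt_one (Real.exp_pos _).le hρ1)).mul_left _
      have hle : ∀ N, μ (s N) ≤ ENNReal.ofReal (C₁ * ρ ^ (N + r)) := fun N => by
        rw [← ofReal_measureReal]
        exact ENNReal.ofReal_le_ofReal (hbound N)
      exact ne_top_of_le_ne_top hsm.tsum_ofReal_ne_top (ENNReal.tsum_le_tsum hle)
    filter_upwards [ae_eventually_notMem hsum] with x hx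
    rw [eventually_atTop] at hx ⊢
    obtain ⟨N₀, hN₀⟩ := hx
    refine ⟨N₀ + r, fun N hN => ?_⟩
    have := hN₀ (N - r) (by omega)
    simp only [hs, Set.mem_ofPred_eq, not_le] at this
    rwa [Nat.sub_add_cancel (by omega)] at this
  filter_upwards [ae_all_iff.2 h1] with x hx
  have h2 : Tendsto (fun N : ℕ => (N : ℝ)⁻¹ * (Real.log (partialSum K β h (trajectories N) x) -
      meanLog K β h μ (trajectories N))) atTop (𝓝 0) := by
    rw [Metric.tendsto_atTop']
    intro ε hε
    obtain ⟨k, hk⟩ := exists_nat_one_div_lt hε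
    obtain ⟨N₀, hN₀⟩ := eventually_atTop.1 (hx k)
    refine ⟨N₀, fun N hN => ?_⟩
    have hN0 : (0 : ℝ) < N := by exact_mod_cast (by omega : 0 < N)
    rw [Real.dist_eq, sub_zero, abs_mul, abs_of_pos (inv_pos.2 hN0), inv_mul_lt_iff₀ hN0]
    have := hN₀ N hN.le
    nlinarith
  have h3 := h2.add (tendsto_freeEnergy hμ hK β h)
  rw [zero_add] at h3
  refine h3.congr fun N => ?_
  ring

end Pinning
end

noncomputable section

namespace Pinning

variable {K : ℕ → ℝ} {β h : ℝ} {μ : Measure (ℕ → ℝ)} {C₁ C₂ ζ c₁ c₂ : ℝ} {r : ℕ}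

/-! ### Gibbs means -/

/-- The mean of `f` under the Gibbs measure on the trajectories from `0` to `N`. -/
def gibbsMean (K : ℕ → ℝ) (β h : ℝ) (N : ℕ) (f : List ℕ → ℝ) (x : ℕ → ℝ) : ℝ :=
  (∑ l ∈ trajectories N, (l.map K).prod * Real.exp (β * energy x l + h * l.length) * f l) /
    partialSum K β h (trajectories N) x

/-- The Gibbs probability that a trajectory from `0` to `j` consists of a single jump. -/
def jumpProb (K : ℕ → ℝ) (β h : ℝ) (j : ℕ) (x : ℕ → ℝ) : ℝ :=
  jumpWeight K β h j x / partialSum K β h (trajectories j) x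

/-- The number of sites covered by jumps longer than `n`. -/
def longSites (n : ℕ) (l : List ℕ) : ℕ := (l.map fun j => if n < j then j else 0).sum

lemma measurable_jumpWeight (j : ℕ) : Measurable (jumpWeight K β h j) := by
  unfold jumpWeight
  fun_prop

lemma measurable_jumpProb (j : ℕ) : Measurable (jumpProb K β h j) :=
  (measurable_jumpWeight j).div (measurable_partialSum _)

lemma jumpProb_nonneg (hK : ∀ n, 0 ≤ K n) (j : ℕ) (x : ℕ → ℝ) : 0 ≤ jumpProb K β h j x :=
  div_nonneg (jumpWeight_nonneg hK j x) (partialSum_nonneg hK _ x)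

lemma jumpProb_le_one (hK : ∀ n, 0 ≤ K n) {j : ℕ} (hj : 0 < j) (x : ℕ → ℝ) :
    jumpProb K β h j x ≤ 1 :=
  div_le_one_of_le₀ (jumpWeight_le hK hj x) (partialSum_nonneg hK _ x)

/-- The identity survives a vanishing denominator: the jump weight is dominated by that partition
function, so both sides are then `0`. -/
lemma jumpWeight_eq (hK : ∀ n, 0 ≤ K n) {j : ℕ} (hj : 0 < j) (x : ℕ → ℝ) :
    jumpWeight K β h j x = jumpProb K β h j x * partialSum K β h (trajectories j) x := by
  rcases (partialSum_nonneg (β := β) (h := h) hK (trajectories j) x).eq_or_lt with h0 | h0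
  · have := jumpWeight_le (β := β) (h := h) hK hj x
    have := jumpWeight_nonneg (β := β) (h := h) hK j x
    rw [← h0, mul_zero]
    linarith
  · rw [jumpProb, div_mul_cancel₀ _ h0.ne']

lemma integrable_jumpProb (hμ : IsStationaryLaw μ C₁ C₂) (hK : ∀ n, 0 ≤ K n) {j : ℕ} (hj : 0 < j) :
    Integrable (jumpProb K β h j) μ := by
  have := hμ.prob
  refine (integrable_const (1 : ℝ)).mono' (measurable_jumpProb j).aestronglyMeasurable
    (Eventually.of_forall fun x => ?_)
  rw [Real.norm_eq_abs, abs_of_nonneg (jumpProb_nonneg hK j x)]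
  exact jumpProb_le_one hK hj x

/-- Given that a trajectory visits `s` and `s + j`, it makes this step in one jump with probability
`jumpProb` of the environment seen from `s`. So `jumpProb` bounds the Gibbs probability of a jump of
length `j` starting at `s`. The proof is a recursion on the first jump. -/
lemma sum_weight_longSites_le (hK : ∀ n, 0 ≤ K n) (n N : ℕ) (x : ℕ → ℝ) :
    ∑ l ∈ trajectories N, (l.map K).prod * Real.exp (β * energy x l + h * l.length) *
        longSites n l ≤
      partialSum K β h (trajectories N) x * ∑ s ∈ Finset.range N,
        ∑ j ∈ Finset.Icc 1 N, ((if n < j then j else 0 : ℕ) : ℝ) *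
          jumpProb K β h j (shift s x) := by
  induction N using Nat.strong_induction_on generalizing x with
  | _ N ih =>
  rcases Nat.eq_zero_or_pos N with rfl | hN
  · simp [trajectories_zero, longSites]
  set R : ℕ → (ℕ → ℝ) → ℝ := fun M y => ∑ j ∈ Finset.Icc 1 M,
    ((if n < j then j else 0 : ℕ) : ℝ) * jumpProb K β h j y with hR
  have hR0 : ∀ M y, 0 ≤ R M y := fun M y =>
    Finset.sum_nonneg fun j _ => mul_nonneg (Nat.cast_nonneg _) (jumpProb_nonneg hK j y)
  have hRmono : ∀ M ≤ N, ∀ y, R M y ≤ R N y := fun M hM y =>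
    Finset.sum_le_sum_of_subset_of_nonneg (Finset.Icc_subset_Icc le_rfl hM)
      fun j _ _ => mul_nonneg (Nat.cast_nonneg _) (jumpProb_nonneg hK j y)
  have hP : ∀ M y, 0 ≤ partialSum K β h (trajectories M) y := fun M y => partialSum_nonneg hK _ y
  set B : ℝ := ∑ s ∈ Finset.Ico 1 N, R N (shift s x) with hB
  have hsplit : ∑ s ∈ Finset.range N, R N (shift s x) = R N x + B := by
    rw [Finset.range_eq_Ico, Finset.sum_eq_sum_Ico_succ_bot hN, shift_zero]
  have hPN : partialSum K β h (trajectories N) x = ∑ j ∈ Finset.Icc 1 N,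
      jumpWeight K β h j x * partialSum K β h (trajectories (N - j)) (shift j x) := by
    rw [partialSum, sum_trajectories hN]
    refine Finset.sum_congr rfl fun j hj => ?_
    rw [partialSum, Finset.mul_sum]
    refine Finset.sum_congr rfl fun l _ => weight_cons (Finset.mem_Icc.1 hj).1 l x
  change _ ≤ _ * ∑ s ∈ Finset.range N, R N (shift s x)
  rw [hsplit, mul_add, sum_trajectories hN]
  have hterm : ∀ j ∈ Finset.Icc 1 N, ∑ l ∈ trajectories (N - j), ((j :: l).map K).prod *
      Real.exp (β * energy x (j :: l) + h * (j :: l).length) * longSites n (j :: l) ≤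
      partialSum K β h (trajectories N) x *
        (((if n < j then j else 0 : ℕ) : ℝ) * jumpProb K β h j x) +
      jumpWeight K β h j x * partialSum K β h (trajectories (N - j)) (shift j x) * B := by
    intro j hj
    rw [Finset.mem_Icc] at hj
    have h1 : ∑ l ∈ trajectories (N - j), ((j :: l).map K).prod *
        Real.exp (β * energy x (j :: l) + h * (j :: l).length) * longSites n (j :: l) =
        jumpWeight K β h j x * (((if n < j then j else 0 : ℕ) : ℝ) *
          partialSum K β h (trajectories (N - j)) (shift j x) +
          ∑ l ∈ trajectories (N - j), (l.map K).prod *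
            Real.exp (β * energy (shift j x) l + h * l.length) * longSites n l) := by
      rw [partialSum, Finset.mul_sum, ← Finset.sum_add_distrib, Finset.mul_sum]
      refine Finset.sum_congr rfl fun l _ => ?_
      rw [weight_cons hj.1 l x]
      simp only [longSites, List.map_cons, List.sum_cons]
      push_cast
      ring
    have h2 := ih (N - j) (by omega) (shift j x)
    have h3 : ∑ s ∈ Finset.range (N - j), R (N - j) (shift s (shift j x)) ≤ B := by
      calc ∑ s ∈ Finset.range (N - j), R (N - j) (shift s (shift j x))
          ≤ ∑ s ∈ Finset.range (N - j), R N (shift (j + s) x) := by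
            refine Finset.sum_le_sum fun s _ => ?_
            rw [shift_shift]
            exact hRmono _ (by omega) _
        _ = ∑ s ∈ Finset.Ico j N, R N (shift s x) := by rw [Finset.sum_Ico_eq_sum_range]
        _ ≤ B := Finset.sum_le_sum_of_subset_of_nonneg (Finset.Ico_subset_Ico hj.1 le_rfl)
            fun s _ _ => hR0 _ _
    have hjw := jumpWeight_nonneg (β := β) (h := h) hK j x
    have h4 := h2.trans (mul_le_mul_of_nonneg_left h3 (hP (N - j) (shift j x)))
    have h5 : jumpWeight K β h j x * partialSum K β h (trajectories (N - j)) (shift j x) ≤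
        jumpProb K β h j x * partialSum K β h (trajectories N) x := by
      rw [jumpWeight_eq hK hj.1, mul_assoc]
      refine mul_le_mul_of_nonneg_left ?_ (jumpProb_nonneg hK j x)
      have := partialSum_mul_le (K := K) (β := β) (h := h) hK (subset_refl (trajectories j))
        (subset_refl (trajectories (N - j))) x
      rwa [Nat.add_sub_cancel' hj.2] at this
    have hc : (0 : ℝ) ≤ ((if n < j then j else 0 : ℕ) : ℝ) := Nat.cast_nonneg _
    rw [h1]
    have h6 := mul_le_mul_of_nonneg_left h4 hjw
    have h7 := mul_le_mul_of_nonneg_left h5 hc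
    rw [mul_add]
    nlinarith
  refine (Finset.sum_le_sum hterm).trans_eq ?_
  rw [Finset.sum_add_distrib, ← Finset.mul_sum, ← Finset.sum_mul, ← hPN]

lemma gibbsMean_nonneg (hK : ∀ n, 0 ≤ K n) {N : ℕ} {f : List ℕ → ℝ} (hf : ∀ l, 0 ≤ f l)
    (x : ℕ → ℝ) : 0 ≤ gibbsMean K β h N f x :=
  div_nonneg (Finset.sum_nonneg fun l _ => mul_nonneg (mul_nonneg (prod_nonneg_of_nonneg hK l)
    (Real.exp_pos _).le) (hf l)) (partialSum_nonneg hK _ x)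

lemma gibbsMean_mono (hK : ∀ n, 0 ≤ K n) {N : ℕ} {f g : List ℕ → ℝ}
    (hfg : ∀ l ∈ trajectories N, f l ≤ g l) (x : ℕ → ℝ) :
    gibbsMean K β h N f x ≤ gibbsMean K β h N g x :=
  div_le_div_of_nonneg_right (Finset.sum_le_sum fun l hl => mul_le_mul_of_nonneg_left (hfg l hl)
    (mul_nonneg (prod_nonneg_of_nonneg hK l) (Real.exp_pos _).le)) (partialSum_nonneg hK _ x)

lemma gibbsMean_const (hK : ∀ n, 0 ≤ K n) {N : ℕ} (hf : Feasible K (trajectories N)) (c : ℝ)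
    (x : ℕ → ℝ) : gibbsMean K β h N (fun _ => c) x = c := by
  rw [gibbsMean, ← Finset.sum_mul, ← partialSum,
    mul_div_cancel_left₀ _ (partialSum_pos hK hf x).ne']

lemma gibbsMean_add {N : ℕ} (f g : List ℕ → ℝ) (x : ℕ → ℝ) :
    gibbsMean K β h N (fun l => f l + g l) x =
      gibbsMean K β h N f x + gibbsMean K β h N g x := by
  simp only [gibbsMean, mul_add, Finset.sum_add_distrib, add_div]

lemma gibbsMean_const_mul {N : ℕ} (c : ℝ) (f : List ℕ → ℝ) (x : ℕ → ℝ) :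
    gibbsMean K β h N (fun l => c * f l) x = c * gibbsMean K β h N f x := by
  rw [gibbsMean, gibbsMean, mul_div_assoc', Finset.mul_sum]
  congr 1
  exact Finset.sum_congr rfl fun l _ => by ring

lemma measurable_gibbsMean (N : ℕ) (f : List ℕ → ℝ) : Measurable (gibbsMean K β h N f) :=
  (Finset.measurable_sum _ fun l _ => (Measurable.const_mul
    (Real.measurable_exp.comp (((measurable_energy l).const_mul β).add_const _)) _).mul_const
      _).div (measurable_partialSum _)

lemma integrable_gibbsMean (hμ : IsStationaryLaw μ C₁ C₂) (hK : ∀ n, 0 ≤ K n) {N : ℕ}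
    (hfe : Feasible K (trajectories N)) {f : List ℕ → ℝ} (hf : ∀ l, 0 ≤ f l) {B : ℝ}
    (hB : ∀ l ∈ trajectories N, f l ≤ B) : Integrable (gibbsMean K β h N f) μ := by
  have := hμ.prob
  refine (integrable_const B).mono' (measurable_gibbsMean N f).aestronglyMeasurable
    (Eventually.of_forall fun x => ?_)
  rw [Real.norm_eq_abs, abs_of_nonneg (gibbsMean_nonneg hK hf x), ← gibbsMean_const (β := β)
    (h := h) hK hfe B x]
  exact gibbsMean_mono hK hB x

lemma longSites_le_sum (n : ℕ) (l : List ℕ) : longSites n l ≤ l.sum := by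
  induction l with
  | nil => simp [longSites]
  | cons j l ih =>
    simp only [longSites, List.map_cons, List.sum_cons] at ih ⊢
    split_ifs <;> omega

lemma longSites_append (n : ℕ) (l l' : List ℕ) :
    longSites n (l ++ l') = longSites n l + longSites n l' := by
  simp [longSites]

lemma sum_le_mul_length_add_longSites (n : ℕ) (l : List ℕ) :
    l.sum ≤ n * l.length + longSites n l := by
  induction l with
  | nil => simp
  | cons j l ih =>
    simp only [longSites, List.map_cons, List.sum_cons, List.length_cons] at ih ⊢
    rw [mul_add, mul_one]
    split_ifs <;> omega

/-- Each starting site contributes at most the sum of `j · j⁻³` over `j > n`, which is at most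
`1/n`. This is why the cube is the right decay to propagate. -/
lemma integral_longSites_le (hμ : IsStationaryLaw μ C₁ C₂) (hK : ∀ n, 0 ≤ K n) {n N : ℕ}
    (hn : 0 < n) (hfe : Feasible K (trajectories N))
    (hg : ∀ j, n < j → ∫ x, jumpProb K β h j x ∂μ ≤ ((j : ℝ) ^ 3)⁻¹) :
    ∫ x, gibbsMean K β h N (fun l => longSites n l) x ∂μ ≤ N / n := by
  have hle : ∀ x, gibbsMean K β h N (fun l => longSites n l) x ≤ ∑ s ∈ Finset.range N,
      ∑ j ∈ Finset.Icc 1 N, ((if n < j then j else 0 : ℕ) : ℝ) *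
          jumpProb K β h j (shift s x) := fun x => by
    rw [gibbsMean, div_le_iff₀ (partialSum_pos hK hfe x), mul_comm]
    exact sum_weight_longSites_le hK n N x
  have hint : ∀ s, ∀ j ∈ Finset.Icc 1 N, Integrable (fun x => ((if n < j then j else 0 : ℕ) : ℝ) *
          jumpProb K β h j (shift s x)) μ := fun s j hj =>
    (integrable_comp_shift hμ (integrable_jumpProb hμ hK (Finset.mem_Icc.1 hj).1) s).const_mul _
  refine (integral_mono (integrable_gibbsMean hμ hK hfe (fun l => Nat.cast_nonneg _) (B := N)
    fun l hl => ?_) (integrable_finsetSum _ fun s _ => integrable_finsetSum _ (hint s)) hle).trans ?_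
  · have := longSites_le_sum n l
    rw [(mem_trajectories.1 hl).2] at this
    exact_mod_cast this
  rw [integral_finsetSum _ fun s _ => integrable_finsetSum _ (hint s)]
  have hs : ∀ s ∈ Finset.range N, ∫ x, ∑ j ∈ Finset.Icc 1 N,
      ((if n < j then j else 0 : ℕ) : ℝ) * jumpProb K β h j (shift s x) ∂μ ≤ (n : ℝ)⁻¹ := by
    intro s _
    rw [integral_finsetSum _ (hint s)]
    simp_rw [integral_const_mul, integral_comp_shift hμ (measurable_jumpProb _)]
    calc ∑ j ∈ Finset.Icc 1 N, ((if n < j then j else 0 : ℕ) : ℝ) * ∫ x, jumpProb K β h j x ∂μ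
        ≤ ∑ j ∈ Finset.Icc 1 N, if j ∈ Finset.Ioc n (max n N) then ((j : ℝ) ^ 2)⁻¹ else 0 := by
          refine Finset.sum_le_sum fun j hj => ?_
          rw [Finset.mem_Icc] at hj
          by_cases hnj : n < j
          · have : j ∈ Finset.Ioc n (max n N) :=
              Finset.mem_Ioc.2 ⟨hnj, hj.2.trans (le_max_right _ _)⟩
            rw [if_pos hnj, if_pos this]
            have hj0 : (0 : ℝ) < j := by exact_mod_cast hj.1
            calc (j : ℝ) * ∫ x, jumpProb K β h j x ∂μ ≤ j * ((j : ℝ) ^ 3)⁻¹ :=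
                  mul_le_mul_of_nonneg_left (hg j hnj) hj0.le
              _ = ((j : ℝ) ^ 2)⁻¹ := by field_simp
          · rw [if_neg hnj]
            simp only [Nat.cast_zero, zero_mul]
            split_ifs <;> positivity
      _ ≤ ∑ j ∈ Finset.Ioc n (max n N), ((j : ℝ) ^ 2)⁻¹ := by
          rw [← Finset.sum_filter]
          exact Finset.sum_le_sum_of_subset_of_nonneg
            (fun j hj => (Finset.mem_filter.1 hj).2) fun _ _ _ => by positivity
      _ ≤ (n : ℝ)⁻¹ - ((max n N : ℕ) : ℝ)⁻¹ :=
          sum_Ioc_inv_sq_le_sub (by omega) (le_max_left _ _)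
      _ ≤ (n : ℝ)⁻¹ := by
          have : (0 : ℝ) ≤ ((max n N : ℕ) : ℝ)⁻¹ := by positivity
          linarith
  refine (Finset.sum_le_sum hs).trans_eq ?_
  rw [Finset.sum_const, Finset.card_range, nsmul_eq_mul, div_eq_mul_inv]

lemma gibbsMean_length_le (hK : ∀ n, 0 ≤ K n) {N : ℕ} (hfe : Feasible K (trajectories N))
    (h' : ℝ) (x : ℕ → ℝ) :
    (h' - h) * gibbsMean K β h N (fun l => l.length) x ≤
      Real.log (partialSum K β h' (trajectories N) x) -
        Real.log (partialSum K β h (trajectories N) x) := by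
  have := log_sum_exp_sub_ge (s := trajectories N) (k := fun l => (l.map K).prod)
    (φ := fun l => β * energy x l + h * l.length) (ψ := fun l => β * energy x l + h' * l.length)
    (fun l _ => prod_nonneg_of_nonneg hK l) hfe
  refine le_trans (le_of_eq ?_) this
  rw [gibbsMean, partialSum, mul_div_assoc', Finset.mul_sum]
  congr 1
  exact Finset.sum_congr rfl fun l _ => by ring

lemma eventually_integral_length_le (hμ : IsStationaryLaw μ C₁ C₂)
    (hK : IsStretchedKernel K ζ r c₁ c₂) {h' p : ℝ} (hh : h < h') (hp : 0 < p)
    (hF : freeEnergyOfLaw K β h' μ - freeEnergyOfLaw K β h μ ≤ p * (h' - h)) :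
    ∀ᶠ N : ℕ in atTop, ∫ x, gibbsMean K β h N (fun l => l.length) x ∂μ ≤ 2 * p * N := by
  have h1 := (tendsto_freeEnergy hμ hK β h').sub (tendsto_freeEnergy hμ hK β h)
  have hh' : 0 < h' - h := sub_pos.2 hh
  have h2 : freeEnergyOfLaw K β h' μ - freeEnergyOfLaw K β h μ < 2 * p * (h' - h) := by
    have := mul_pos hp hh'
    linarith
  filter_upwards [h1.eventually (gt_mem_nhds h2), eventually_ge_atTop r] with N hN1 hN2
  have hN0 : (0 : ℝ) < N := by exact_mod_cast hK.threshold_pos.trans_le hN2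
  have hfe := hK.feasible hN2
  have hi := fun h => integrable_log_partialSum (β := β) (h := h) hμ hK.nonneg subset_rfl hfe
  have h3 := integral_mono ((integrable_gibbsMean (β := β) (h := h) hμ hK.nonneg hfe
    (fun l => Nat.cast_nonneg l.length) (B := N)
    (fun l hl => by exact_mod_cast length_le_of_mem hl)).const_mul (h' - h))
    ((hi h').sub (hi h)) (fun x => gibbsMean_length_le hK.nonneg hfe h' x)
  simp only [Pi.sub_apply] at h3
  rw [integral_const_mul, integral_sub (hi h') (hi h)] at h3
  change _ ≤ meanLog K β h' μ (trajectories N) - meanLog K β h μ (trajectories N) at h3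
  rw [← mul_sub, inv_mul_lt_iff₀ hN0] at hN1
  rw [← mul_le_mul_iff_right₀ hh']
  linarith

/-- Trajectories with few contacts and few sites in long jumps. -/
def goodTrajectories (n N : ℕ) (M : ℝ) : Finset (List ℕ) :=
  (trajectories N).filter fun l => (l.length : ℝ) ≤ M ∧ 10 * longSites n l ≤ N

/-- Markov's inequality under the Gibbs measure, one term for each of the two defining constraints.
-/
lemma partialSum_good_ge (hK : ∀ n, 0 ≤ K n) {n N : ℕ} (hN : 0 < N)
    (hfe : Feasible K (trajectories N)) {M : ℝ} (hM : 0 < M) (x : ℕ → ℝ) :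
    partialSum K β h (trajectories N) x *
      (1 - (M⁻¹ * gibbsMean K β h N (fun l => l.length) x +
        10 / N * gibbsMean K β h N (fun l => longSites n l) x)) ≤
      partialSum K β h (goodTrajectories n N M) x := by
  have hN0 : (0 : ℝ) < N := by exact_mod_cast hN
  have hP := partialSum_pos (β := β) (h := h) hK hfe x
  rw [← gibbsMean_const_mul, ← gibbsMean_const_mul, ← gibbsMean_add, mul_sub, mul_one, sub_le_comm,
    gibbsMean, mul_div_cancel₀ _ hP.ne']
  rw [partialSum, goodTrajectories, partialSum, ← Finset.sum_filter_add_sum_filter_not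
    (trajectories N) (fun l => (l.length : ℝ) ≤ M ∧ 10 * longSites n l ≤ N), add_sub_cancel_left]
  have hw : ∀ l : List ℕ, 0 ≤ (l.map K).prod * Real.exp (β * energy x l + h * l.length) :=
    fun l => mul_nonneg (prod_nonneg_of_nonneg hK l) (Real.exp_pos _).le
  refine (Finset.sum_le_sum fun l hl => ?_).trans
    (Finset.sum_le_sum_of_subset_of_nonneg (Finset.filter_subset _ _) fun l _ _ =>
      mul_nonneg (hw l) (by positivity))
  rw [Finset.mem_filter, not_and_or, not_le, not_le] at hl
  refine le_mul_of_one_le_right (hw l) ?_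
  have h1 : 0 ≤ M⁻¹ * (l.length : ℝ) := by positivity
  have h2 : 0 ≤ 10 / (N : ℝ) * (longSites n l : ℝ) := by positivity
  rcases hl.2 with h3 | h3
  · have : 1 ≤ M⁻¹ * (l.length : ℝ) := by
      rw [inv_mul_eq_div, one_le_div hM]
      exact h3.le
    linarith
  · have : 1 ≤ 10 / (N : ℝ) * (longSites n l : ℝ) := by
      rw [div_mul_eq_mul_div, one_le_div hN0]
      exact_mod_cast h3.le
    linarith

/-- The mean Gibbs weight of bad trajectories is at most `1/8 + 1/8`, the second term using `n ≥
80`. A further Markov inequality, over the environment at level `3/4`, gives `1/3`. -/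
lemma measure_good_small (hμ : IsStationaryLaw μ C₁ C₂) (hK : ∀ n, 0 ≤ K n) {n N : ℕ}
    (hn : 80 ≤ n) (hN : 0 < N) (hfe : Feasible K (trajectories N)) {p : ℝ} (hp : 0 < p)
    (hlen : ∫ x, gibbsMean K β h N (fun l => l.length) x ∂μ ≤ 2 * p * N)
    (hg : ∀ j, n < j → ∫ x, jumpProb K β h j x ∂μ ≤ ((j : ℝ) ^ 3)⁻¹) :
    μ.real {x | partialSum K β h (goodTrajectories n N (16 * p * N)) x <
      partialSum K β h (trajectories N) x / 4} ≤ 1 / 3 := by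
  have := hμ.prob
  have hN0 : (0 : ℝ) < N := by exact_mod_cast hN
  have hn0 : (80 : ℝ) ≤ n := by exact_mod_cast hn
  set ψ : (ℕ → ℝ) → ℝ := fun x => (16 * p * N)⁻¹ * gibbsMean K β h N (fun l => l.length) x +
        10 / N * gibbsMean K β h N (fun l => longSites n l) x with hψ
  have hi1 : Integrable (gibbsMean K β h N (fun l => (l.length : ℝ))) μ :=
    integrable_gibbsMean hμ hK hfe (fun l => Nat.cast_nonneg l.length) (B := N)
      (fun l hl => by exact_mod_cast length_le_of_mem hl)
  have hi2 : Integrable (gibbsMean K β h N (fun l => (longSites n l : ℝ))) μ :=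
    integrable_gibbsMean hμ hK hfe (fun l => Nat.cast_nonneg _) (B := N)
      (fun l hl => by
        have := longSites_le_sum n l
        rw [(mem_trajectories.1 hl).2] at this
        exact_mod_cast this)
  have hψi : Integrable ψ μ := (hi1.const_mul _).add (hi2.const_mul _)
  have hψ0 : ∀ x, 0 ≤ ψ x := fun x => add_nonneg
    (mul_nonneg (by positivity) (gibbsMean_nonneg hK (fun l => Nat.cast_nonneg l.length) x))
    (mul_nonneg (by positivity) (gibbsMean_nonneg hK (fun l => Nat.cast_nonneg _) x))
  have hE : ∫ x, ψ x ∂μ ≤ 1 / 4 := by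
    rw [integral_add (hi1.const_mul _) (hi2.const_mul _), integral_const_mul, integral_const_mul]
    have h1 := mul_le_mul_of_nonneg_left hlen (by positivity : 0 ≤ (16 * p * N)⁻¹)
    have h2 := mul_le_mul_of_nonneg_left
      (integral_longSites_le (N := N) hμ hK (by omega : 0 < n) hfe hg)
      (by positivity : (0 : ℝ) ≤ 10 / N)
    have h3 : (16 * p * (N : ℝ))⁻¹ * (2 * p * N) = 1 / 8 := by
      field_simp
      norm_num
    have h4 : (10 : ℝ) / N * (N / n) ≤ 1 / 8 := by
      rw [div_mul_div_cancel₀ hN0.ne', div_le_div_iff₀ (by linarith) (by norm_num)]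
      linarith
    linarith
  have hmark := mul_meas_ge_le_integral_of_nonneg (μ := μ) (Eventually.of_forall hψ0) hψi (3 / 4)
  refine (measureReal_mono (fun x hx => ?_) (by finiteness)).trans
    (show μ.real {x | 3 / 4 ≤ ψ x} ≤ 1 / 3 by linarith)
  by_contra hcon
  simp only [Set.mem_ofPred_eq, not_le] at hx hcon
  have h1 := partialSum_good_ge (β := β) (h := h) (n := n) hK hN hfe
    (by positivity : 0 < 16 * p * (N : ℝ)) x
  have hP := partialSum_pos (β := β) (h := h) hK hfe x
  have h2 : partialSum K β h (trajectories N) x * (1 - 3 / 4) ≤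
      partialSum K β h (trajectories N) x * (1 - ψ x) :=
    mul_le_mul_of_nonneg_left (by linarith) hP.le
  simp only [hψ] at h2
  linarith

end Pinning
end

noncomputable section

namespace Pinning

variable {K : ℕ → ℝ} {β h : ℝ} {μ : Measure (ℕ → ℝ)} {C₁ C₂ ζ c₁ c₂ : ℝ} {r : ℕ}

/-! ### Coarse graining -/

/-- Greedy grouping from the right: a jump opens a new group only if it is longer than `w` or would
push the first group above `w`. Two neighbouring groups then have total length above `w`, so there
are at most about `2 * l.sum / w` groups. The head term in the bound is what the induction needs. -/
lemma exists_grouping {w : ℕ} {l : List ℕ} (hl : ∀ i ∈ l, 0 < i) :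
    ∃ L : List (List ℕ), L.flatten = l ∧ (∀ g ∈ L, g ≠ [] ∧ (g.sum ≤ w ∨ ∃ j, g = [j])) ∧
      w * L.length + (L.head?.getD []).sum ≤ 2 * l.sum + w := by
  induction l with
  | nil => exact ⟨[], by simp⟩
  | cons j l ih =>
    obtain ⟨L, h1, h2, h3⟩ := ih fun i hi => hl i (by simp [hi])
    rcases lt_or_ge w j with hj | hj
    · refine ⟨[j] :: L, by simp [h1], ?_, ?_⟩
      · intro g hg
        rcases List.mem_cons.1 hg with rfl | hg
        · exact ⟨by simp, Or.inr ⟨j, rfl⟩⟩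
        · exact h2 g hg
      · simp only [List.length_cons, List.head?_cons, Option.getD_some, List.sum_nil,
          List.sum_cons]
        rw [mul_add]
        omega
    · cases L with
      | nil =>
        refine ⟨[[j]], by simpa using h1, by simp, ?_⟩
        simp only [List.length_cons, List.length_nil, List.head?_cons, Option.getD_some,
          List.sum_nil, List.sum_cons]
        omega
      | cons g L =>
        simp only [List.length_cons, List.head?_cons, Option.getD_some] at h3
        rcases le_or_gt (j + g.sum) w with hg | hg
        · refine ⟨(j :: g) :: L, by simpa using h1, ?_, ?_⟩
          · intro g' hg'
            rcases List.mem_cons.1 hg' with rfl | hg'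
            · exact ⟨by simp, Or.inl (by simpa using hg)⟩
            · exact h2 g' (by simp [hg'])
          · simp only [List.length_cons, List.head?_cons, Option.getD_some, List.sum_cons]
            omega
        · refine ⟨[j] :: g :: L, by simpa using h1, ?_, ?_⟩
          · intro g' hg'
            rcases List.mem_cons.1 hg' with rfl | hg'
            · exact ⟨by simp, Or.inr ⟨j, rfl⟩⟩
            · exact h2 g' hg'
          · simp only [List.length_cons, List.head?_cons, Option.getD_some, List.sum_cons,
              List.sum_nil]
            rw [mul_add]
            omega

/-- Trajectories with at most `R` jumps. -/
def shortTrajectories (N R : ℕ) : Finset (List ℕ) := (trajectories N).filter fun l => l.length ≤ R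

/-- Induction on the first jump with a geometric series of ratio `1 + w⁻¹`. Taking `w` of the order
of the block length makes the second factor harmless. -/
lemma card_shortTrajectories_le {w : ℝ} (hw : 1 ≤ w) (R N : ℕ) :
    ((shortTrajectories N R).card : ℝ) ≤ w ^ R * (1 + w⁻¹) ^ N := by
  have hw0 : 0 < w := by linarith
  have hone : ∀ R N : ℕ, (1 : ℝ) ≤ w ^ R * (1 + w⁻¹) ^ N := fun R N =>
    one_le_mul_of_one_le_of_one_le (one_le_pow₀ hw)
      (one_le_pow₀ (by linarith [inv_pos.2 hw0]))
  have hzero : ∀ R, ((shortTrajectories 0 R).card : ℝ) = 1 := fun R => by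
    simp [shortTrajectories, trajectories_zero, Finset.filter_singleton]
  induction R generalizing N with
  | zero =>
    have : shortTrajectories N 0 ⊆ {[]} := by
      intro l hl
      rw [shortTrajectories, Finset.mem_filter] at hl
      simpa using hl.2
    have h1 := Finset.card_le_card this
    rw [Finset.card_singleton] at h1
    exact le_trans (by exact_mod_cast h1) (hone 0 N)
  | succ R ih =>
    rcases Nat.eq_zero_or_pos N with rfl | hN
    · rw [hzero]
      exact hone _ _
    have hcard : ((shortTrajectories N (R + 1)).card : ℝ) =
        ∑ j ∈ Finset.Icc 1 N, ((shortTrajectories (N - j) R).card : ℝ) := by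
      simp only [shortTrajectories, Finset.card_filter]
      push_cast
      rw [sum_trajectories hN]
      simp
    rw [hcard]
    calc ∑ j ∈ Finset.Icc 1 N, ((shortTrajectories (N - j) R).card : ℝ)
        ≤ ∑ j ∈ Finset.Icc 1 N, w ^ R * (1 + w⁻¹) ^ (N - j) :=
          Finset.sum_le_sum fun j _ => ih (N - j)
      _ = w ^ R * ∑ i ∈ Finset.range N, (1 + w⁻¹) ^ i := by
          rw [← Finset.mul_sum, ← Finset.sum_range_reflect]
          congr 1
          rw [← Finset.Ico_add_one_right_eq_Icc, Finset.sum_Ico_eq_sum_range]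
          refine Finset.sum_congr (by simp) fun i _ => ?_
          congr 1
          omega
      _ = w ^ R * (w * ((1 + w⁻¹) ^ N - 1)) := by
          rw [geom_sum_eq (by simp [hw0.ne'])]
          congr 1
          rw [add_sub_cancel_left, div_inv_eq_mul, mul_comm]
      _ ≤ w ^ (R + 1) * (1 + w⁻¹) ^ N := by
          rw [pow_succ, mul_assoc]
          refine mul_le_mul_of_nonneg_left (mul_le_mul_of_nonneg_left (by linarith) hw0.le)
            (by positivity)

/-- Trajectories from `0` to `ℓ` with `m` contacts. -/
def segments (ℓ m : ℕ) : Finset (List ℕ) := (trajectories ℓ).filter fun l => l.length = m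

lemma segments_subset (ℓ m : ℕ) : segments ℓ m ⊆ trajectories ℓ := Finset.filter_subset _ _

/-- The trajectories made of successive segments with prescribed lengths and contact numbers. -/
def coarseTrajectories : List (ℕ × ℕ) → Finset (List ℕ)
  | [] => {[]}
  | q :: c => concat (segments q.1 q.2) (coarseTrajectories c)

lemma coarseTrajectories_subset (c : List (ℕ × ℕ)) :
    coarseTrajectories c ⊆ trajectories (c.map Prod.fst).sum := by
  induction c with
  | nil => simp [coarseTrajectories, trajectories_zero]
  | cons q c ih =>
    rw [List.map_cons, List.sum_cons]
    exact concat_subset (segments_subset _ _) ih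

lemma length_of_mem_coarseTrajectories {c : List (ℕ × ℕ)} {l : List ℕ}
    (hl : l ∈ coarseTrajectories c) : l.length = (c.map Prod.snd).sum := by
  induction c generalizing l with
  | nil =>
    rw [coarseTrajectories, Finset.mem_singleton] at hl
    simp [hl]
  | cons q c ih =>
    obtain ⟨l₁, h₁, l₂, h₂, rfl⟩ := mem_concat.1 hl
    rw [List.length_append, ih h₂, (Finset.mem_filter.1 h₁).2]
    simp

lemma flatten_mem_coarseTrajectories {L : List (List ℕ)} (hL : ∀ i ∈ L.flatten, 0 < i) :
    L.flatten ∈ coarseTrajectories (L.map fun g => (g.sum, g.length)) := by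
  induction L with
  | nil => simp [coarseTrajectories]
  | cons g L ih =>
    simp only [List.flatten_cons, List.mem_append] at hL
    refine mem_concat.2 ⟨g, ?_, L.flatten, ih fun i hi => hL i (Or.inr hi), by simp⟩
    rw [segments, Finset.mem_filter, mem_trajectories]
    exact ⟨⟨fun i hi => hL i (Or.inl hi), rfl⟩, rfl⟩

lemma Feasible.of_concat (hK : ∀ n, 0 ≤ K n) {X Y : Finset (List ℕ)}
    (hf : Feasible K (Pinning.concat X Y)) : Feasible K X ∧ Feasible K Y := by
  obtain ⟨l, hl, hp⟩ := hf
  obtain ⟨l₁, h₁, l₂, h₂, rfl⟩ := mem_concat.1 hl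
  rw [List.map_append, List.prod_append] at hp
  exact ⟨⟨l₁, h₁, pos_of_mul_pos_left hp (prod_nonneg_of_nonneg hK l₂)⟩,
    ⟨l₂, h₂, pos_of_mul_pos_right hp (prod_nonneg_of_nonneg hK l₁)⟩⟩

lemma Feasible.of_coarse (hK : ∀ n, 0 ≤ K n) {c : List (ℕ × ℕ)}
    (hf : Feasible K (coarseTrajectories c)) : ∀ q ∈ c, Feasible K (segments q.1 q.2) := by
  induction c with
  | nil => simp
  | cons q c ih =>
    have := Feasible.of_concat hK hf
    intro q' hq'
    rcases List.mem_cons.1 hq' with rfl | hq'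
    exacts [this.1, ih this.2 q' hq']

lemma meanLog_coarse (hμ : IsStationaryLaw μ C₁ C₂) (hK : ∀ n, 0 ≤ K n) {c : List (ℕ × ℕ)}
    (hf : Feasible K (coarseTrajectories c)) :
    meanLog K β h μ (coarseTrajectories c) =
      (c.map fun q => meanLog K β h μ (segments q.1 q.2)).sum := by
  induction c with
  | nil => simp [coarseTrajectories, meanLog, partialSum_nil]
  | cons q c ih =>
    have h1 := Feasible.of_concat hK hf
    rw [coarseTrajectories, meanLog_concat hμ hK (segments_subset _ _)
      (coarseTrajectories_subset c) h1.1 h1.2, ih h1.2, List.map_cons, List.sum_cons]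

/-- A finite set of coarse grained trajectories. -/
def coarseConfigs (N R : ℕ) : Finset (List (ℕ × ℕ)) :=
  (shortTrajectories N R ×ˢ (Finset.range (N + 1)).biUnion fun M => shortTrajectories M R).image
    fun p => p.1.zip p.2

lemma card_coarseConfigs_le {w : ℝ} (hw : 1 ≤ w) (R N : ℕ) :
    ((coarseConfigs N R).card : ℝ) ≤ (N + 1) * (w ^ R * (1 + w⁻¹) ^ N) ^ 2 := by
  have hw0 : 0 < w := by linarith
  set B : ℝ := w ^ R * (1 + w⁻¹) ^ N with hB
  have hB0 : 0 < B := by positivity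
  have h1 : ((coarseConfigs N R).card : ℝ) ≤ ((shortTrajectories N R).card : ℝ) *
      ∑ M ∈ Finset.range (N + 1), ((shortTrajectories M R).card : ℝ) := by
    refine le_trans (Nat.cast_le.2 Finset.card_image_le) ?_
    rw [Finset.card_product]
    push_cast
    refine mul_le_mul_of_nonneg_left ?_ (Nat.cast_nonneg _)
    exact_mod_cast Finset.card_biUnion_le
  have h2 : ∑ M ∈ Finset.range (N + 1), ((shortTrajectories M R).card : ℝ) ≤ (N + 1) * B := by
    calc _ ≤ ∑ M ∈ Finset.range (N + 1), B := by
          refine Finset.sum_le_sum fun M hM => (card_shortTrajectories_le hw R M).trans ?_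
          rw [Finset.mem_range] at hM
          exact mul_le_mul_of_nonneg_left
            (pow_le_pow_right₀ (by linarith [inv_pos.2 hw0]) (by omega)) (by positivity)
      _ = _ := by simp
  calc ((coarseConfigs N R).card : ℝ) ≤ B * ((N + 1) * B) :=
        h1.trans (mul_le_mul (card_shortTrajectories_le hw R N) h2
          (Finset.sum_nonneg fun _ _ => Nat.cast_nonneg _) hB0.le)
    _ = _ := by ring

/-- The coarse grained trajectories with few contacts and few sites in long jumps. -/
structure IsGoodConfig (K : ℕ → ℝ) (n N : ℕ) (M : ℝ) (c : List (ℕ × ℕ)) : Prop where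
  segment : ∀ q ∈ c, 0 < q.1 ∧ (q.1 ≤ n / 2 ∨ q.2 = 1)
  feasible : Feasible K (coarseTrajectories c)
  sum_fst : (c.map Prod.fst).sum = N
  sum_snd : ((c.map Prod.snd).sum : ℝ) ≤ M
  sum_long : 10 * (c.map fun q => if n < q.1 then q.1 else 0).sum ≤ N
  length_le : (n / 2) * c.length ≤ 2 * N + n / 2

lemma longSites_flatten (n : ℕ) (L : List (List ℕ)) :
    longSites n L.flatten = (L.map (longSites n)).sum := by
  induction L with
  | nil => simp [longSites]
  | cons g L ih => rw [List.flatten_cons, longSites_append, ih, List.map_cons, List.sum_cons]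

lemma exists_goodConfig {n N : ℕ} (hn : 2 ≤ n) {M : ℝ} {l : List ℕ}
    (hl : l ∈ goodTrajectories n N M) (hp : 0 < (l.map K).prod) :
    ∃ c ∈ coarseConfigs N (2 * N / (n / 2) + 1), IsGoodConfig K n N M c ∧
      l ∈ coarseTrajectories c := by
  rw [goodTrajectories, Finset.mem_filter] at hl
  obtain ⟨hlN, hlM, hlong⟩ := hl
  have hl' := mem_trajectories.1 hlN
  obtain ⟨L, rfl, h2, h3⟩ := exists_grouping (w := n / 2) hl'.1
  have hmem := flatten_mem_coarseTrajectories hl'.1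
  have hlenL : (n / 2) * L.length ≤ 2 * N + n / 2 := by
    rw [hl'.2] at h3
    omega
  have hR : L.length ≤ 2 * N / (n / 2) + 1 := by
    have hw : 0 < n / 2 := by omega
    rw [← Nat.add_div_right _ hw, Nat.le_div_iff_mul_le hw, mul_comm]
    exact hlenL
  have hpos : ∀ g ∈ L, 0 < g.length ∧ 0 < g.sum := fun g hg => by
    have h4 := (h2 g hg).1
    have h5 : 0 < g.length := List.length_pos_iff.2 h4
    refine ⟨h5, h5.trans_le (length_le_sum fun i hi => hl'.1 i ?_)⟩
    exact List.mem_flatten.2 ⟨g, hg, hi⟩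
  have hsum1 : (L.map List.sum).sum = N := by rw [← List.sum_flatten, hl'.2]
  have hsum2 : (L.map List.length).sum = L.flatten.length := by rw [List.length_flatten]
  refine ⟨L.map fun g => (g.sum, g.length), ?_, ⟨?_, ⟨_, hmem, hp⟩, ?_, ?_, ?_, ?_⟩, hmem⟩
  · rw [coarseConfigs, Finset.mem_image]
    refine ⟨(L.map List.sum, L.map List.length), ?_, ?_⟩
    · simp only [Finset.mem_product, Finset.mem_biUnion, shortTrajectories, Finset.mem_filter,
        mem_trajectories, List.mem_map, forall_exists_index, and_imp, forall_apply_eq_imp_iff₂,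
        List.length_map, Finset.mem_range]
      refine ⟨⟨⟨fun g hg => (hpos g hg).2, hsum1⟩, hR⟩, L.flatten.length, ?_,
        ⟨fun g hg => (hpos g hg).1, hsum2⟩, hR⟩
      have := length_le_of_mem hlN
      omega
    · rw [List.zip_map']
  · intro q hq
    obtain ⟨g, hg, rfl⟩ := List.mem_map.1 hq
    refine ⟨(hpos g hg).2, ?_⟩
    rcases (h2 g hg).2 with h4 | ⟨j, rfl⟩
    · exact Or.inl h4
    · exact Or.inr rfl
  · rw [List.map_map]
    exact hsum1
  · rw [List.map_map]
    change ((L.map List.length).sum : ℝ) ≤ M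
    rwa [hsum2]
  · refine le_trans ?_ hlong
    rw [longSites_flatten, List.map_map]
    -- A group longer than `n` exceeds `n / 2`, hence is a single jump already counted among the
    -- long sites.
    refine Nat.mul_le_mul_left _ (List.sum_le_sum fun g hg => ?_)
    simp only [Function.comp_apply]
    split_ifs with h4
    · rcases (h2 g hg).2 with h5 | ⟨j, rfl⟩
      · omega
      · simp only [List.sum_singleton] at h4
        simp [longSites, h4]
    · exact Nat.zero_le _
  · simpa using hlenL

end Pinning
end

/-! ### Selection of one coarse configuration by concentration and a union bound. -/

noncomputable section

namespace Pinning

variable {K : ℕ → ℝ} {β h : ℝ} {μ : Measure (ℕ → ℝ)} {C₁ C₂ ζ c₁ c₂ : ℝ} {r : ℕ}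

lemma one_le_log_natCast {n : ℕ} (hn : 80 ≤ n) : 1 ≤ Real.log n := by
  have hn0 : (80 : ℝ) ≤ n := by exact_mod_cast hn
  rw [Real.le_log_iff_exp_le (by linarith)]
  linarith [Real.exp_one_lt_d9]

lemma mul_le_half_cast {n : ℕ} (hn : 80 ≤ n) : (2 / 5 : ℝ) * n ≤ (n / 2 : ℕ) := by
  have h1 : n ≤ 2 * (n / 2) + 1 := by omega
  have h2 : (n : ℝ) ≤ 2 * (n / 2 : ℕ) + 1 := by exact_mod_cast h1
  have hn0 : (80 : ℝ) ≤ n := by exact_mod_cast hn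
  linarith

lemma half_cast_le (n : ℕ) : ((n / 2 : ℕ) : ℝ) ≤ n / 2 := by
  have := Nat.cast_div_le (α := ℝ) (m := n) (n := 2)
  simpa using this

lemma eventually_card_coarseConfigs_le {n : ℕ} (hn : 80 ≤ n) :
    ∀ᶠ N : ℕ in atTop, ((coarseConfigs N (2 * N / (n / 2) + 1)).card : ℝ) ≤
      Real.exp (N / n * (16 * Real.log n)) := by
  have hn0 : (80 : ℝ) ≤ n := by exact_mod_cast hn
  have hlog := one_le_log_natCast hn
  have hlim : Tendsto (fun N : ℕ => (Real.log ((N : ℝ) + 1) + 2 * Real.log n) / ((N : ℝ) + 1))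
      atTop (𝓝 (0 + 0)) := by
    have h1 : Tendsto (fun N : ℕ => (N : ℝ) + 1) atTop atTop :=
      tendsto_atTop_add_const_right _ _ tendsto_natCast_atTop_atTop
    simp_rw [add_div]
    refine Tendsto.add ?_ (h1.const_div_atTop _)
    exact (Real.isLittleO_log_id_atTop.tendsto_div_nhds_zero).comp h1
  rw [zero_add] at hlim
  filter_upwards [hlim.eventually (gt_mem_nhds (by positivity : (0 : ℝ) < 1 / (2 * n))),
    eventually_ge_atTop 1] with N hN hN1
  have hN0 : (1 : ℝ) ≤ N := by exact_mod_cast hN1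
  have hsmall : Real.log ((N : ℝ) + 1) + 2 * Real.log n ≤ N / n := by
    rw [div_lt_div_iff₀ (by linarith) (by linarith)] at hN
    rw [le_div_iff₀ (by linarith)]
    linarith
  set w : ℝ := ((n / 2 : ℕ) : ℝ) with hw
  have hwl : (2 / 5 : ℝ) * n ≤ w := mul_le_half_cast hn
  have hw1 : 1 ≤ w := by linarith
  have hw0 : 0 < w := by linarith
  refine (card_coarseConfigs_le hw1 _ N).trans ?_
  set R : ℕ := 2 * N / (n / 2) + 1 with hR
  have hNw : (N : ℝ) / w ≤ 5 / 2 * (N / n) := by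
    rw [div_le_iff₀ hw0]
    calc (N : ℝ) = 5 / 2 * (N / n) * (2 / 5 * n) := by field_simp
      _ ≤ _ := mul_le_mul_of_nonneg_left hwl (by positivity)
  have hRle : (R : ℝ) ≤ 5 * (N / n) + 1 := by
    have : ((2 * N / (n / 2) : ℕ) : ℝ) ≤ (2 * N : ℕ) / ((n / 2 : ℕ) : ℝ) := Nat.cast_div_le
    rw [hR]
    push_cast at this ⊢
    rw [mul_div_assoc] at this
    linarith
  have hlogw : Real.log w ≤ Real.log n :=
    Real.log_le_log hw0 (by linarith [half_cast_le n])
  have hlogw0 : 0 ≤ Real.log w := Real.log_nonneg hw1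
  have hlog1 : Real.log (1 + w⁻¹) ≤ w⁻¹ := by
    have := Real.log_le_sub_one_of_pos (by positivity : 0 < 1 + w⁻¹)
    linarith
  -- The square in the cardinality bound accounts for lengths and contact numbers. In units of `(N /
  -- n) log n` the exponent is at most `10` from `w ^ R`, `5` from `(1 + w⁻¹) ^ N`, and `1` from the
  -- lower-order terms `log (N + 1) + 2 log n`: in all `16`.
  rw [← Real.log_le_iff_le_exp (by positivity), Real.log_mul (by positivity) (by positivity),
    Real.log_pow, Real.log_mul (by positivity) (by positivity), Real.log_pow, Real.log_pow]
  have h1 : (R : ℝ) * Real.log w ≤ (5 * (N / n) + 1) * Real.log n :=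
    mul_le_mul hRle hlogw hlogw0 (by positivity)
  have h2 : (N : ℝ) * Real.log (1 + w⁻¹) ≤ 5 / 2 * (N / n) := by
    refine (mul_le_mul_of_nonneg_left hlog1 (by linarith)).trans ?_
    rw [← div_eq_mul_inv]
    exact hNw
  have h3 : (N : ℝ) / n * 1 ≤ N / n * Real.log n :=
    mul_le_mul_of_nonneg_left hlog (by positivity)
  push_cast
  nlinarith

/-- The error, per block of length `n`, in the comparison of the free energy with the means of the
logarithms of the segment partition functions. -/
def blockError (C₂ β p : ℝ) (n : ℕ) : ℝ :=
  2 + 16 * Real.log n + √(512 * C₂ * (β ^ 2 * p * n * Real.log n))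

lemma partialSum_good_le_sum (hK : ∀ n, 0 ≤ K n) {n N : ℕ} (hn : 2 ≤ n) {M : ℝ}
    {S : Finset (List (ℕ × ℕ))}
    (hS : ∀ c ∈ coarseConfigs N (2 * N / (n / 2) + 1), IsGoodConfig K n N M c → c ∈ S)
    (x : ℕ → ℝ) :
    partialSum K β h (goodTrajectories n N M) x ≤
      ∑ c ∈ S, partialSum K β h (coarseTrajectories c) x := by
  have hw : ∀ l : List ℕ, 0 ≤ (l.map K).prod * Real.exp (β * energy x l + h * l.length) :=
    fun l => mul_nonneg (prod_nonneg_of_nonneg hK l) (Real.exp_pos _).le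
  calc partialSum K β h (goodTrajectories n N M) x
      ≤ ∑ l ∈ goodTrajectories n N M, ∑ c ∈ S, if l ∈ coarseTrajectories c then
          (l.map K).prod * Real.exp (β * energy x l + h * l.length) else 0 := by
        refine Finset.sum_le_sum fun l hl => ?_
        have hterm : ∀ c ∈ S, 0 ≤ if l ∈ coarseTrajectories c then
            (l.map K).prod * Real.exp (β * energy x l + h * l.length) else 0 := fun c _ => by
          split_ifs
          exacts [hw l, le_rfl]
        rcases (prod_nonneg_of_nonneg hK l).eq_or_lt with h0 | h0
        · rw [← h0, zero_mul]
          rw [← h0, zero_mul] at hterm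
          exact Finset.sum_nonneg hterm
        · obtain ⟨c, hc, hg, hlc⟩ := exists_goodConfig hn hl h0
          refine le_trans (le_of_eq ?_) (Finset.single_le_sum hterm (hS c hc hg))
          rw [if_pos hlc]
    _ = ∑ c ∈ S, ∑ l ∈ goodTrajectories n N M, if l ∈ coarseTrajectories c then
          (l.map K).prod * Real.exp (β * energy x l + h * l.length) else 0 := Finset.sum_comm
    _ ≤ _ := by
        refine Finset.sum_le_sum fun c _ => ?_
        rw [← Finset.sum_filter]
        exact Finset.sum_le_sum_of_subset_of_nonneg (fun l hl => (Finset.mem_filter.1 hl).2)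
          fun l _ _ => hw l

lemma eventually_measure_log_partialSum_lt (hμ : IsStationaryLaw μ C₁ C₂)
    (hK : IsStretchedKernel K ζ r c₁ c₂) (hβ : 0 < β) (h : ℝ) {δ ε : ℝ} (hδ : 0 < δ)
    (hε : 0 < ε) :
    ∀ᶠ N : ℕ in atTop, μ.real {x | Real.log (partialSum K β h (trajectories N) x) <
      (freeEnergyOfLaw K β h μ - δ) * N} ≤ ε := by
  have := hμ.prob
  have h1 := tendstoInMeasure_of_tendsto_ae (μ := μ)
    (fun N => ((measurable_log_partialSum (K := K) (β := β) (h := h)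
      (trajectories N)).const_mul ((N : ℝ)⁻¹)).aestronglyMeasurable)
    (ae_tendsto_freeEnergy hμ hK hβ h)
  rw [tendstoInMeasure_iff_measureReal_dist] at h1
  filter_upwards [(h1 δ hδ).eventually (ge_mem_nhds hε), eventually_ge_atTop 1] with N hN hN1
  have hN0 : (0 : ℝ) < N := by exact_mod_cast hN1
  refine (measureReal_mono (fun x hx => ?_) (by finiteness)).trans hN
  simp only [Set.mem_ofPred_eq] at hx ⊢
  rw [Real.dist_eq]
  refine le_trans ?_ (neg_le_abs _)
  have h2 : (N : ℝ)⁻¹ * Real.log (partialSum K β h (trajectories N) x) <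
      freeEnergyOfLaw K β h μ - δ := by
    rw [inv_mul_lt_iff₀ hN0]
    linarith
  linarith

/-- Otherwise every good configuration has too small a mean. Outside three exceptional events the
full partition function is near `exp(F N)`, good trajectories carry a quarter of it, and every
configuration is close to its mean; summing over configurations contradicts this. In `blockError`,
the logarithm pays for the entropy, the square root for the fluctuations, and the `2` for the error
in `F` and the factor `1/4`. -/
lemma exists_config_meanLog_ge (hμ : IsStationaryLaw μ C₁ C₂) (hK : IsStretchedKernel K ζ r c₁ c₂)
    (hβ : 0 < β) {n : ℕ} (hn : 80 ≤ n) {p : ℝ} (hp : 0 < p)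
    (hlen : ∀ᶠ N : ℕ in atTop, ∫ x, gibbsMean K β h N (fun l => l.length) x ∂μ ≤ 2 * p * N)
    (hg : ∀ j, n < j → ∫ x, jumpProb K β h j x ∂μ ≤ ((j : ℝ) ^ 3)⁻¹) :
    ∃ N : ℕ, 2 * n ≤ N ∧ ∃ c, IsGoodConfig K n N (16 * p * N) c ∧
      freeEnergyOfLaw K β h μ * N - N / n * blockError C₂ β p n ≤
        (c.map fun q => meanLog K β h μ (segments q.1 q.2)).sum := by
  classical
  have := hμ.prob
  have hn0 : (80 : ℝ) ≤ n := by exact_mod_cast hn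
  have hlog := one_le_log_natCast hn
  have hC₂ := hμ.pos₂
  set s : ℝ := √(512 * C₂ * (β ^ 2 * p * n * Real.log n)) with hs
  have harg : 0 < 512 * C₂ * (β ^ 2 * p * n * Real.log n) := by positivity
  have hs0 : 0 < s := Real.sqrt_pos.2 harg
  have hs2 : s ^ 2 = 512 * C₂ * (β ^ 2 * p * n * Real.log n) := Real.sq_sqrt harg.le
  have hlimC : Tendsto (fun N : ℕ => C₁ * Real.exp (-(N * (16 * Real.log n / n)))) atTop
      (𝓝 (C₁ * 0)) := by
    refine Tendsto.const_mul _ (Real.tendsto_exp_neg_atTop_nhds_zero.comp ?_)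
    exact Tendsto.atTop_mul_const (by positivity) tendsto_natCast_atTop_atTop
  rw [mul_zero] at hlimC
  obtain ⟨N, hNlen, hNcard, hNlog, hNC, hNn, hNr⟩ := (hlen.and
    ((eventually_card_coarseConfigs_le hn).and
    ((eventually_measure_log_partialSum_lt hμ hK hβ h (by positivity : (0 : ℝ) < (n : ℝ)⁻¹)
      (by norm_num : (0 : ℝ) < 1 / 6)).and
    ((hlimC.eventually (ge_mem_nhds (by norm_num : (0 : ℝ) < 1 / 6))).and
    ((eventually_ge_atTop (2 * n)).and (eventually_ge_atTop r)))))).exists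
  have hN : 0 < N := by omega
  have hN0 : (0 : ℝ) < N := by exact_mod_cast hN
  have hfe := hK.feasible hNr
  have hkk : 2 ≤ (N : ℝ) / n := by
    rw [le_div_iff₀ (by linarith)]
    exact_mod_cast hNn
  refine ⟨N, hNn, ?_⟩
  set S := (coarseConfigs N (2 * N / (n / 2) + 1)).filter
    (fun c => IsGoodConfig K n N (16 * p * N) c) with hS
  have hSsub : ∀ c ∈ S, IsGoodConfig K n N (16 * p * N) c := fun c hc =>
    (Finset.mem_filter.1 hc).2
  have hScard : (S.card : ℝ) ≤ Real.exp (N / n * (16 * Real.log n)) :=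
    (Nat.cast_le.2 (Finset.card_filter_le _ _)).trans hNcard
  by_contra! hcon
  -- the three exceptional events
  have hA3 : μ.real (⋃ c ∈ S, {x | N / n * s ≤ |Real.log (partialSum K β h
      (coarseTrajectories c) x) - meanLog K β h μ (coarseTrajectories c)|}) ≤ 1 / 6 := by
    refine (measureReal_biUnion_finset_le _ _).trans ?_
    calc ∑ c ∈ S, μ.real {x | N / n * s ≤ |Real.log (partialSum K β h
          (coarseTrajectories c) x) - meanLog K β h μ (coarseTrajectories c)|}
        ≤ ∑ c ∈ S, C₁ * Real.exp (-(N / n * (32 * Real.log n))) := by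
          refine Finset.sum_le_sum fun c hc => ?_
          have hgc := hSsub c hc
          have hsub := coarseTrajectories_subset c
          rw [hgc.sum_fst] at hsub
          refine (concentration_log_partialSum hμ hK.nonneg hβ hsub hgc.feasible
            (M := 16 * p * N) (by positivity) (fun l hl => ?_)
            (by positivity : 0 < N / n * s)).trans_eq ?_
          · rw [length_of_mem_coarseTrajectories hl]
            exact hgc.sum_snd
          -- With at most `16 p N` contacts, the constant `512 = 16 · 32` makes the Gaussian
          -- exponent `32 (N / n) log n`, twice the entropy exponent.
          · congr 3
            rw [mul_pow, hs2]
            field_simp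
            ring
      _ = S.card * (C₁ * Real.exp (-(N / n * (32 * Real.log n)))) := by
          rw [Finset.sum_const, nsmul_eq_mul]
      _ ≤ Real.exp (N / n * (16 * Real.log n)) *
            (C₁ * Real.exp (-(N / n * (32 * Real.log n)))) :=
          mul_le_mul_of_nonneg_right hScard (mul_nonneg hμ.pos₁.le (Real.exp_pos _).le)
      _ = C₁ * Real.exp (-(N * (16 * Real.log n / n))) := by
          rw [mul_left_comm, ← Real.exp_add]
          congr 2
          field_simp
          ring
      _ ≤ 1 / 6 := hNC
  have hA2 := measure_good_small hμ hK.nonneg hn hN hfe hp hNlen hg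
  -- The exceptional events have total probability at most `2/3`.
  obtain ⟨x, hx⟩ : ∃ x, x ∉ ({x | Real.log (partialSum K β h (trajectories N) x) <
      (freeEnergyOfLaw K β h μ - (n : ℝ)⁻¹) * N} ∪
      {x | partialSum K β h (goodTrajectories n N (16 * p * N)) x <
        partialSum K β h (trajectories N) x / 4}) ∪
      ⋃ c ∈ S, {x | N / n * s ≤ |Real.log (partialSum K β h
        (coarseTrajectories c) x) - meanLog K β h μ (coarseTrajectories c)|} := by
    by_contra! hall
    have h1 := Set.eq_univ_of_forall hall
    have h2 : μ.real Set.univ ≤ 1 / 6 + 1 / 3 + 1 / 6 := by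
      rw [← h1]
      exact (measureReal_union_le _ _).trans
        (add_le_add ((measureReal_union_le _ _).trans (add_le_add hNlog hA2)) hA3)
    rw [probReal_univ] at h2
    norm_num at h2
  simp only [Set.mem_union, Set.mem_ofPred_eq, not_or, not_lt, Set.mem_iUnion, not_exists,
    not_le] at hx
  obtain ⟨⟨hx1, hx2⟩, hx3⟩ := hx
  have hP := partialSum_pos (β := β) (h := h) hK.nonneg hfe x
  have h4 := partialSum_good_le_sum (β := β) (h := h) hK.nonneg (by omega : 2 ≤ n) (S := S)
    (M := 16 * p * N) (fun c hc hgc => Finset.mem_filter.2 ⟨hc, hgc⟩) x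
  set F := freeEnergyOfLaw K β h μ with hF
  have h5 : ∑ c ∈ S, partialSum K β h (coarseTrajectories c) x ≤
      S.card * Real.exp (F * N - N / n * blockError C₂ β p n + N / n * s) := by
    rw [← nsmul_eq_mul, ← Finset.sum_const]
    refine Finset.sum_le_sum fun c hc => ?_
    have hgc := hSsub c hc
    have h6 := hcon c hgc
    rw [← meanLog_coarse hμ hK.nonneg hgc.feasible] at h6
    have h7 := (abs_lt.1 (hx3 c hc)).2
    rw [← Real.log_le_iff_le_exp (partialSum_pos hK.nonneg hgc.feasible x)]
    linarith
  have h8 : Real.exp ((F - (n : ℝ)⁻¹) * N) ≤ partialSum K β h (trajectories N) x :=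
    (Real.le_log_iff_exp_le hP).1 hx1
  have h9 : Real.exp ((F - (n : ℝ)⁻¹) * N) / 4 ≤ Real.exp (N / n * (16 * Real.log n)) *
      Real.exp (F * N - N / n * blockError C₂ β p n + N / n * s) := by
    refine le_trans ?_ (h5.trans (mul_le_mul_of_nonneg_right hScard (Real.exp_pos _).le))
    linarith
  rw [← Real.exp_add, show N / n * (16 * Real.log n) +
    (F * N - N / n * blockError C₂ β p n + N / n * s) = (F - (n : ℝ)⁻¹) * N + -((N : ℝ) / n) by
      rw [blockError, ← hs]; field_simp; ring, Real.exp_add, div_eq_mul_inv,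
    mul_le_mul_iff_right₀ (Real.exp_pos _)] at h9
  have h10 : Real.exp (-((N : ℝ) / n)) ≤ Real.exp (-2) := Real.exp_le_exp.2 (by linarith)
  have h11 : Real.exp (-2) < 1 / 4 := by
    rw [Real.exp_neg, show (2 : ℝ) = 1 + 1 by norm_num, Real.exp_add, one_div]
    have := Real.exp_one_gt_d9
    exact inv_strictAnti₀ (by norm_num) (by nlinarith)
  norm_num at h9 h11
  linarith

end Pinning
end

/-! ### Extraction of a good segment, and comparison of a single jump with a competitor. -/

noncomputable section

namespace Pinning

variable {K : ℕ → ℝ} {β h : ℝ} {μ : Measure (ℕ → ℝ)} {C₁ C₂ ζ c₁ c₂ : ℝ} {r : ℕ}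

lemma sum_fst_le {c : List (ℕ × ℕ)} {n : ℕ} {α F γ κ : ℝ} {a : ℕ × ℕ → ℝ}
    (hc : ∀ q ∈ c, (q.1 : ℝ) ≤ ((if n < q.1 then q.1 else 0 : ℕ) : ℝ) + α * (F * q.1 - a q) + γ +
      κ * q.2) :
    ((c.map Prod.fst).sum : ℝ) ≤ ((c.map fun q => if n < q.1 then q.1 else 0).sum : ℕ) +
      α * (F * (c.map Prod.fst).sum - (c.map a).sum) + γ * c.length + κ * (c.map Prod.snd).sum := by
  induction c with
  | nil => simp
  | cons q c ih =>
    have h1 := ih fun q' hq' => hc q' (by simp [hq'])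
    have h2 := hc q (by simp)
    simp only [List.map_cons, List.sum_cons, List.length_cons, Nat.cast_add, Nat.cast_one] at h1 ⊢
    linarith

/-- Every piece has a nonnegative deficit `F ℓ - meanLog`, and the deficits sum to at most `(N / n)
E`. Long jumps, jumps of intermediate length, tiny pieces, and pieces with many contacts or a large
deficit together cover too little of `[0, N]`, so a piece of none of these kinds exists. -/
lemma exists_good_segment (hμ : IsStationaryLaw μ C₁ C₂) (hK : IsStretchedKernel K ζ r c₁ c₂)
    {n N : ℕ} (hn : 80 ≤ n) (hN : 2 * n ≤ N) {p E : ℝ} (hp : 0 < p) (hE : 0 < E)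
    {c : List (ℕ × ℕ)} (hc : IsGoodConfig K n N (16 * p * N) c)
    (hsum : freeEnergyOfLaw K β h μ * N - N / n * E ≤
      (c.map fun q => meanLog K β h μ (segments q.1 q.2)).sum)
    (hmid : ∀ j, n / 2 < j → j ≤ n → 0 < K j →
      10 * E ≤ freeEnergyOfLaw K β h μ * j - (Real.log (K j) + h)) :
    ∃ ℓ m : ℕ, 0 < ℓ ∧ ℓ ≤ n / 2 ∧ n ≤ 40 * ℓ ∧ (m : ℝ) ≤ 80 * p * n ∧
      Feasible K (segments ℓ m) ∧
      freeEnergyOfLaw K β h μ * ℓ - 5 * E ≤ meanLog K β h μ (segments ℓ m) := by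
  set F := freeEnergyOfLaw K β h μ with hF
  have hn0 : (80 : ℝ) ≤ n := by exact_mod_cast hn
  have hN0 : 2 * (n : ℝ) ≤ N := by exact_mod_cast hN
  set w : ℝ := ((n / 2 : ℕ) : ℝ) with hw
  have hwl : (2 / 5 : ℝ) * n ≤ w := mul_le_half_cast hn
  have hwu : w ≤ n / 2 := half_cast_le n
  have hw0 : 0 < w := by linarith
  by_contra! hcon
  have hfeas := hc.feasible.of_coarse hK.nonneg
  -- If no good segment exists, each length is charged to one term: a long jump to the indicator, an
  -- intermediate jump to `n / (10 E)` times its deficit, a poor segment to `w / (5 E)` times its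
  -- deficit, a tiny one to `w / 16` (as `n / 40 ≤ w / 16`), and a crowded one to its contacts.
  have hterm : ∀ q ∈ c, (q.1 : ℝ) ≤ ((if n < q.1 then q.1 else 0 : ℕ) : ℝ) +
      (n / (10 * E) + w / (5 * E)) * (F * q.1 - meanLog K β h μ (segments q.1 q.2)) + w / 16 +
      w / (80 * p * n) * q.2 := by
    intro q hq
    obtain ⟨hq0, hq1⟩ := hc.segment q hq
    have hd : 0 ≤ F * q.1 - meanLog K β h μ (segments q.1 q.2) :=
      sub_nonneg.2 (meanLog_le hμ hK hq0 (segments_subset _ _) (hfeas q hq))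
    set d := F * q.1 - meanLog K β h μ (segments q.1 q.2) with hdd
    have hnE : 0 ≤ (n : ℝ) / (10 * E) * d := by positivity
    have hwE : 0 ≤ w / (5 * E) * d := by positivity
    have hwp : 0 ≤ w / (80 * p * n) * q.2 := by positivity
    rw [add_mul]
    by_cases hlong : n < q.1
    · rw [if_pos hlong]
      linarith
    rw [if_neg hlong, Nat.cast_zero]
    rcases le_or_gt q.1 (n / 2) with hsmall | hsmall
    · have hqw : (q.1 : ℝ) ≤ w := Nat.cast_le.2 hsmall
      by_cases h1 : n ≤ 40 * q.1
      · by_cases h2 : (q.2 : ℝ) ≤ 80 * p * n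
        · have h3 := hcon q.1 q.2 hq0 hsmall h1 h2 (hfeas q hq)
          have h4 : 5 * E ≤ d := by linarith
          have h5 : w ≤ w / (5 * E) * d := by
            rw [div_mul_eq_mul_div, le_div_iff₀ (by positivity)]
            exact mul_le_mul_of_nonneg_left h4 hw0.le
          linarith
        · have h5 : w ≤ w / (80 * p * n) * q.2 := by
            rw [div_mul_eq_mul_div, le_div_iff₀ (by positivity)]
            exact mul_le_mul_of_nonneg_left (not_le.1 h2).le hw0.le
          linarith
      · have h2 : 40 * (q.1 : ℝ) ≤ n := by exact_mod_cast (not_le.1 h1).le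
        linarith
    · have hm : q.2 = 1 := hq1.resolve_left (by omega)
      obtain ⟨l, hl, hlp⟩ := hfeas q hq
      have hseg : segments q.1 q.2 = {[q.1]} := by
        ext l
        rw [segments, Finset.mem_filter, mem_trajectories, Finset.mem_singleton, hm]
        constructor
        · rintro ⟨⟨_, h2⟩, h3⟩
          obtain ⟨j, rfl⟩ := List.length_eq_one_iff.1 h3
          simpa using h2
        · rintro rfl
          simpa using hq0
      rw [hseg, Finset.mem_singleton] at hl
      have hKp : 0 < K q.1 := by simpa [hl] using hlp
      have h1 := hmid q.1 hsmall (not_lt.1 hlong) hKp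
      have h2 : d = F * q.1 - (Real.log (K q.1) + h) := by
        rw [hdd, hseg, meanLog_singleton hμ hq0 hKp]
      rw [← h2] at h1
      have h3 : (q.1 : ℝ) ≤ n := by exact_mod_cast not_lt.1 hlong
      have h5 : (n : ℝ) ≤ n / (10 * E) * d := by
        rw [div_mul_eq_mul_div, le_div_iff₀ (by positivity)]
        exact mul_le_mul_of_nonneg_left h1 (by linarith)
      linarith
  have hmain := sum_fst_le hterm
  rw [hc.sum_fst] at hmain
  have h1 : 10 * (((c.map fun q => if n < q.1 then q.1 else 0).sum : ℕ) : ℝ) ≤ N := by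
    exact_mod_cast hc.sum_long
  have h2 : w * c.length ≤ 2 * N + w := by
    have := hc.length_le
    rw [hw]
    exact_mod_cast this
  have h3 : (n / (10 * E) + w / (5 * E)) *
      (F * N - (c.map fun q => meanLog K β h μ (segments q.1 q.2)).sum) ≤ N / 5 := by
    calc _ ≤ (n / (10 * E) + w / (5 * E)) * (N / n * E) :=
          mul_le_mul_of_nonneg_left (by linarith) (by positivity)
      _ ≤ (n / (10 * E) + (n / 2) / (5 * E)) * (N / n * E) := by gcongr
      _ = N / 5 := by field_simp; norm_num
  have h4 : w / (80 * p * n) * ((c.map Prod.snd).sum : ℝ) ≤ N / 10 := by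
    calc _ ≤ w / (80 * p * n) * (16 * p * N) :=
          mul_le_mul_of_nonneg_left hc.sum_snd (by positivity)
      _ ≤ (n / 2) / (80 * p * n) * (16 * p * N) := by gcongr
      _ = N / 10 := by field_simp; ring
  -- The total charge is at most `N/10 + N/5 + (2N + w)/16 + N/10`, which is below `N`.
  linarith

/-- The competitor to the jump of length `a + s` is a trajectory of `X` followed by a jump of length
`s`. Both end at the same site, so its potential cancels in the ratio, leaving `K (a + s) / K s`. On
the event where the partition function of `X` deviates by `t`, the trivial bound `1` is used. -/
lemma integral_jumpProb_le (hμ : IsStationaryLaw μ C₁ C₂) (hK : ∀ n, 0 ≤ K n) (hβ : 0 < β)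
    {X : Finset (List ℕ)} {a s : ℕ} (hX : X ⊆ trajectories a) (hf : Feasible K X) {M : ℝ}
    (hM : 0 < M) (hlen : ∀ l ∈ X, (l.length : ℝ) ≤ M) (hs : 0 < s) (hKs : 0 < K s) {t : ℝ}
    (ht : 0 < t) :
    ∫ x, jumpProb K β h (a + s) x ∂μ ≤ K (a + s) / K s * Real.exp (-(meanLog K β h μ X - t)) +
      C₁ * Real.exp (-(t ^ 2 / (C₂ * (β ^ 2 * M)))) := by
  have := hμ.prob
  set U : Set (ℕ → ℝ) := {x | t ≤ |Real.log (partialSum K β h X x) - meanLog K β h μ X|} with hU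
  set A : ℝ := K (a + s) / K s * Real.exp (-(meanLog K β h μ X - t)) with hA
  have hA0 : 0 ≤ A := mul_nonneg (div_nonneg (hK _) hKs.le) (Real.exp_pos _).le
  have hUm : MeasurableSet U := measurableSet_le measurable_const
    (continuous_abs.measurable.comp ((measurable_log_partialSum X).sub_const _))
  have hpt : ∀ x, jumpProb K β h (a + s) x ≤ A + U.indicator 1 x := by
    intro x
    by_cases hx : x ∈ U
    · rw [Set.indicator_of_mem hx]
      have := jumpProb_le_one (β := β) (h := h) hK (by omega : 0 < a + s) x
      simp only [Pi.one_apply]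
      linarith
    · rw [Set.indicator_of_notMem hx, add_zero]
      simp only [hU, Set.mem_ofPred_eq, not_le] at hx
      have h1 := (abs_lt.1 hx).1
      have hPX := partialSum_pos (β := β) (h := h) hK hf x
      have h2 := partialSum_mul_le (K := K) (β := β) (h := h) hK hX
        (singleton_subset_trajectories hs) x
      rw [partialSum_singleton hs] at h2
      have h3 : jumpWeight K β h s (shift a x) = K s * Real.exp (β * x (a + s - 1) + h) := by
        rw [jumpWeight, shift, show s - 1 + a = a + s - 1 by omega]
      rw [h3] at h2
      have h4 : Real.exp (meanLog K β h μ X - t) ≤ partialSum K β h X x :=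
        (Real.le_log_iff_exp_le hPX).1 (by linarith)
      set e := Real.exp (β * x (a + s - 1) + h) with he
      have he0 : 0 < e := Real.exp_pos _
      have h5 : Real.exp (meanLog K β h μ X - t) * (K s * e) ≤
          partialSum K β h (trajectories (a + s)) x :=
        (mul_le_mul_of_nonneg_right h4 (by positivity)).trans h2
      rw [jumpProb, jumpWeight, ← he]
      calc K (a + s) * e / partialSum K β h (trajectories (a + s)) x
          ≤ K (a + s) * e / (Real.exp (meanLog K β h μ X - t) * (K s * e)) :=
            div_le_div_of_nonneg_left (mul_nonneg (hK _) he0.le) (by positivity) h5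
        _ = A := by
            rw [hA, Real.exp_neg]
            field_simp
  have hind : Integrable (U.indicator (1 : (ℕ → ℝ) → ℝ)) μ :=
    (integrable_const (1 : ℝ)).indicator hUm
  refine (integral_mono (integrable_jumpProb hμ hK (by omega)) ((integrable_const A).add hind)
    hpt).trans ?_
  simp only [Pi.add_apply]
  rw [integral_add (integrable_const A) hind, integral_indicator_one hUm, integral_const,
    probReal_univ, one_smul]
  exact add_le_add_right (concentration_log_partialSum hμ hK hβ hX hf hM hlen ht) A

end Pinning
end

/-! ### The descent over scales and the lower bound on the contact density. -/

noncomputable section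

namespace Pinning

variable {K : ℕ → ℝ} {β h : ℝ} {μ : Measure (ℕ → ℝ)} {C₁ C₂ ζ c₁ c₂ : ℝ} {r : ℕ}

lemma IsStretchedKernel.const_pos₂ (hK : IsStretchedKernel K ζ r c₁ c₂) : 0 < c₂ := by
  have h1 := (hK.pos le_rfl).trans_le (hK.upper r le_rfl)
  exact pos_of_mul_pos_left h1 (Real.exp_pos _).le

lemma IsStretchedKernel.log_le (hK : IsStretchedKernel K ζ r c₁ c₂) {n : ℕ} (hn : r ≤ n) :
    Real.log (K n) ≤ Real.log c₂ - (n : ℝ) ^ ζ := by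
  have := Real.log_le_log (hK.pos hn) (hK.upper n hn)
  rwa [Real.log_mul hK.const_pos₂.ne' (Real.exp_pos _).ne', Real.log_exp] at this

lemma tendsto_rpow_natCast_atTop (hζ : 0 < ζ) : Tendsto (fun n : ℕ => (n : ℝ) ^ ζ) atTop atTop :=
  (tendsto_rpow_atTop hζ).comp tendsto_natCast_atTop_atTop

lemma eventually_log_le_rpow (hζ : 0 < ζ) {ε : ℝ} (hε : 0 < ε) (a b : ℝ) :
    ∀ᶠ n : ℕ in atTop, a + b * Real.log n ≤ ε * (n : ℝ) ^ ζ := by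
  have h1 := ((isLittleO_log_rpow_atTop hζ).const_mul_left b).comp_tendsto
    (tendsto_natCast_atTop_atTop (R := ℝ))
  have h2 := h1.def (half_pos hε)
  filter_upwards [h2, (tendsto_rpow_natCast_atTop hζ).eventually_ge_atTop (2 * a / ε)] with n hn hn2
  simp only [Function.comp_apply, Real.norm_eq_abs] at hn
  have h3 : |(n : ℝ) ^ ζ| = (n : ℝ) ^ ζ := abs_of_nonneg (by positivity)
  rw [h3] at hn
  have h4 := le_abs_self (b * Real.log n)
  rw [div_le_iff₀ hε] at hn2
  linarith

lemma exp_neg_le_inv_cube {n : ℕ} (hn : 0 < n) {y : ℝ} (hy : 3 * Real.log n ≤ y) :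
    Real.exp (-y) ≤ ((n : ℝ) ^ 3)⁻¹ := by
  have hn0 : (0 : ℝ) < n := by exact_mod_cast hn
  rw [Real.exp_neg]
  refine inv_anti₀ (by positivity) ?_
  rw [← Real.log_le_iff_le_exp (by positivity), Real.log_pow]
  exact_mod_cast hy

lemma mul_exp_neg_le_inv_cube {n : ℕ} (hn : 0 < n) {C y : ℝ} (hC : 0 < C)
    (hy : Real.log (2 * C) + 3 * Real.log n ≤ y) :
    C * Real.exp (-y) ≤ ((n : ℝ) ^ 3)⁻¹ / 2 := by
  have h1 := exp_neg_le_inv_cube hn (y := y - Real.log (2 * C)) (by linarith)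
  rw [neg_sub, sub_eq_add_neg, Real.exp_add, Real.exp_log (by positivity)] at h1
  linarith

/-- At a positive free energy, single jumps over long distances are unlikely. -/
lemma eventually_integral_jumpProb_le (hμ : IsStationaryLaw μ C₁ C₂)
    (hK : IsStretchedKernel K ζ r c₁ c₂) (hβ : 0 < β) (hF : 0 < freeEnergyOfLaw K β h μ) :
    ∀ᶠ j : ℕ in atTop, ∫ x, jumpProb K β h j x ∂μ ≤ ((j : ℝ) ^ 3)⁻¹ := by
  set F := freeEnergyOfLaw K β h μ with hFdef
  have hC₁ := hμ.pos₁
  have hC₂ := hμ.pos₂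
  have hζ := hK.exp_pos
  have hr0 := hK.threshold_pos
  set s : ℝ := F ^ 2 / (8 * C₂ * β ^ 2) with hs
  have hs0 : 0 < s := by positivity
  have h1 := (tendsto_freeEnergy hμ hK β h).eventually (lt_mem_nhds (half_lt_self hF))
  have h1' := (tendsto_sub_atTop_nat r).eventually h1
  filter_upwards [h1', eventually_log_le_rpow (ζ := 1) one_pos hs0 (Real.log (2 * C₁)) 3,
    eventually_log_le_rpow (ζ := ζ) hζ one_pos (Real.log (2 * (c₂ / K r))) 3,
    eventually_ge_atTop (2 * r + 1)] with j hj1 hj2 hj3 hj4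
  set a := j - r with ha
  have haj : a + r = j := by omega
  have ha0 : 0 < a := by omega
  have ha0' : (0 : ℝ) < a := by exact_mod_cast ha0
  have hj0 : (0 : ℝ) < j := by exact_mod_cast (by omega : 0 < j)
  have haj2 : (j : ℝ) ≤ 2 * a := by exact_mod_cast (by omega : j ≤ 2 * a)
  have hfe := hK.feasible (by omega : r ≤ a)
  have hKr := hK.pos (le_refl r)
  -- Here the competitor uses all trajectories to `j - r` and then a jump of length `r`. Its mean
  -- logarithm is at least `F a / 2`, while a deviation of that order has exponentially small
  -- probability in `j`.
  have hmain := integral_jumpProb_le (h := h) hμ hK.nonneg hβ subset_rfl hfe ha0'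
    (fun l hl => by exact_mod_cast length_le_of_mem hl) hr0 hKr
    (t := F / 2 * a) (by positivity)
  rw [haj] at hmain
  have hmean : 0 ≤ meanLog K β h μ (trajectories a) - F / 2 * a := by
    rw [inv_mul_eq_div, lt_div_iff₀ ha0'] at hj1
    linarith
  have hA : K j / K r * Real.exp (-(meanLog K β h μ (trajectories a) - F / 2 * a)) ≤
      ((j : ℝ) ^ 3)⁻¹ / 2 := by
    have h5 : Real.exp (-(meanLog K β h μ (trajectories a) - F / 2 * a)) ≤ 1 :=
      Real.exp_le_one_iff.2 (by linarith)
    have h6 := mul_exp_neg_le_inv_cube (by omega : 0 < j) (div_pos hK.const_pos₂ hKr)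
      (y := (j : ℝ) ^ ζ) (by linarith)
    have h8 : K j / K r ≤ c₂ / K r * Real.exp (-(j : ℝ) ^ ζ) := by
      rw [div_mul_eq_mul_div]
      exact div_le_div_of_nonneg_right (hK.upper j (by omega)) hKr.le
    have h9 := mul_le_of_le_one_right (div_nonneg (hK.nonneg j) hKr.le) h5
    linarith
  have hB : C₁ * Real.exp (-((F / 2 * a) ^ 2 / (C₂ * (β ^ 2 * a)))) ≤ ((j : ℝ) ^ 3)⁻¹ / 2 := by
    have h5 : s * j ≤ (F / 2 * a) ^ 2 / (C₂ * (β ^ 2 * a)) := by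
      have : (F / 2 * a) ^ 2 / (C₂ * (β ^ 2 * a)) = s * (2 * a) := by
        rw [hs]
        field_simp
        norm_num
      rw [this]
      exact mul_le_mul_of_nonneg_left haj2 hs0.le
    rw [Real.rpow_one] at hj2
    exact mul_exp_neg_le_inv_cube (by omega) hC₁ (by linarith)
  linarith

/-- The contact density cannot be so small that the fluctuations of the partition function are
negligible on all scales: the descent step. -/
lemma exists_descent (hμ : IsStationaryLaw μ C₁ C₂) (hK : IsStretchedKernel K ζ r c₁ c₂) :
    ∃ κ : ℝ, 0 < κ ∧ ∃ L : ℕ, 80 ≤ L ∧ ∀ (β h p : ℝ) (n : ℕ), 0 < β → 0 < p → L ≤ n →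
      0 ≤ freeEnergyOfLaw K β h μ → freeEnergyOfLaw K β h μ ≤ 1 →
      β ^ 2 * p * n * Real.log n ≤ κ * ((n : ℝ) ^ ζ + freeEnergyOfLaw K β h μ * n) ^ 2 →
      (∀ᶠ N : ℕ in atTop, ∫ x, gibbsMean K β h N (fun l => l.length) x ∂μ ≤ 2 * p * N) →
      (∀ j, n < j → ∫ x, jumpProb K β h j x ∂μ ≤ ((j : ℝ) ^ 3)⁻¹) →
      ∫ x, jumpProb K β h n x ∂μ ≤ ((n : ℝ) ^ 3)⁻¹ := by
  have hC₁ := hμ.pos₁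
  have hC₂ := hμ.pos₂
  have hζ := hK.exp_pos
  have hr0 := hK.threshold_pos
  have hr0' : (0 : ℝ) < r := by exact_mod_cast hr0
  have hKr := hK.pos (le_refl r)
  have hc₂ := hK.const_pos₂
  have hc₁ := hK.const_pos
  -- The exponent gained by replacing a jump of length `n` by one of length at most `3n/4` is at
  -- least `θ n^ζ`.
  set θ : ℝ := 1 - (3 / 4 : ℝ) ^ ζ with hθ
  have hθ0 : 0 < θ := sub_pos.2 (Real.rpow_lt_one (by norm_num) (by norm_num) hζ)
  have hθ1 : θ ≤ 1 / 4 := by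
    have : (3 / 4 : ℝ) ^ (1 : ℝ) ≤ (3 / 4 : ℝ) ^ ζ :=
      Real.rpow_le_rpow_of_exponent_ge (by norm_num) (by norm_num) hK.exp_lt_one.le
    rw [Real.rpow_one] at this
    linarith
  -- With at most `40` copies, each losing `5 E ≤ 5 η T`, and a deviation `η T`, the total loss is
  -- `201 η T = θ T / 2`, where `T = n^ζ + F n`.
  set η : ℝ := θ / 402 with hη
  have hη0 : 0 < η := by positivity
  -- Here `16000 = 5 · 3200`: the competitor has at most `3200 p n` contacts, and its deviation
  -- probability must be at most `C₁ n⁻⁵`.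
  set κ : ℝ := η ^ 2 / (16000 * C₂) with hκ
  have hκ0 : 0 < κ := by positivity
  -- An upper bound for every `h` with `F ≤ 1`, read off from a single jump of length `r`; it makes
  -- `L` independent of `h`.
  set H : ℝ := r - Real.log (K r) with hH
  obtain ⟨L, hL⟩ := eventually_atTop.1 ((eventually_log_le_rpow hζ (half_pos hη0) 2 16).and
    ((eventually_log_le_rpow hζ (by norm_num : (0 : ℝ) < 1 / 4) (Real.log c₂ + H) 0).and
    ((eventually_log_le_rpow hζ (half_pos hθ0) (Real.log (2 * (c₂ / c₁))) 3).and
    ((Real.tendsto_log_atTop.comp (tendsto_natCast_atTop_atTop (R := ℝ))).eventually_ge_atTop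
      (Real.log (2 * C₁))))))
  refine ⟨κ, hκ0, max L (80 + 4 * r), le_trans (by omega) (le_max_right _ _), ?_⟩
  intro β h p n hβ hp hn hF0 hF1 hHyp hlen hg
  set F := freeEnergyOfLaw K β h μ with hF
  obtain ⟨hL1, hL2, hL3, hL4⟩ := hL n ((le_max_left _ _).trans hn)
  simp only [Function.comp_apply] at hL4
  have hnr : 80 + 4 * r ≤ n := (le_max_right _ _).trans hn
  have hn80 : 80 ≤ n := by omega
  have hn0 : (0 : ℝ) < n := by exact_mod_cast (by omega : 0 < n)
  have hlog := one_le_log_natCast hn80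
  set T : ℝ := (n : ℝ) ^ ζ + F * n with hT
  have hnζ : 0 < (n : ℝ) ^ ζ := Real.rpow_pos_of_pos hn0 ζ
  have hT0 : 0 < T := by positivity
  set E : ℝ := blockError C₂ β p n with hE
  have hE0 : 0 < E := by
    rw [hE, blockError]
    positivity
  have hET : E ≤ η * T := by
    have h1 : √(512 * C₂ * (β ^ 2 * p * n * Real.log n)) ≤ η / 2 * T := by
      refine Real.sqrt_le_iff.2 ⟨by positivity, ?_⟩
      calc 512 * C₂ * (β ^ 2 * p * n * Real.log n) ≤ 512 * C₂ * (κ * T ^ 2) :=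
            mul_le_mul_of_nonneg_left hHyp (by positivity)
        _ = 512 / 16000 * (η ^ 2 * T ^ 2) := by rw [hκ]; field_simp
        _ ≤ 1 / 4 * (η ^ 2 * T ^ 2) :=
            mul_le_mul_of_nonneg_right (by norm_num) (by positivity)
        _ = (η / 2 * T) ^ 2 := by ring
    have h2 : (n : ℝ) ^ ζ ≤ T := by
      rw [hT]
      exact le_add_of_nonneg_right (by positivity)
    have h3 : η / 2 * (n : ℝ) ^ ζ ≤ η / 2 * T := mul_le_mul_of_nonneg_left h2 (by positivity)
    rw [hE, blockError]
    linarith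
  have hhH : h ≤ H := by
    have h1 := log_kernel_add_le hμ hK β h hr0 hKr
    have h2 : F * r ≤ 1 * r := mul_le_mul_of_nonneg_right hF1 hr0'.le
    rw [hH]
    linarith
  -- A single jump of length between `n / 2` and `n` has deficit at least `T / 2` up to a constant,
  -- far more than the error per block.
  have hmid : ∀ j, n / 2 < j → j ≤ n → 0 < K j → 10 * E ≤ F * j - (Real.log (K j) + h) := by
    intro j hj1 hj2 _
    have h1 := hK.log_le (by omega : r ≤ j)
    have hj : (n : ℝ) / 2 ≤ j := by
      have h2 : n ≤ 2 * j := by omega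
      have h3 : (n : ℝ) ≤ 2 * j := by exact_mod_cast h2
      linarith
    have h2 : (n : ℝ) ^ ζ / 2 ≤ (j : ℝ) ^ ζ := by
      calc (n : ℝ) ^ ζ / 2 = (1 / 2 : ℝ) ^ (1 : ℝ) * (n : ℝ) ^ ζ := by rw [Real.rpow_one]; ring
        _ ≤ (1 / 2 : ℝ) ^ ζ * (n : ℝ) ^ ζ := mul_le_mul_of_nonneg_right
            (Real.rpow_le_rpow_of_exponent_ge (by norm_num) (by norm_num) hK.exp_lt_one.le) hnζ.le
        _ = (n / 2 : ℝ) ^ ζ := by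
            rw [← Real.mul_rpow (by norm_num) hn0.le]
            congr 1
            ring
        _ ≤ (j : ℝ) ^ ζ := Real.rpow_le_rpow (by positivity) hj hζ.le
    have h3 : F * n / 2 ≤ F * j := by
      rw [mul_div_assoc]
      exact mul_le_mul_of_nonneg_left hj hF0
    have h4 : 10 * (η * T) ≤ T / 4 := by
      have : η ≤ 1 / 40 := by rw [hη]; linarith
      nlinarith
    have h5 : T = (n : ℝ) ^ ζ + F * n := hT
    have h6 : 0 ≤ F * n := by positivity
    linarith
  obtain ⟨N, hN, c, hc, hsum⟩ := exists_config_meanLog_ge hμ hK hβ hn80 hp hlen hg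
  obtain ⟨ℓ, m, hℓ0, hℓ1, hℓ2, hm, hfe, hmean⟩ :=
    exists_good_segment hμ hK hn80 hN hp hE0 hc hsum hmid
  -- As many copies of the segment as fit into `n - r`. The final jump of length `s` then satisfies
  -- `r ≤ s`, where the kernel bounds hold, and `s ≤ 3n/4`, while the copies cover at least `n/4`.
  set q := (n - r) / ℓ with hq
  set s := (n - r) % ℓ + r with hs
  have hdiv : q * ℓ + (n - r) % ℓ = n - r := Nat.div_add_mod' (n - r) ℓ
  have hqs : q * ℓ + s = n := by omega
  have hmod : (n - r) % ℓ < ℓ := Nat.mod_lt _ hℓ0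
  have hs34 : 4 * s ≤ 3 * n := by omega
  have hsr : r ≤ s := by omega
  have hs0 : 0 < s := by omega
  have hqℓ : n ≤ 4 * (q * ℓ) := by omega
  have hq0 : 0 < q := Nat.div_pos (by omega) hℓ0
  have hq40 : q ≤ 40 := by
    by_contra hcon
    have : 41 * ℓ ≤ q * ℓ := Nat.mul_le_mul_right _ (by omega)
    omega
  have hq0' : (0 : ℝ) < q := by exact_mod_cast hq0
  have hq40' : (q : ℝ) ≤ 40 := by exact_mod_cast hq40
  have hmain := integral_jumpProb_le (h := h) hμ hK.nonneg hβ
    (concatPow_subset (segments_subset ℓ m) q) (feasible_concatPow hfe q)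
    (M := 3200 * p * n) (by positivity) (fun l hl => by
      have h1 := length_concatPow (m := m) (fun l hl => (Finset.mem_filter.1 hl).2.le) q l hl
      have h2 : (l.length : ℝ) ≤ q * m := by exact_mod_cast h1
      have h3 : (q : ℝ) * m ≤ 40 * (80 * p * n) :=
        mul_le_mul hq40' hm (Nat.cast_nonneg _) (by norm_num)
      linarith) hs0 (hK.pos hsr) (t := η * T) (by positivity)
  rw [hqs, meanLog_concatPow hμ hK.nonneg (segments_subset ℓ m) hfe] at hmain
  have hA : K n / K s * Real.exp (-(q * meanLog K β h μ (segments ℓ m) - η * T)) ≤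
      ((n : ℝ) ^ 3)⁻¹ / 2 := by
    have h1 : K n / K s ≤ c₂ / c₁ * Real.exp (-(θ * (n : ℝ) ^ ζ)) := by
      have h2 : (s : ℝ) ^ ζ ≤ (3 / 4 : ℝ) ^ ζ * (n : ℝ) ^ ζ := by
        rw [← Real.mul_rpow (by norm_num) hn0.le]
        refine Real.rpow_le_rpow (Nat.cast_nonneg _) ?_ hζ.le
        have : (4 : ℝ) * s ≤ 3 * n := by exact_mod_cast hs34
        linarith
      have h3 : c₁ * Real.exp (-((3 / 4 : ℝ) ^ ζ * (n : ℝ) ^ ζ)) ≤ K s :=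
        (mul_le_mul_of_nonneg_left (Real.exp_le_exp.2 (neg_le_neg h2)) hc₁.le).trans
          (hK.lower s hsr)
      calc K n / K s ≤ c₂ * Real.exp (-(n : ℝ) ^ ζ) /
            (c₁ * Real.exp (-((3 / 4 : ℝ) ^ ζ * (n : ℝ) ^ ζ))) :=
            div_le_div₀ (by positivity) (hK.upper n (by omega)) (by positivity) h3
        _ = _ := by
            rw [mul_div_mul_comm, ← Real.exp_sub, hθ]
            congr 2
            ring
    have h2 : Real.exp (-(q * meanLog K β h μ (segments ℓ m) - η * T)) ≤
        Real.exp (θ / 2 * (n : ℝ) ^ ζ) := by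
      refine Real.exp_le_exp.2 ?_
      have h3 : (q : ℝ) * (F * ℓ - 5 * E) ≤ q * meanLog K β h μ (segments ℓ m) :=
        mul_le_mul_of_nonneg_left hmean hq0'.le
      have h4 : (q : ℝ) * E ≤ 40 * (η * T) :=
        mul_le_mul hq40' hET hE0.le (by norm_num)
      have h5 : F * n ≤ F * (4 * (q * ℓ)) :=
        mul_le_mul_of_nonneg_left (by exact_mod_cast hqℓ) hF0
      -- The part of the loss proportional to `F n` is paid by the free energy of the copies, at
      -- least `F n / 4`; the rest uses half of the gain `θ n^ζ`.
      have h6 : 201 * (η * T) = θ / 2 * (n : ℝ) ^ ζ + θ / 2 * (F * n) := by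
        rw [hη, hT]
        ring
      have h7 : θ / 2 * (F * n) ≤ 1 / 4 * (F * n) :=
        mul_le_mul_of_nonneg_right (by linarith) (by positivity)
      linarith
    have h3 := mul_exp_neg_le_inv_cube (by omega : 0 < n) (div_pos hc₂ hc₁)
      (y := θ / 2 * (n : ℝ) ^ ζ) hL3
    calc K n / K s * Real.exp (-(q * meanLog K β h μ (segments ℓ m) - η * T))
        ≤ c₂ / c₁ * Real.exp (-(θ * (n : ℝ) ^ ζ)) * Real.exp (θ / 2 * (n : ℝ) ^ ζ) :=
          mul_le_mul h1 h2 (Real.exp_pos _).le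
            (mul_nonneg (div_pos hc₂ hc₁).le (Real.exp_pos _).le)
      _ = c₂ / c₁ * Real.exp (-(θ / 2 * (n : ℝ) ^ ζ)) := by
          rw [mul_assoc, ← Real.exp_add]
          congr 2
          ring
      _ ≤ _ := h3
  have hB : C₁ * Real.exp (-((η * T) ^ 2 / (C₂ * (β ^ 2 * (3200 * p * n))))) ≤
      ((n : ℝ) ^ 3)⁻¹ / 2 := by
    have h1 : 5 * Real.log n ≤ (η * T) ^ 2 / (C₂ * (β ^ 2 * (3200 * p * n))) := by
      rw [le_div_iff₀ (by positivity)]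
      calc 5 * Real.log n * (C₂ * (β ^ 2 * (3200 * p * n)))
          = 16000 * C₂ * (β ^ 2 * p * n * Real.log n) := by ring
        _ ≤ 16000 * C₂ * (κ * T ^ 2) := mul_le_mul_of_nonneg_left hHyp (by positivity)
        _ = (η * T) ^ 2 := by rw [hκ]; field_simp
    exact mul_exp_neg_le_inv_cube (by omega) hC₁ (by linarith)
  linarith

/-- If the free energy is positive, the contact density cannot be too small. -/
theorem exists_contact_density_lower_bound (hμ : IsStationaryLaw μ C₁ C₂)
    (hK : IsStretchedKernel K ζ r c₁ c₂) :
    ∃ κ : ℝ, 0 < κ ∧ ∃ L : ℕ, 80 ≤ L ∧ ∀ β h h' p : ℝ, 0 < β → h < h' → 0 < p →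
      0 < freeEnergyOfLaw K β h μ → freeEnergyOfLaw K β h μ ≤ 1 → 4 * L * p ≤ 1 →
      (∀ n : ℕ, L ≤ n →
        β ^ 2 * p * n * Real.log n ≤ κ * ((n : ℝ) ^ ζ + freeEnergyOfLaw K β h μ * n) ^ 2) →
      p * (h' - h) < freeEnergyOfLaw K β h' μ - freeEnergyOfLaw K β h μ := by
  obtain ⟨κ, hκ, L, hL80, hdesc⟩ := exists_descent hμ hK
  refine ⟨κ, hκ, L, hL80, ?_⟩
  intro β h h' p hβ hh hp hF0 hF1 hpL hHyp
  by_contra! hcon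
  have hlen := eventually_integral_length_le hμ hK hh hp hcon
  obtain ⟨n₀, hn₀⟩ := eventually_atTop.1 (eventually_integral_jumpProb_le hμ hK hβ hF0)
  -- Downward induction from `n₀`: the `k`-th step reaches lengths down to `n₀ - k`, and the bound
  -- at `j` uses those at all larger lengths.
  have hall : ∀ k : ℕ, ∀ j, L ≤ j → n₀ ≤ j + k →
      ∫ x, jumpProb K β h j x ∂μ ≤ ((j : ℝ) ^ 3)⁻¹ := by
    intro k
    induction k with
    | zero => exact fun j _ hj => hn₀ j hj
    | succ k ih =>
      intro j hj hjk
      exact hdesc β h p j hβ hp hj hF0.le hF1 (hHyp j hj) hlen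
        fun i hi => ih i (by omega) (by omega)
  obtain ⟨N, hN1, hN2, hN3⟩ := (hlen.and ((eventually_ge_atTop r).and
    (eventually_ge_atTop 1))).exists
  have hfe := hK.feasible hN2
  have hN0 : (0 : ℝ) < N := by exact_mod_cast hN3
  have hL0 : (80 : ℝ) ≤ L := by exact_mod_cast hL80
  have hlong := integral_longSites_le (β := β) (h := h) (N := N) hμ hK.nonneg (by omega : 0 < L)
    hfe fun j hj => hall n₀ j hj.le (by omega)
  have hi1 : Integrable (gibbsMean K β h N (fun l => (l.length : ℝ))) μ :=
    integrable_gibbsMean hμ hK.nonneg hfe (fun l => Nat.cast_nonneg l.length) (B := N)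
      (fun l hl => by exact_mod_cast length_le_of_mem hl)
  have hi2 : Integrable (gibbsMean K β h N (fun l => (longSites L l : ℝ))) μ :=
    integrable_gibbsMean hμ hK.nonneg hfe (fun l => Nat.cast_nonneg _) (B := N)
      (fun l hl => by
        have := longSites_le_sum L l
        rw [(mem_trajectories.1 hl).2] at this
        exact_mod_cast this)
  have := hμ.prob
  -- Every site lies under a jump longer than `L` or under one of at most `L`. The former cover at
  -- most `N / 80` sites on average and the latter at most `L · 2pN ≤ N / 2`, which is too few.
  have hle : (N : ℝ) ≤ ∫ x, (L * gibbsMean K β h N (fun l => (l.length : ℝ)) x +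
      gibbsMean K β h N (fun l => (longSites L l : ℝ)) x) ∂μ := by
    calc (N : ℝ) = ∫ _, (N : ℝ) ∂μ := by simp
      _ ≤ _ := by
        refine integral_mono (integrable_const _) ((hi1.const_mul _).add hi2) fun x => ?_
        simp only
        rw [← gibbsMean_const_mul, ← gibbsMean_add,
          ← gibbsMean_const (β := β) (h := h) hK.nonneg hfe (N : ℝ) x]
        refine gibbsMean_mono hK.nonneg (fun l hl => ?_) x
        have := sum_le_mul_length_add_longSites L l
        rw [(mem_trajectories.1 hl).2] at this
        exact_mod_cast this
  rw [integral_add (hi1.const_mul _) hi2, integral_const_mul] at hle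
  have h1 : (L : ℝ) * ∫ x, gibbsMean K β h N (fun l => (l.length : ℝ)) x ∂μ ≤ N / 2 := by
    calc _ ≤ (L : ℝ) * (2 * p * N) := mul_le_mul_of_nonneg_left hN1 (by linarith)
      _ = (4 * L * p) * (N / 2) := by ring
      _ ≤ 1 * (N / 2) := mul_le_mul_of_nonneg_right hpL (by positivity)
      _ = N / 2 := one_mul _
  have h2 : (N : ℝ) / L ≤ N / 80 := div_le_div_of_nonneg_left hN0.le (by norm_num) hL0
  linarith

end Pinning
end

noncomputable section

namespace Pinning

/-! ### The law of the environment -/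

lemma measurable_shift (a : ℕ) : Measurable (shift a) :=
  measurable_pi_lambda _ fun n => measurable_pi_apply (n + a)

lemma IsEnvironment.isStationaryLaw {Ω : Type*} [MeasurableSpace Ω] {Pr : Measure Ω}
    [IsProbabilityMeasure Pr] {ω : ℕ → Ω → ℝ} (hω : IsEnvironment ω Pr)
    (hconc : ConvexConcentration ω Pr) :
    ∃ C₁ C₂ : ℝ, IsStationaryLaw (Pr.map fun w n => ω n w) C₁ C₂ := by
  obtain ⟨C₁, C₂, hC₁, hC₂, hC⟩ := hconc
  have hmeas : Measurable fun w n => ω n w := measurable_pi_lambda _ hω.measurable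
  have hint0 : Integrable (ω 0) Pr := by
    have := integrable_pow_of_integrable_exp_mul (X := ω 0) (μ := Pr) one_ne_zero
      (hω.exp_moments 1) (by simpa using hω.exp_moments (-1)) 1
    simpa using this
  have hint : ∀ n, Integrable (ω n) Pr := fun n => (hω.ident n).integrable_iff.2 hint0
  have hexp : ∀ n t, Integrable (fun w => Real.exp (t * ω n w)) Pr := fun n t =>
    (((hω.ident n).comp (u := fun y => Real.exp (t * y)) (by fun_prop)).integrable_iff).2
      (hω.exp_moments t)
  -- The law of an i.i.d. sequence is unchanged by any injective relabelling of the sites; shifts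
  -- are a special case.
  have hlaw : ∀ g : ℕ → ℕ, Function.Injective g →
      Pr.map (fun w n => ω (g n) w) = Measure.infinitePi fun _ => Pr.map (ω 0) := fun g hg => by
    rw [(hω.indep.precomp hg).map_fun_eq_infinitePi_map fun n => hω.measurable (g n)]
    congr 1
    ext1 n
    exact (hω.ident (g n)).map_eq
  refine ⟨C₁, C₂, Measure.isProbabilityMeasure_map hmeas.aemeasurable, fun a =>
    ⟨measurable_shift a, ?_⟩, fun n => ?_, fun n => ?_, fun β => ?_, hC₁, hC₂, ?_⟩
  · rw [Measure.map_map (measurable_shift a) hmeas]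
    exact (hlaw (fun n => n + a) (add_left_injective a)).trans
      (hlaw (fun n => n) Function.injective_id).symm
  · exact (integrable_map_measure (measurable_pi_apply n).aestronglyMeasurable
      hmeas.aemeasurable).2 (hint n)
  · rw [integral_map hmeas.aemeasurable (measurable_pi_apply n).aestronglyMeasurable,
      (hω.ident n).integral_eq, hω.centered]
  -- By independence the exponential moment over `s` is exactly the `s.card`-th power of the
  -- one-site moment.
  · refine ⟨Real.log (mgf (ω 0) Pr β), fun s => ?_⟩
    have hm : Measurable fun x : ℕ → ℝ => Real.exp (β * ∑ i ∈ s, x i) :=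
      Real.measurable_exp.comp
        ((Finset.measurable_sum _ fun i _ => measurable_pi_apply i).const_mul β)
    have hi := hω.indep.integrable_exp_mul_sum hω.measurable (s := s) (t := β)
      fun i _ => hexp i β
    have hsum := hω.indep.mgf_sum hω.measurable s (t := β)
    have hmgf : ∀ i, mgf (ω i) Pr β = mgf (ω 0) Pr β := fun i =>
      (hω.ident i).comp (u := fun y => Real.exp (β * y)) (by fun_prop) |>.integral_eq
    simp only [Finset.sum_apply] at hi
    refine ⟨(integrable_map_measure hm.aestronglyMeasurable hmeas.aemeasurable).2 hi, ?_⟩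
    rw [integral_map hmeas.aemeasurable hm.aestronglyMeasurable, mul_comm (Real.log _),
      Real.exp_nat_mul, Real.exp_log (mgf_pos (hω.exp_moments β))]
    simp only [hmgf, Finset.prod_const] at hsum
    rw [← hsum]
    simp [mgf]
  · intro N F k hk hlip hconv u hu
    have hproj : Measurable fun x : ℕ → ℝ =>
        F (WithLp.toLp 2 fun i : Fin N => x i) :=
      hlip.continuous.measurable.comp ((WithLp.measurable_toLp 2 _).comp
        (measurable_pi_lambda _ fun i => measurable_pi_apply (i : ℕ)))
    have hset : ∀ a : ℝ, MeasurableSet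
        {x : ℕ → ℝ | u ≤ |F (WithLp.toLp 2 fun i : Fin N => x i) - a|} := fun a =>
      measurableSet_le measurable_const (continuous_abs.measurable.comp (hproj.sub_const a))
    rw [integral_map hmeas.aemeasurable hproj.aestronglyMeasurable,
      map_measureReal_apply hmeas (hset _)]
    exact hC N F k hk hlip hconv u hu

/-! ### The renewal representation of the partition function -/

variable {S : Type*} {ξ : ℕ → S → ℕ}

/-- The list of the first `k` increments. -/
def incrementList (ξ : ℕ → S → ℕ) (k : ℕ) (s : S) : List ℕ := (List.range k).map fun i => ξ i s

lemma length_incrementList (k : ℕ) (s : S) : (incrementList ξ k s).length = k := by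
  simp [incrementList]

lemma sum_incrementList (k : ℕ) (s : S) :
    (incrementList ξ k s).sum = ∑ j ∈ Finset.range k, ξ j s := by
  induction k with
  | zero => simp [incrementList]
  | succ k ih =>
    rw [Finset.sum_range_succ, ← ih]
    simp [incrementList, List.range_succ]

lemma pos_of_mem_incrementList (hpos : ∀ i s, 0 < ξ i s) {k : ℕ} {s : S} :
    ∀ i ∈ incrementList ξ k s, 0 < i := by
  intro i hi
  obtain ⟨j, _, rfl⟩ := List.mem_map.1 hi
  exact hpos j s

lemma strictMono_renewal (hpos : ∀ i s, 0 < ξ i s) (s : S) :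
    StrictMono fun i : ℕ => ∑ j ∈ Finset.range i, ξ j s :=
  strictMono_nat_of_lt_succ fun i => by
    rw [Finset.sum_range_succ]
    exact Nat.lt_add_of_pos_right (hpos i s)

lemma mem_sites_iff {l : List ℕ} (hl : ∀ i ∈ l, 0 < i) (n : ℕ) :
    n ∈ sites l ↔ ∃ i < l.length, (l.take (i + 1)).sum = n + 1 := by
  induction l generalizing n with
  | nil => simp [sites]
  | cons j l ih =>
    have hj := hl j (by simp)
    have ih := ih fun i hi => hl i (by simp [hi])
    rw [sites, Finset.mem_insert, Finset.mem_map]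
    constructor
    · rintro (rfl | ⟨m, hm, rfl⟩)
      · exact ⟨0, by simp, by simp; omega⟩
      · obtain ⟨i, hi, his⟩ := (ih m).1 hm
        refine ⟨i + 1, by simpa using hi, ?_⟩
        rw [List.take_succ_cons, List.sum_cons, his, addRightEmbedding_apply]
        omega
    · rintro ⟨i, hi, his⟩
      rw [List.take_succ_cons, List.sum_cons] at his
      cases i with
      | zero =>
        left
        simp only [List.take_zero, List.sum_nil] at his
        omega
      | succ i =>
        right
        have hpos : 0 < (l.take (i + 1)).sum := by
          refine lt_of_lt_of_le ?_ (length_le_sum fun a ha => hl a ?_)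
          · simp only [List.length_cons] at hi
            rw [List.length_take]
            omega
          · exact List.mem_cons_of_mem _ (List.mem_of_mem_take ha)
        refine ⟨n - j, (ih _).2 ⟨i, by simpa using hi, by omega⟩, ?_⟩
        rw [addRightEmbedding_apply]
        omega

lemma mem_sites_incrementList (hpos : ∀ i s, 0 < ξ i s) (k : ℕ) (s : S) (n : ℕ) :
    n ∈ sites (incrementList ξ k s) ↔ ∃ i < k, ∑ j ∈ Finset.range (i + 1), ξ j s = n + 1 := by
  rw [mem_sites_iff (pos_of_mem_incrementList hpos), length_incrementList]
  refine exists_congr fun i => and_congr_right fun hi => ?_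
  rw [← sum_incrementList, incrementList, incrementList, ← List.map_take, List.take_range,
    min_eq_left (by omega)]

lemma contact_eq_of_sum (hpos : ∀ i s, 0 < ξ i s) {k : ℕ} {s : S} {n : ℕ}
    (hn : n < ∑ j ∈ Finset.range k, ξ j s) :
    contact ξ (n + 1) s = if n ∈ sites (incrementList ξ k s) then 1 else 0 := by
  classical
  have hmono := strictMono_renewal hpos s
  rw [contact, Set.indicator_apply]
  refine if_congr ?_ rfl rfl
  rw [mem_sites_incrementList hpos, renewalSet, Set.mem_range]
  constructor
  · rintro ⟨i, hi⟩
    cases i with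
    | zero => simp at hi
    | succ i =>
      refine ⟨i, ?_, hi⟩
      have hi : ∑ j ∈ Finset.range (i + 1), ξ j s = n + 1 := hi
      have : i + 1 ≤ k := hmono.le_iff_le.1
        (show ∑ j ∈ Finset.range (i + 1), ξ j s ≤ ∑ j ∈ Finset.range k, ξ j s by omega)
      omega
  · rintro ⟨i, _, hi⟩
    exact ⟨i + 1, hi⟩

lemma incrementList_eq_of_mem (hpos : ∀ i s, 0 < ξ i s) {k N : ℕ} {s : S}
    (hk : ∑ j ∈ Finset.range k, ξ j s = N) {l : List ℕ} (hl : l ∈ trajectories N) :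
    incrementList ξ l.length s = l ↔ l = incrementList ξ k s := by
  constructor
  · intro h
    have h1 : ∑ j ∈ Finset.range l.length, ξ j s = N := by
      rw [← sum_incrementList, h, (mem_trajectories.1 hl).2]
    have h2 := (strictMono_renewal hpos s).injective (h1.trans hk.symm)
    rw [← h2, h]
  · rintro rfl
    rw [length_incrementList]

/-- Renewal sums increase strictly, so at most one initial list of increments is a trajectory to
`N`, and there is one exactly when `N` is a renewal point. Hence at most one indicator is nonzero.
-/
lemma integrand_eq_sum (hpos : ∀ i s, 0 < ξ i s) (β h : ℝ) (x : ℕ → ℝ) (N : ℕ) (s : S) :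
    Real.exp (∑ n ∈ Finset.range N, (β * x n + h) * contact ξ (n + 1) s) * contact ξ N s =
      ∑ l ∈ trajectories N, {s | incrementList ξ l.length s = l}.indicator
        (fun _ => Real.exp (β * energy x l + h * l.length)) s := by
  by_cases hN : N ∈ renewalSet ξ s
  · have hcontact : contact ξ N s = 1 := Set.indicator_of_mem hN _
    obtain ⟨k, hk⟩ := hN
    simp only at hk
    have hmem : incrementList ξ k s ∈ trajectories N :=
      mem_trajectories.2 ⟨pos_of_mem_incrementList hpos, by rw [sum_incrementList, hk]⟩
    rw [Finset.sum_eq_single_of_mem _ hmem]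
    · rw [Set.indicator_of_mem (by simp [length_incrementList]), hcontact, mul_one]
      congr 1
      have hsub := sites_subset (pos_of_mem_incrementList hpos (k := k) (s := s))
      rw [sum_incrementList, hk] at hsub
      rw [← card_sites (pos_of_mem_incrementList hpos), energy, Finset.mul_sum, mul_comm h,
        ← nsmul_eq_mul, ← Finset.sum_const, ← Finset.sum_add_distrib,
        ← Finset.sum_subset hsub (f := fun n => (β * x n + h) * contact ξ (n + 1) s)]
      · refine Finset.sum_congr rfl fun n hn => ?_
        have := Finset.mem_range.1 (hsub hn)
        rw [contact_eq_of_sum hpos (k := k) (by omega), if_pos hn, mul_one]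
      · intro n hn hn'
        rw [Finset.mem_range] at hn
        rw [contact_eq_of_sum hpos (k := k) (by omega), if_neg hn', mul_zero]
    · intro l hl hne
      refine Set.indicator_of_notMem ?_ _
      rw [Set.mem_ofPred_eq, incrementList_eq_of_mem hpos hk hl]
      exact hne
  · have hcontact : contact ξ N s = 0 := Set.indicator_of_notMem hN _
    rw [hcontact, mul_zero]
    symm
    refine Finset.sum_eq_zero fun l hl => Set.indicator_of_notMem ?_ _
    intro hmem
    refine hN ⟨l.length, ?_⟩
    have hmem : incrementList ξ l.length s = l := hmem
    simp only
    rw [← sum_incrementList, hmem, (mem_trajectories.1 hl).2]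

lemma prod_range_getD (f : ℕ → ℝ) (l : List ℕ) :
    ∏ i ∈ Finset.range l.length, f (l.getD i 0) = (l.map f).prod := by
  induction l with
  | nil => simp
  | cons j l ih =>
    rw [List.length_cons, Finset.prod_range_succ', List.map_cons, List.prod_cons, ← ih, mul_comm]
    simp

lemma setOf_incrementList_eq (l : List ℕ) : {s | incrementList ξ l.length s = l} =
    ⋂ i ∈ Finset.range l.length, ξ i ⁻¹' {l.getD i 0} := by
  ext s
  simp only [Set.mem_ofPred_eq, Set.mem_iInter, Finset.mem_range, Set.mem_preimage,
    Set.mem_singleton_iff]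
  constructor
  · intro h i hi
    rw [← h]
    simp [incrementList, hi]
  · intro h
    refine List.ext_getElem (length_incrementList _ _) fun i h1 h2 => ?_
    have := h i h2
    rw [List.getD_eq_getElem _ _ h2] at this
    simpa [incrementList] using this

variable [MeasurableSpace S] {P : Measure S}

lemma measurableSet_incrementList (hξ : IsRenewalIncrements ξ P) (l : List ℕ) :
    MeasurableSet {s | incrementList ξ l.length s = l} := by
  rw [setOf_incrementList_eq]
  exact Finset.measurableSet_biInter _ fun i _ => hξ.measurable i (measurableSet_singleton _)

lemma measureReal_incrementList (hξ : IsRenewalIncrements ξ P) (l : List ℕ) :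
    P.real {s | incrementList ξ l.length s = l} = (l.map (interarrivalLaw ξ P)).prod := by
  rw [setOf_incrementList_eq, measureReal_def,
    hξ.indep.measure_inter_preimage_eq_mul _ fun i _ => measurableSet_singleton _,
    ENNReal.toReal_prod, ← prod_range_getD]
  refine Finset.prod_congr rfl fun i _ => ?_
  rw [interarrivalLaw, measureReal_def]
  congr 1
  exact (hξ.ident i).measure_mem_eq (measurableSet_singleton _)

lemma partitionFunction_eq [IsProbabilityMeasure P] (hξ : IsRenewalIncrements ξ P) (β h : ℝ)
    (x : ℕ → ℝ) (N : ℕ) :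
    partitionFunction ξ P β h x N = partialSum (interarrivalLaw ξ P) β h (trajectories N) x := by
  rw [partitionFunction, partialSum]
  simp_rw [integrand_eq_sum hξ.pos]
  rw [integral_finsetSum _ fun l _ =>
    (integrable_const _).indicator (measurableSet_incrementList hξ l)]
  refine Finset.sum_congr rfl fun l _ => ?_
  rw [integral_indicator_const _ (measurableSet_incrementList hξ l),
    measureReal_incrementList hξ, smul_eq_mul]

lemma isStretchedKernel_interarrivalLaw [IsProbabilityMeasure P] (hξ : IsRenewalIncrements ξ P)
    {ζ c : ℝ} (hζ0 : 0 < ζ) (hζ1 : ζ < 1) (hc : 0 < c)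
    (hK : Asymptotics.IsEquivalent atTop (fun n : ℕ => interarrivalLaw ξ P n)
      (fun n : ℕ => c * Real.exp (-(n : ℝ) ^ ζ))) :
    ∃ (r : ℕ) (c₁ c₂ : ℝ), IsStretchedKernel (interarrivalLaw ξ P) ζ r c₁ c₂ := by
  have h1 := hK.isLittleO.def (by norm_num : (0 : ℝ) < 1 / 2)
  obtain ⟨r, hr⟩ := eventually_atTop.1 h1
  have h2 : ∀ n, r + 1 ≤ n → |interarrivalLaw ξ P n - c * Real.exp (-(n : ℝ) ^ ζ)| ≤
      1 / 2 * (c * Real.exp (-(n : ℝ) ^ ζ)) := fun n hn => by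
    have := hr n (by omega)
    simp only [Pi.sub_apply, Real.norm_eq_abs] at this
    rwa [abs_of_pos (mul_pos hc (Real.exp_pos _))] at this
  refine ⟨r + 1, c / 2, 3 * c / 2, fun n => measureReal_nonneg, fun N => ?_, hζ0, hζ1, by omega,
    by positivity, fun n hn => ?_, fun n hn => ?_⟩
  · exact (sum_measureReal_preimage_singleton (μ := P) (Finset.Icc 1 N) (f := ξ 0)
      fun y _ => hξ.measurable 0 (measurableSet_singleton y)).trans_le measureReal_le_one
  · have := (abs_le.1 (h2 n hn)).1
    linarith
  · have := (abs_le.1 (h2 n hn)).2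
    linarith

lemma integral_log_partitionFunction {Ω : Type*} [MeasurableSpace Ω] {Pr : Measure Ω}
    [IsProbabilityMeasure P] {ω : ℕ → Ω → ℝ} (hω : IsEnvironment ω Pr)
    (hξ : IsRenewalIncrements ξ P) (β h : ℝ) (N : ℕ) :
    ∫ w, Real.log (partitionFunction ξ P β h (fun n => ω n w) N) ∂Pr =
      meanLog (interarrivalLaw ξ P) β h (Pr.map fun w n => ω n w) (trajectories N) := by
  rw [meanLog, integral_map (measurable_pi_lambda _ hω.measurable).aemeasurable
    (measurable_log_partialSum _).aestronglyMeasurable]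
  simp_rw [partitionFunction_eq hξ]

lemma freeEnergy_eq {Ω : Type*} [MeasurableSpace Ω] {Pr : Measure Ω} [IsProbabilityMeasure P]
    {ω : ℕ → Ω → ℝ} (hω : IsEnvironment ω Pr) (hξ : IsRenewalIncrements ξ P) (β h : ℝ) :
    freeEnergy ω Pr ξ P β h =
      freeEnergyOfLaw (interarrivalLaw ξ P) β h (Pr.map fun w n => ω n w) := by
  unfold freeEnergy freeEnergyOfLaw
  simp_rw [integral_log_partitionFunction hω hξ]

end Pinning
end

noncomputable section

namespace Pinning

/-! ### A differential inequality in finite differences -/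

/-- A discrete integration of `du ≤ B g^{γ-1} |log g| dg` that needs no differentiability. Points
where `g` is successively halved exist by the intermediate value theorem, and the contributions of
these dyadic shells decay geometrically with ratio about `2^{-γ}`. -/
lemma le_of_difference_inequality {g : ℝ → ℝ} (hcont : Continuous g) (hmono : Monotone g)
    (hg0 : g 0 = 0) (hpos : ∀ u, 0 < u → 0 < g u) {γ B F₀ : ℝ} (hγ : 0 < γ) (hB : 0 < B)
    (hF₀ : F₀ ≤ Real.exp (-max (Real.log 2)
      (2 * (2 : ℝ) ^ (-γ) * Real.log 2 / (1 - (2 : ℝ) ^ (-γ)))))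
    (hstep : ∀ v v', 0 < v → v < v' → g v ≤ F₀ →
      v' - v ≤ B * (g v ^ (γ - 1) * -Real.log (g v)) * (g v' - g v))
    {u : ℝ} (hu : 0 < u) (hgu : g u ≤ F₀) :
    u ≤ 4 * B / (1 - (2 : ℝ) ^ (-γ)) * (g u ^ γ * -Real.log (g u)) := by
  set a : ℝ := (2 : ℝ) ^ (-γ) with ha
  have ha0 : 0 < a := by positivity
  have ha1 : a < 1 := Real.rpow_lt_one_of_one_lt_of_neg (by norm_num) (by linarith)
  set A : ℝ := 4 * B / (1 - a) with hA
  have hlog2 : 0 < Real.log 2 := Real.log_pos (by norm_num)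
  -- Along a halving, `v - A g^γ |log g|` does not decrease, so the comparison telescopes down to
  -- `v` near `0`.
  have hhalf : ∀ v, 0 < v → g v ≤ F₀ → ∃ v', 0 < v' ∧ g v' = g v / 2 ∧
      v - A * (g v ^ γ * -Real.log (g v)) ≤ v' - A * (g v' ^ γ * -Real.log (g v')) := by
    intro v hv hgv
    have hG := hpos v hv
    obtain ⟨v', ⟨hv'0, hv'1⟩, hv'g⟩ := intermediate_value_Icc hv.le hcont.continuousOn
      (show g v / 2 ∈ Set.Icc (g 0) (g v) from ⟨by rw [hg0]; positivity, by linarith⟩)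
    have hv'pos : 0 < v' := by
      refine lt_of_le_of_ne hv'0 ?_
      rintro rfl
      rw [hg0] at hv'g
      linarith
    have hv'lt : v' < v := by
      refine lt_of_le_of_ne hv'1 ?_
      rintro rfl
      linarith
    refine ⟨v', hv'pos, hv'g, ?_⟩
    have h1 := hstep v' v hv'pos hv'lt (by linarith)
    rw [hv'g] at h1 ⊢
    set G := g v with hGdef
    set y := G ^ γ with hy
    have hy0 : 0 < y := Real.rpow_pos_of_pos hG γ
    have h2 : (G / 2) ^ γ = a * y := by
      rw [Real.div_rpow hG.le (by norm_num), ha, Real.rpow_neg (by norm_num), div_eq_mul_inv,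
        mul_comm]
    have h3 : (G / 2) ^ (γ - 1) * (G / 2) = a * y := by
      rw [← h2, ← Real.rpow_add_one (by positivity), sub_add_cancel]
    have h4 : -Real.log (G / 2) = -Real.log G + Real.log 2 := by
      rw [Real.log_div hG.ne' (by norm_num)]
      ring
    set ℓ := -Real.log G with hℓ
    have h5 : max (Real.log 2) (2 * a * Real.log 2 / (1 - a)) ≤ ℓ := by
      have := Real.log_le_log hG (hgv.trans hF₀)
      rw [Real.log_exp] at this
      linarith
    have h6 : Real.log 2 ≤ ℓ := (le_max_left _ _).trans h5
    have h7 : 2 * a * Real.log 2 ≤ ℓ * (1 - a) := by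
      have := (le_max_right _ _).trans h5
      rwa [div_le_iff₀ (by linarith)] at this
    have h8 : v - v' ≤ B * (a * y * (ℓ + Real.log 2)) := by
      refine h1.trans_eq ?_
      rw [h4, ← h3]
      ring
    -- Passing from `G` to `G / 2` adds `log 2` to the logarithm. The threshold `F₀` makes `ℓ` large
    -- enough that at least `(1 - a) ℓ / 2` remains.
    have h9 : B * (a * (ℓ + Real.log 2)) ≤ A * (ℓ - a * (ℓ + Real.log 2)) := by
      have h10 : a * (ℓ + Real.log 2) ≤ 1 * (2 * ℓ) :=
        mul_le_mul ha1.le (by linarith) (by linarith) (by norm_num)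
      calc B * (a * (ℓ + Real.log 2)) ≤ B * (2 * ℓ) :=
            mul_le_mul_of_nonneg_left (by linarith) hB.le
        _ = A * ((1 - a) * ℓ / 2) := by
            have : 1 - a ≠ 0 := by linarith
            rw [hA]
            field_simp
            ring
        _ ≤ A * (ℓ - a * (ℓ + Real.log 2)) :=
            mul_le_mul_of_nonneg_left (by linarith) (div_nonneg (by linarith) (by linarith))
    have h11 := mul_le_mul_of_nonneg_left h9 hy0.le
    rw [h2, h4]
    linarith
  have hiter : ∀ j : ℕ, ∃ v, 0 < v ∧ g v = g u / 2 ^ j ∧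
      u - A * (g u ^ γ * -Real.log (g u)) ≤ v - A * (g v ^ γ * -Real.log (g v)) := by
    intro j
    induction j with
    | zero => exact ⟨u, hu, by simp, le_rfl⟩
    | succ j ih =>
      obtain ⟨v, hv, hgv, hle⟩ := ih
      have hgv' : g v ≤ F₀ := by
        rw [hgv]
        exact (div_le_self (hpos u hu).le (one_le_pow₀ (by norm_num))).trans hgu
      obtain ⟨v', hv', hgv'', hle'⟩ := hhalf v hv hgv'
      exact ⟨v', hv', by rw [hgv'', hgv, pow_succ, div_div], hle.trans hle'⟩
  refine le_of_forall_pos_le_add fun ε hε => ?_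
  have hlim : Tendsto (fun j : ℕ => g u / 2 ^ j) atTop (𝓝 0) :=
    (tendsto_pow_atTop_atTop_of_one_lt (by norm_num : (1 : ℝ) < 2)).const_div_atTop _
  obtain ⟨j, hj⟩ := (hlim.eventually (gt_mem_nhds (hpos ε hε))).exists
  obtain ⟨v, hv, hgv, hle⟩ := hiter j
  have hvε : v < ε := by
    by_contra hcon
    have := hmono (not_lt.1 hcon)
    linarith
  have hvF : g v ≤ 1 := by
    have h1 : g v ≤ g u := by
      rw [hgv]
      exact div_le_self (hpos u hu).le (one_le_pow₀ (by norm_num))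
    have h2 : F₀ ≤ 1 := hF₀.trans (Real.exp_le_one_iff.2 (neg_nonpos.2
      (hlog2.le.trans (le_max_left _ _))))
    linarith
  have hnn : 0 ≤ A * (g v ^ γ * -Real.log (g v)) := by
    refine mul_nonneg (div_nonneg (by linarith) (by linarith)) (mul_nonneg
      (Real.rpow_nonneg (hpos v hv).le _) ?_)
    linarith [Real.log_nonpos (hpos v hv).le hvF]
  linarith

/-- To invert `G^γ |log G|`, it suffices that `|log G|` is at most a multiple of `|log u|`, which
holds once `G ≥ u^(2/γ)`. -/
lemma rpow_le_of_le_rpow_mul_log {γ A b G u : ℝ} (hγ : 0 < γ) (hA : 0 < A) (hb : 0 < b)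
    (hG : 0 < G) (hu : 0 < u) (hu1 : u < 1) (hub : u < (γ / (4 * A * b)) ^ 2)
    (h : u ≤ A * b * (G ^ γ * -Real.log G)) :
    (γ / (2 * A)) ^ (1 / γ) * (u / (b * |Real.log u|)) ^ (1 / γ) ≤ G := by
  have hlogu : Real.log u < 0 := Real.log_neg hu hu1
  have hGγ : 0 < G ^ γ := Real.rpow_pos_of_pos hG γ
  rw [abs_of_neg hlogu]
  set t := -Real.log u with hlam
  have ht : 0 < t := by linarith
  rcases le_or_gt (u ^ (2 / γ)) G with hcase | hcase
  · have h1 : -Real.log G ≤ 2 / γ * t := by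
      have := Real.log_le_log (Real.rpow_pos_of_pos hu _) hcase
      rw [Real.log_rpow hu] at this
      rw [hlam]
      linarith
    have h2 : u ≤ A * b * (G ^ γ * (2 / γ * t)) :=
      h.trans (mul_le_mul_of_nonneg_left (mul_le_mul_of_nonneg_left h1 hGγ.le) (by positivity))
    have h3 : γ / (2 * A) * (u / (b * t)) ≤ G ^ γ := by
      rw [div_mul_div_comm, div_le_iff₀ (by positivity)]
      calc γ * u ≤ γ * (A * b * (G ^ γ * (2 / γ * t))) := mul_le_mul_of_nonneg_left h2 hγ.le
        _ = G ^ γ * (2 * A * (b * t)) := by field_simp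
    rw [← Real.mul_rpow (by positivity) (by positivity)]
    calc (γ / (2 * A) * (u / (b * t))) ^ (1 / γ) ≤ (G ^ γ) ^ (1 / γ) :=
          Real.rpow_le_rpow (by positivity) h3 (by positivity)
      _ = G := by rw [← Real.rpow_mul hG.le, mul_one_div_cancel hγ.ne', Real.rpow_one]
  -- For smaller `G`, spending a quarter of the power on the logarithm gives `G^γ |log G| ≤ (4/γ)
  -- u^(3/2)`, which is too small compared with `u`.
  · exfalso
    have h1 : -Real.log G ≤ G ^ (-(γ / 4)) / (γ / 4) := by
      have := Real.log_le_rpow_div (inv_pos.2 hG).le (by positivity : 0 < γ / 4)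
      rwa [Real.log_inv, Real.inv_rpow hG.le, ← Real.rpow_neg hG.le] at this
    have h2 : G ^ γ * -Real.log G ≤ 4 / γ * u ^ (3 / 2 : ℝ) := by
      calc G ^ γ * -Real.log G ≤ G ^ γ * (G ^ (-(γ / 4)) / (γ / 4)) :=
            mul_le_mul_of_nonneg_left h1 hGγ.le
        _ = 4 / γ * G ^ (3 * γ / 4) := by
            rw [mul_div_assoc', ← Real.rpow_add hG, show γ + -(γ / 4) = 3 * γ / 4 by ring]
            field_simp
        _ ≤ 4 / γ * (u ^ (2 / γ)) ^ (3 * γ / 4) := mul_le_mul_of_nonneg_left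
            (Real.rpow_le_rpow hG.le hcase.le (by positivity)) (by positivity)
        _ = 4 / γ * u ^ (3 / 2 : ℝ) := by
            rw [← Real.rpow_mul hu.le]
            congr 2
            field_simp
            norm_num
    have h3 : u ≤ A * b * (4 / γ * u ^ (3 / 2 : ℝ)) :=
      h.trans (mul_le_mul_of_nonneg_left h2 (by positivity))
    have h4 : u ^ (3 / 2 : ℝ) = u * √u := by
      rw [Real.sqrt_eq_rpow, ← Real.rpow_one_add' hu.le (by norm_num)]
      norm_num
    have h5 : √u < γ / (4 * A * b) := (Real.sqrt_lt' (by positivity)).2 hub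
    rw [h4, show A * b * (4 / γ * (u * √u)) = u * (4 * A * b / γ * √u) by ring] at h3
    have h6 : 4 * A * b / γ * √u < 1 := by
      calc 4 * A * b / γ * √u < 4 * A * b / γ * (γ / (4 * A * b)) :=
            mul_lt_mul_of_pos_left h5 (by positivity)
        _ = 1 := by field_simp
    nlinarith

/-! ### The critical point -/

variable {K : ℕ → ℝ} {β : ℝ} {μ : Measure (ℕ → ℝ)} {C₁ C₂ ζ c₁ c₂ : ℝ} {r : ℕ}

/-- The real `sInf` returns `0` on sets that are empty or unbounded below, so both degenerate cases
have to be excluded. -/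
lemma isGLB_critical (hμ : IsStationaryLaw μ C₁ C₂) (hK : IsStretchedKernel K ζ r c₁ c₂) (β : ℝ) :
    IsGLB {h : ℝ | 0 < freeEnergyOfLaw K β h μ} (sInf {h : ℝ | 0 < freeEnergyOfLaw K β h μ}) := by
  obtain ⟨h₀, hh₀⟩ := exists_freeEnergy_nonpos hμ hK β
  refine isGLB_csInf (exists_freeEnergy_pos hμ hK β) ⟨h₀, fun h hh => ?_⟩
  by_contra hcon
  have := freeEnergy_mono hμ hK β (not_le.1 hcon).le
  have hh : 0 < freeEnergyOfLaw K β h μ := hh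
  simp only at this
  linarith

/-- The free energy above the critical point `hc`. -/
structure IsCriticalPoint (K : ℕ → ℝ) (β : ℝ) (μ : Measure (ℕ → ℝ)) (hc : ℝ) : Prop where
  pos : ∀ h, hc < h → 0 < freeEnergyOfLaw K β h μ
  zero : freeEnergyOfLaw K β hc μ = 0

/-- The free energy vanishes at the critical point itself because it is nonnegative and grows at
most at unit rate in `h`. -/
lemma isCriticalPoint_of_isGLB (hμ : IsStationaryLaw μ C₁ C₂) (hK : IsStretchedKernel K ζ r c₁ c₂)
    {hc : ℝ} (hglb : IsGLB {h : ℝ | 0 < freeEnergyOfLaw K β h μ} hc) :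
    IsCriticalPoint K β μ hc := by
  refine ⟨fun h hh => ?_, le_antisymm ?_ (freeEnergy_nonneg hμ hK β hc)⟩
  · obtain ⟨h', hh', _, hlt⟩ := hglb.exists_between hh
    exact lt_of_lt_of_le hh' (freeEnergy_mono hμ hK β hlt.le)
  · refine le_of_forall_pos_le_add fun ε hε => ?_
    have h1 := freeEnergy_le_add hμ hK β (sub_le_self hc hε.le)
    have h2 : freeEnergyOfLaw K β (hc - ε) μ ≤ 0 := by
      by_contra hcon
      have := hglb.1 (not_le.1 hcon)
      linarith
    linarith

lemma IsCriticalPoint.le (hμ : IsStationaryLaw μ C₁ C₂) (hK : IsStretchedKernel K ζ r c₁ c₂)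
    {hc : ℝ} (hcrit : IsCriticalPoint K β μ hc) {u : ℝ} (hu : 0 ≤ u) :
    freeEnergyOfLaw K β (hc + u) μ ≤ u := by
  have := freeEnergy_le_add hμ hK β (le_add_of_nonneg_right hu : hc ≤ hc + u)
  rw [hcrit.zero] at this
  linarith

/-! ### Lower bounds on the free energy -/

theorem first_order_lower_bound (hμ : IsStationaryLaw μ C₁ C₂)
    (hK : IsStretchedKernel K ζ r c₁ c₂) (hζ : 1 / 2 < ζ) :
    ∃ c : ℝ, 0 < c ∧ ∀ β h hc : ℝ, 0 < β → IsCriticalPoint K β μ hc →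
      c * min 1 (β ^ 2)⁻¹ * max (h - hc) 0 ≤ freeEnergyOfLaw K β h μ := by
  obtain ⟨κ, hκ, L, hL, hmain⟩ := exists_contact_density_lower_bound hμ hK
  have hL0 : (80 : ℝ) ≤ L := by exact_mod_cast hL
  have hζ' : 0 < 2 * ζ - 1 := by linarith
  -- The first entry absorbs the constant in `log n ≤ n^(2ζ-1) / (2ζ-1)`, the second ensures `4 L p
  -- ≤ 1`.
  set c : ℝ := min (κ * (2 * ζ - 1)) (1 / (4 * L)) with hc
  have hc0 : 0 < c := lt_min (by positivity) (by positivity)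
  refine ⟨c, hc0, fun β h hc hβ hcrit => ?_⟩
  rcases le_or_gt h hc with hle | hlt
  · rw [max_eq_right (by linarith), mul_zero]
    exact freeEnergy_nonneg hμ hK β h
  rw [max_eq_left (by linarith)]
  set m : ℝ := min 1 (β ^ 2)⁻¹ with hm
  have hm0 : 0 < m := lt_min one_pos (by positivity)
  set p : ℝ := c * m with hp
  have hp0 : 0 < p := mul_pos hc0 hm0
  have hβp : β ^ 2 * p ≤ κ * (2 * ζ - 1) := by
    calc β ^ 2 * p = c * (β ^ 2 * m) := by rw [hp]; ring
      _ ≤ c * (β ^ 2 * (β ^ 2)⁻¹) := mul_le_mul_of_nonneg_left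
          (mul_le_mul_of_nonneg_left (min_le_right _ _) (by positivity)) hc0.le
      _ = c := by rw [mul_inv_cancel₀ (by positivity), mul_one]
      _ ≤ _ := min_le_left _ _
  have hpL : 4 * L * p ≤ 1 := by
    calc 4 * L * p ≤ 4 * L * (1 / (4 * L) * 1) := mul_le_mul_of_nonneg_left
          (mul_le_mul (min_le_right _ _) (min_le_left _ _) hm0.le (by positivity)) (by positivity)
      _ = 1 := by field_simp
  -- The density bound requires a positive free energy of at most `1`, so it starts at some `h₁`
  -- strictly above the critical point and within distance `1` of it. The factor `p` does not depend
  -- on `h₁`, so letting `h₁` decrease to `hc` concludes.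
  have key : ∀ h₁, hc < h₁ → h₁ ≤ hc + 1 → h₁ < h →
      p * (h - h₁) ≤ freeEnergyOfLaw K β h μ := by
    intro h₁ h1 h2 h3
    have hF0 := hcrit.pos h₁ h1
    have hF1 : freeEnergyOfLaw K β h₁ μ ≤ 1 := by
      have := hcrit.le hμ hK (u := h₁ - hc) (by linarith)
      rw [add_sub_cancel] at this
      linarith
    have := hmain β h₁ h p hβ h3 hp0 hF0 hF1 hpL fun n hn => by
      have hn0 : (0 : ℝ) < n := by exact_mod_cast (by omega : 0 < n)
      have h4 := Real.log_le_rpow_div hn0.le hζ'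
      have h5 : (n : ℝ) * (n : ℝ) ^ (2 * ζ - 1) = ((n : ℝ) ^ ζ) ^ 2 := by
        rw [← Real.rpow_one_add' hn0.le (by linarith), ← Real.rpow_natCast, ← Real.rpow_mul hn0.le]
        congr 1
        push_cast
        ring
      calc β ^ 2 * p * n * Real.log n
          ≤ κ * (2 * ζ - 1) * n * ((n : ℝ) ^ (2 * ζ - 1) / (2 * ζ - 1)) := by
            refine mul_le_mul (mul_le_mul_of_nonneg_right hβp hn0.le) h4 (Real.log_nonneg ?_)
              (by positivity)
            exact_mod_cast (by omega : 1 ≤ n)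
        _ = κ * ((n : ℝ) ^ ζ) ^ 2 := by
            rw [← h5]
            field_simp
        _ ≤ κ * ((n : ℝ) ^ ζ + freeEnergyOfLaw K β h₁ μ * n) ^ 2 := by
            refine mul_le_mul_of_nonneg_left (pow_le_pow_left₀ (by positivity) ?_ 2) hκ.le
            exact le_add_of_nonneg_right (by positivity)
    linarith
  by_contra! hcon
  set g := p * (h - hc) - freeEnergyOfLaw K β h μ with hg
  have hg0 : 0 < g := by linarith
  set ε := min (min ((h - hc) / 2) 1) (g / (2 * p)) with hε
  have hε0 : 0 < ε := lt_min (lt_min (by linarith) one_pos) (by positivity)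
  have hε1 : ε ≤ (h - hc) / 2 := (min_le_left _ _).trans (min_le_left _ _)
  have hε2 : ε ≤ 1 := (min_le_left _ _).trans (min_le_right _ _)
  have hε3 : p * ε ≤ g / 2 := by
    calc p * ε ≤ p * (g / (2 * p)) := mul_le_mul_of_nonneg_left (min_le_right _ _) hp0.le
      _ = g / 2 := by field_simp
  have := key (hc + ε) (by linarith) (by linarith) (by linarith)
  rw [show p * (h - (hc + ε)) = p * (h - hc) - p * ε by ring] at this
  linarith

/-- The scale `X` separates two regimes: below it the term `n^ζ` alone suffices, above it the linear
term does, because `log n / n` decreases beyond `e`. -/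
lemma rpow_mul_log_le {ζ X : ℝ} (hζ : ζ ≤ 1 / 2) (hX : Real.exp 1 ≤ X) {n : ℝ} (hn : 1 ≤ n) :
    X ^ (2 * ζ - 1) * (n * Real.log n) ≤ Real.log X * (n ^ ζ + X ^ (ζ - 1) * n) ^ 2 := by
  have hX0 : 0 < X := (Real.exp_pos 1).trans_le hX
  have hn0 : 0 < n := by linarith
  have hlogn : 0 ≤ Real.log n := Real.log_nonneg hn
  have hlogX : 0 ≤ Real.log X := Real.log_nonneg (by linarith [Real.add_one_le_exp (1 : ℝ)])
  have ha : 0 ≤ n ^ ζ := by positivity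
  have hb : 0 ≤ X ^ (ζ - 1) * n := by positivity
  rcases le_or_gt n X with hnX | hnX
  · calc X ^ (2 * ζ - 1) * (n * Real.log n) ≤ n ^ (2 * ζ - 1) * (n * Real.log X) :=
          mul_le_mul (Real.rpow_le_rpow_of_nonpos hn0 hnX (by linarith))
            (mul_le_mul_of_nonneg_left (Real.log_le_log hn0 hnX) hn0.le)
            (by positivity) (by positivity)
      _ = Real.log X * (n ^ ζ) ^ 2 := by
          rw [← mul_assoc, ← Real.rpow_add_one hn0.ne', ← Real.rpow_natCast, ← Real.rpow_mul hn0.le,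
            mul_comm]
          congr 2
          push_cast
          ring
      _ ≤ _ := mul_le_mul_of_nonneg_left
          (pow_le_pow_left₀ ha (le_add_of_nonneg_right hb) 2) hlogX
  · have h1 := Real.log_div_self_antitoneOn (show X ∈ {x | Real.exp 1 ≤ x} from hX : X ∈ {x | Real.exp 1 ≤ x})
      (show n ∈ {x | Real.exp 1 ≤ x} from hX.trans hnX.le) hnX.le
    simp only at h1
    calc X ^ (2 * ζ - 1) * (n * Real.log n) = X ^ (2 * ζ - 1) * n ^ 2 * (Real.log n / n) := by
          field_simp
      _ ≤ X ^ (2 * ζ - 1) * n ^ 2 * (Real.log X / X) :=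
          mul_le_mul_of_nonneg_left h1 (by positivity)
      _ = Real.log X * (X ^ (ζ - 1) * n) ^ 2 := by
          have : X ^ (2 * ζ - 1) = (X ^ (ζ - 1)) ^ 2 * X := by
            rw [← Real.rpow_natCast, ← Real.rpow_mul hX0.le, ← Real.rpow_add_one hX0.ne']
            congr 1
            push_cast
            ring
          rw [this]
          field_simp
      _ ≤ _ := mul_le_mul_of_nonneg_left
          (pow_le_pow_left₀ hb (le_add_of_nonneg_left ha) 2) hlogX

theorem finite_order_lower_bound (hμ : IsStationaryLaw μ C₁ C₂)
    (hK : IsStretchedKernel K ζ r c₁ c₂) (hζ : ζ ≤ 1 / 2) :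
    ∃ c : ℝ, 0 < c ∧ ∀ β hc : ℝ, 0 < β → IsCriticalPoint K β μ hc → ∃ u₀ : ℝ, 0 < u₀ ∧
      ∀ u : ℝ, 0 < u → u < u₀ →
        c * (u / (β ^ 2 * |Real.log u|)) ^ ((1 - ζ) / ζ) ≤ freeEnergyOfLaw K β (hc + u) μ := by
  obtain ⟨κ, hκ, L, hL, hmain⟩ := exists_contact_density_lower_bound hμ hK
  have hL0 : (80 : ℝ) ≤ L := by exact_mod_cast hL
  have hζ0 := hK.exp_pos
  have hζ1 : 0 < 1 - ζ := by linarith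
  set γ : ℝ := ζ / (1 - ζ) with hγ
  have hγ0 : 0 < γ := by positivity
  set a : ℝ := (2 : ℝ) ^ (-γ) with ha
  have ha1 : a < 1 := Real.rpow_lt_one_of_one_lt_of_neg (by norm_num) (by linarith)
  have ha1' : 0 < 1 - a := by linarith
  set B : ℝ := 1 / (κ * (1 - ζ)) with hB
  have hB0 : 0 < B := by positivity
  set A : ℝ := 4 * B / (1 - a) with hA
  have hA0 : 0 < A := by positivity
  refine ⟨(γ / (2 * A)) ^ (1 / γ), by positivity, fun β hc hβ hcrit => ?_⟩
  have hβ2 : 0 < β ^ 2 := by positivity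
  -- The first pair of terms is the threshold for the difference inequality; the second makes the
  -- scale `X` exceed `e` and gives `4 L p ≤ 1`.
  set F₀ : ℝ := Real.exp (-max (max (Real.log 2) (2 * a * Real.log 2 / (1 - a)))
    (max 1 (4 * L * κ / β ^ 2))) with hF₀
  have hF₀0 : 0 < F₀ := Real.exp_pos _
  have hF₀1 : F₀ < 1 := by
    rw [hF₀, Real.exp_lt_one_iff, neg_lt_zero]
    exact lt_max_of_lt_right (lt_max_of_lt_left one_pos)
  set g : ℝ → ℝ := fun u => freeEnergyOfLaw K β (hc + u) μ with hg
  have hgmono : Monotone g := fun u v huv => freeEnergy_mono hμ hK β (by linarith)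
  have hgcont : Continuous g := by
    refine (LipschitzWith.of_le_add (f := g) fun u v => ?_).continuous
    rcases le_total u v with huv | huv
    · have := hgmono huv
      have := dist_nonneg (x := u) (y := v)
      linarith
    · have := freeEnergy_le_add hμ hK β (by linarith : hc + v ≤ hc + u)
      rw [Real.dist_eq, abs_of_nonneg (by linarith)]
      simp only [hg]
      linarith
  have hgpos : ∀ u, 0 < u → 0 < g u := fun u hu => hcrit.pos _ (by linarith)
  have hstep : ∀ v v', 0 < v → v < v' → g v ≤ F₀ →
      v' - v ≤ B * β ^ 2 * (g v ^ (γ - 1) * -Real.log (g v)) * (g v' - g v) := by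
    intro v v' hv hvv' hgv
    have hG := hgpos v hv
    set G := g v with hGdef
    have hlogG : max (max (Real.log 2) (2 * a * Real.log 2 / (1 - a)))
        (max 1 (4 * L * κ / β ^ 2)) ≤ -Real.log G := by
      have := Real.log_le_log hG hgv
      rw [hF₀, Real.log_exp] at this
      linarith
    have hlog1 : 1 ≤ -Real.log G := (le_max_left _ _).trans ((le_max_right _ _).trans hlogG)
    have hlog2 : 4 * L * κ / β ^ 2 ≤ -Real.log G :=
      (le_max_right _ _).trans ((le_max_right _ _).trans hlogG)
    -- The crossover scale, at which `X^ζ = G X`.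
    set X : ℝ := G ^ (-(1 / (1 - ζ))) with hX
    have hX0 : 0 < X := Real.rpow_pos_of_pos hG _
    have hlogX : Real.log X = -Real.log G / (1 - ζ) := by
      rw [hX, Real.log_rpow hG]
      ring
    have hlogXG : -Real.log G ≤ Real.log X := by
      rw [hlogX]
      exact le_div_self (by linarith) hζ1 (by linarith)
    have hlogX0 : 0 < Real.log X := by linarith
    have hXe : Real.exp 1 ≤ X := (Real.le_log_iff_exp_le hX0).1 (by linarith)
    have hXG : X ^ (ζ - 1) = G := by
      rw [hX, ← Real.rpow_mul hG.le, show -(1 / (1 - ζ)) * (ζ - 1) = 1 by field_simp; ring,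
        Real.rpow_one]
    have hXα : X ^ (2 * ζ - 1) = G ^ (1 - γ) := by
      rw [hX, ← Real.rpow_mul hG.le]
      congr 1
      rw [hγ]
      field_simp
      ring
    -- The largest density that `rpow_mul_log_le` permits at all scales; its inverse is exactly `B
    -- β² G^(γ-1) |log G|`.
    set p : ℝ := κ * X ^ (2 * ζ - 1) / (β ^ 2 * Real.log X) with hp
    have hp0 : 0 < p := by positivity
    have hpL : 4 * L * p ≤ 1 := by
      have h1 : X ^ (2 * ζ - 1) ≤ 1 := Real.rpow_le_one_of_one_le_of_nonpos
        (by linarith [Real.add_one_le_exp (1 : ℝ)]) (by linarith)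
      rw [hp, mul_div_assoc', div_le_one (by positivity)]
      rw [div_le_iff₀ hβ2] at hlog2
      calc 4 * L * (κ * X ^ (2 * ζ - 1)) ≤ 4 * L * (κ * 1) := by gcongr
        _ = 4 * L * κ := by ring
        _ ≤ -Real.log G * β ^ 2 := hlog2
        _ ≤ Real.log X * β ^ 2 := mul_le_mul_of_nonneg_right hlogXG hβ2.le
        _ = _ := mul_comm _ _
    have h1 := hmain β (hc + v) (hc + v') p hβ (by linarith) hp0 hG (hgv.trans hF₀1.le) hpL
      fun n hn => by
        have hn1 : (1 : ℝ) ≤ n := by exact_mod_cast (by omega : 1 ≤ n)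
        have h2 := rpow_mul_log_le hζ hXe hn1
        rw [hXG] at h2
        change β ^ 2 * p * n * Real.log n ≤ κ * ((n : ℝ) ^ ζ + G * n) ^ 2
        calc β ^ 2 * p * n * Real.log n
            = κ / Real.log X * (X ^ (2 * ζ - 1) * (n * Real.log n)) := by
              rw [hp]
              field_simp
          _ ≤ κ / Real.log X * (Real.log X * ((n : ℝ) ^ ζ + G * n) ^ 2) :=
              mul_le_mul_of_nonneg_left h2 (by positivity)
          _ = _ := by field_simp
    change p * (hc + v' - (hc + v)) < g v' - G at h1
    rw [add_sub_add_left_eq_sub] at h1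
    have h2 : B * β ^ 2 * (G ^ (γ - 1) * -Real.log G) * p = 1 := by
      have h3 : G ^ (γ - 1) * G ^ (1 - γ) = 1 := by
        rw [← Real.rpow_add hG]
        simp
      have h4 : Real.log G ≠ 0 := by linarith
      rw [hp, hXα, hlogX, hB]
      calc _ = (G ^ (γ - 1) * G ^ (1 - γ)) *
            (κ * (1 - ζ) / (κ * (1 - ζ)) * (β ^ 2 / β ^ 2) * (Real.log G / Real.log G)) := by
              field_simp
        _ = 1 := by
              rw [h3, div_self (by positivity), div_self hβ2.ne', div_self h4]
              norm_num
    have h5 : 0 < B * β ^ 2 * (G ^ (γ - 1) * -Real.log G) := by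
      have := Real.rpow_pos_of_pos hG (γ - 1)
      have : 0 < -Real.log G := by linarith
      positivity
    have h6 := mul_le_mul_of_nonneg_left h1.le h5.le
    rwa [← mul_assoc, h2, one_mul] at h6
  refine ⟨min F₀ ((γ / (4 * A * β ^ 2)) ^ 2), lt_min hF₀0 (by positivity), fun u hu hu₀ => ?_⟩
  have huF : u < F₀ := hu₀.trans_le (min_le_left _ _)
  have hgu : g u ≤ F₀ := (hcrit.le hμ hK hu.le).trans huF.le
  have hode := le_of_difference_inequality hgcont hgmono (by simp [hg, hcrit.zero]) hgpos hγ0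
    (by positivity : 0 < B * β ^ 2) (F₀ := F₀)
    (Real.exp_le_exp.2 (neg_le_neg (le_max_left _ _))) hstep hu hgu
  have hfin := rpow_le_of_le_rpow_mul_log hγ0 hA0 hβ2 (hgpos u hu) hu
    (huF.trans hF₀1) (hu₀.trans_le (min_le_right _ _)) (hode.trans_eq (by rw [hA]; ring))
  rwa [show (1 - ζ) / ζ = 1 / γ by rw [hγ, one_div_div]]

end Pinning
end

/-! ### Transfer from the law on sequence space to the given environment and renewal process. -/

theorem theorem2p2 {Ω S : Type*} [MeasurableSpace Ω] [MeasurableSpace S]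
    (Pr : Measure Ω) [IsProbabilityMeasure Pr] (P : Measure S) [IsProbabilityMeasure P]
    (ω : ℕ → Ω → ℝ) (hω : Pinning.IsEnvironment ω Pr) (hconc : Pinning.ConvexConcentration ω Pr)
    (ξ : ℕ → S → ℕ) (hξ : Pinning.IsRenewalIncrements ξ P)
    (ζ cK : ℝ) (hζ0 : 0 < ζ) (hζ1 : ζ < 1) (hcK : 0 < cK)
    (hK : Asymptotics.IsEquivalent atTop (fun n : ℕ => Pinning.interarrivalLaw ξ P n)
      (fun n : ℕ => cK * Real.exp (-(n : ℝ) ^ ζ))) :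
    -- the free energy is well defined, as an almost sure limit and as a limit of means
    (∀ β h : ℝ, 0 < β →
      (∀ᵐ w ∂Pr, Tendsto (fun N : ℕ => (N : ℝ)⁻¹ *
          Real.log (Pinning.partitionFunction ξ P β h (fun n => ω n w) N)) atTop
        (𝓝 (Pinning.freeEnergy ω Pr ξ P β h))) ∧
      Tendsto (fun N : ℕ => (N : ℝ)⁻¹ *
          ∫ w, Real.log (Pinning.partitionFunction ξ P β h (fun n => ω n w) N) ∂Pr) atTop
        (𝓝 (Pinning.freeEnergy ω Pr ξ P β h))) ∧
    -- the critical point is well defined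
    (∀ β : ℝ, 0 < β → IsGLB {h : ℝ | 0 < Pinning.freeEnergy ω Pr ξ P β h}
      (Pinning.criticalPoint ω Pr ξ P β)) ∧
    -- (i) first order transition
    (1 / 2 < ζ → ∃ c : ℝ, 0 < c ∧ ∀ β h : ℝ, 0 < β →
      c * min 1 (β ^ 2)⁻¹ * max (h - Pinning.criticalPoint ω Pr ξ P β) 0
        ≤ Pinning.freeEnergy ω Pr ξ P β h) ∧
    -- (ii) transition of finite order
    (ζ ≤ 1 / 2 → ∃ c : ℝ, 0 < c ∧ ∀ β : ℝ, 0 < β → ∃ u₀ : ℝ, 0 < u₀ ∧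
      ∀ u : ℝ, 0 < u → u < u₀ →
        c * (u / (β ^ 2 * |Real.log u|)) ^ ((1 - ζ) / ζ)
          ≤ Pinning.freeEnergy ω Pr ξ P β (Pinning.criticalPoint ω Pr ξ P β + u)) := by
  obtain ⟨C₁, C₂, hμ⟩ := Pinning.IsEnvironment.isStationaryLaw hω hconc
  obtain ⟨r, c₁, c₂, hker⟩ := Pinning.isStretchedKernel_interarrivalLaw hξ hζ0 hζ1 hcK hK
  have hglb : ∀ β : ℝ, IsGLB {h : ℝ | 0 < Pinning.freeEnergy ω Pr ξ P β h}
      (Pinning.criticalPoint ω Pr ξ P β) := by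
    intro β
    unfold Pinning.criticalPoint
    simp_rw [Pinning.freeEnergy_eq hω hξ]
    exact Pinning.isGLB_critical hμ hker β
  have hcrit : ∀ β : ℝ, Pinning.IsCriticalPoint (Pinning.interarrivalLaw ξ P) β
      (Pr.map fun w n => ω n w) (Pinning.criticalPoint ω Pr ξ P β) := by
    intro β
    have h := hglb β
    simp_rw [Pinning.freeEnergy_eq hω hξ] at h
    exact Pinning.isCriticalPoint_of_isGLB hμ hker h
  refine ⟨fun β h hβ => ⟨?_, ?_⟩, fun β _ => hglb β, fun hζ => ?_, fun hζ => ?_⟩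
  · rw [Pinning.freeEnergy_eq hω hξ]
    simp_rw [Pinning.partitionFunction_eq hξ]
    exact ae_of_ae_map (measurable_pi_lambda _ hω.measurable).aemeasurable
      (Pinning.ae_tendsto_freeEnergy hμ hker hβ h)
  · rw [Pinning.freeEnergy_eq hω hξ]
    simp_rw [Pinning.integral_log_partitionFunction hω hξ]
    exact Pinning.tendsto_freeEnergy hμ hker β h
  · obtain ⟨c, hc, hbound⟩ := Pinning.first_order_lower_bound hμ hker hζ
    refine ⟨c, hc, fun β h hβ => ?_⟩
    rw [Pinning.freeEnergy_eq hω hξ β h]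
    exact hbound β h _ hβ (hcrit β)
  · obtain ⟨c, hc, hbound⟩ := Pinning.finite_order_lower_bound hμ hker hζ
    refine ⟨c, hc, fun β hβ => ?_⟩
    obtain ⟨u₀, hu₀, hu⟩ := hbound β _ hβ (hcrit β)
    refine ⟨u₀, hu₀, fun u h0 h1 => ?_⟩
    rw [Pinning.freeEnergy_eq hω hξ]
    exact hu u h0 h1
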